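/- Setting. Let $G$ be a compact connected Lie group, $\theta$ an involutive automorphism of $G$, $G_\theta$ its fixed point group, and $K$ a closed subgroup of $G$ with $G_\theta^0\subset K\subset G_\theta$, where $G_\theta^0$ is the identity component of $G_\theta$. Let $\mathfrak g$ be the Lie algebra of $G$ with an inner product $\langle\ ,\ \rangle$ invariant under $\theta$ and $\mathrm{Ad}(G)$, and let $\mathfrak m=\{X\in\mathfrak g\mid\theta X=-X\}$. Assume that $(G,K)$ is irreducible, i.e. $\mathfrak m\neq 0$ and $K$ acts irreducibly on $\mathfrak m$. Let $\mathfrak a$ be a maximal abelian subspace of $\mathfrak m$. For $\alpha\in\mathfrak a$ put $$\mathfrak g_\alpha=\{X\in\mathfrak g^{\mathbf C}\mid [H,X]=\sqrt{-1}\,\langle\alpha,H\rangle X\ \ (H\in\mathfrak a)\},$$ let $R=\{\alpha\in\mathfrak a\setminus\{0\}\mid\mathfrak g_\alpha\neq 0\}$ be the restricted root system, $m(\alpha)=\dim_{\mathbf C}\mathfrak g_\alpha$ the multiplicity of $\alpha\in R$, and $\mathbf RR=\{x\alpha\mid x\in\mathbf R,\ \alpha\in R\}$. Let $R_+$ be the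 set of positive restricted roots for the lexicographic ordering of $\mathfrak a$ given by a basis of $\mathfrak a$, and $F\subset R_+$ the corresponding fundamental system. For $\Delta\subset F$ let $$C^\Delta=\{H\in\mathfrak a\mid\langle\alpha,H\rangle>0\ (\alpha\in\Delta),\ \langle\beta,H\rangle=0\ (\beta\in F-\Delta)\},\qquad R_+^\Delta=R_+\cap(F-\Delta)_{\mathbf Z},$$ where $(F-\Delta)_{\mathbf Z}$ is the set of integral linear combinations of $F-\Delta$. For $H\in\mathfrak a$ put $P_H=\{\alpha\in R_+\mid\langle\alpha,H\rangle\neq 0\}$. A submanifold $M$ of a Riemannian manifold is called austere if for every normal vector $\xi$ of $M$ the set of eigenvalues of the shape operator $A_\xi$, counted with multiplicities, is invariant under multiplication by $-1$. Statement. Let $H\in\mathfrak a-\mathbf RR$. Then the following hold. (0) $R$ is finite, and if $H\in C^\Delta$ with $\Delta\subset F$, then $P_H=R_+-R_+^\Delta$. (1) The orbit $\mathrm{Ad}(K)H$ is an austere submanifold of the sphere $S$ of radius $\|H\|$ centred at $0$ in $\mathfrak m$ if and only if there exist a mapping $f:P_H\to P_H$ without fixed points and constants $n_\alpha\in\mathbf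 R\setminus\{0\}$, $\epsilon_\alpha=\pm1$ for each $\alpha\in P_H$ such that for every $\alpha\in P_H$ $$H=n_\alpha\left(\frac{\alpha}{\|\alpha\|}+\epsilon_\alpha\frac{f(\alpha)}{\|f(\alpha)\|}\right)\qquad\text{(a)}$$ and $$\sum_{\mu\in P_H,\ \mu\parallel\alpha}m(\mu)=\sum_{\nu\in P_H,\ \nu\parallel f(\alpha)}m(\nu).\qquad\text{(b)}$$ (2) Suppose that $R$ is not of type $BC_l$ for any $l\ge1$, and let $f:P_H\to P_H$ be a mapping without fixed points which satisfies (a) for some constants $n_\alpha\neq0$, $\epsilon_\alpha=\pm1$. Then for each $\alpha\in P_H$ the equality (b) is equivalent to $m(\alpha)=m(f(\alpha))$; moreover $f^2=1$, and the number of elements of $P_H$ is even. -/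

import Mathlib

open Set Bundle
open scoped Manifold ContDiff TensorProduct InnerProductSpace

/-! ### Submanifolds of a Euclidean space and austere submanifolds of a sphere -/

section Austere

variable {W : Type*} [NormedAddCommGroup W] [InnerProductSpace ℝ W]

/-- `M` is a smooth (embedded) submanifold of `W`, of some dimension `d`: every point of `M` has
a neighbourhood in `M` which is diffeomorphic to an open subset of `ℝ^d`. Here `φ` is a local
parametrization, and its inverse is the restriction to `M` of a smooth map `ψ` defined on an open
subset `O` of `W`. -/
def IsSmoothSubmanifold (M : Set W) : Prop :=
  ∃ d : ℕ, ∀ p ∈ M, ∃ (O : Set W) (U : Set (EuclideanSpace ℝ (Fin d)))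
    (φ : EuclideanSpace ℝ (Fin d) → W) (ψ : W → EuclideanSpace ℝ (Fin d)),
    IsOpen O ∧ p ∈ O ∧ IsOpen U ∧ ContDiffOn ℝ ∞ φ U ∧ ContDiffOn ℝ ∞ ψ O ∧
      φ '' U = M ∩ O ∧ ∀ x ∈ U, ψ (φ x) = x

/-- The tangent space `T_p M`: the velocities at `p` of the smooth curves lying in `M`. (For a
submanifold these velocities form a linear subspace; the span makes it one in general.) -/
noncomputable def tangentSpaceOf (M : Set W) (p : W) : Submodule ℝ W :=
  Submodule.span ℝ {v | ∃ c : ℝ → W, ContDiff ℝ ∞ c ∧ (∀ t, c t ∈ M) ∧ c 0 = p ∧ deriv c 0 = v}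

/-- The normal space at `p` of a submanifold `M` of a sphere centred at `0`: the vectors tangent
to the sphere at `p` (that is, orthogonal to `p`) and orthogonal to `T_p M`. -/
noncomputable def sphereNormalSpace (M : Set W) (p : W) : Submodule ℝ W :=
  (ℝ ∙ p)ᗮ ⊓ (tangentSpaceOf M p)ᗮ

/-- The Levi-Civita connection of the sphere centred at `0` through `p`: the derivative at `p` of
the vector field `Y` in the direction `u`, orthogonally projected to the tangent space
`p^⊥` of the sphere. -/
noncomputable def sphereCovDeriv (Y : W → W) (p u : W) : W :=
  (ℝ ∙ p)ᗮ.starProjection (fderiv ℝ Y p u)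

/-- `A` is the shape operator `A_ξ` at `p` of the submanifold `M` of a sphere centred at `0`,
where `ξ` is normal: `⟨A_ξ u, Y_p⟩ = ⟨h(u, Y_p), ξ⟩ = ⟨∇_u Y, ξ⟩` for all `u ∈ T_p M` and all smooth
vector fields `Y` which are tangent to `M` along `M`, where `∇` is the connection of the sphere. -/
def IsShapeOperator (M : Set W) (p ξ : W)
    (A : tangentSpaceOf M p →ₗ[ℝ] tangentSpaceOf M p) : Prop :=
  ∀ (u : tangentSpaceOf M p) (Y : W → W), ContDiff ℝ ∞ Y →
    (∀ q ∈ M, Y q ∈ tangentSpaceOf M q) →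
    ⟪(A u : W), Y p⟫_ℝ = ⟪sphereCovDeriv Y p u, ξ⟫_ℝ

/-- `M` is an austere submanifold of the sphere of radius `r` centred at `0`: at each point and
for each normal vector `ξ`, the set of eigenvalues of the shape operator `A_ξ`, counted with
multiplicities, is invariant under multiplication by `-1`. -/
def IsAustereInSphere (r : ℝ) (M : Set W) : Prop :=
  M ⊆ Metric.sphere 0 r ∧ IsSmoothSubmanifold M ∧
    ∀ p ∈ M, ∀ ξ ∈ sphereNormalSpace M p,
      ∃ A : tangentSpaceOf M p →ₗ[ℝ] tangentSpaceOf M p, IsShapeOperator M p ξ A ∧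
        ∀ c : ℝ, Module.finrank ℝ (Module.End.eigenspace A c) =
          Module.finrank ℝ (Module.End.eigenspace A (-c))

end Austere

/-! ### Lie groups and symmetric pairs -/

instance instLEInftyMinSmoothnessReal : ENat.LEInfty (minSmoothness ℝ 3) :=
  ⟨by rw [minSmoothness_of_isRCLikeNormedField]; exact ENat.LEInfty.out⟩

section LieGroup

variable {d : ℕ} {G : Type*} [TopologicalSpace G] [ChartedSpace (EuclideanSpace ℝ (Fin d)) G]
  [Group G]

/-- The adjoint representation: `Ad g` is the differential at `1` of `x ↦ g x g⁻¹`. -/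
noncomputable def lieAd (g : G) : GroupLieAlgebra (𝓡 d) G →L[ℝ] GroupLieAlgebra (𝓡 d) G :=
  mfderiv (𝓡 d) (𝓡 d) (fun x : G => g * x * g⁻¹) 1

/-- The endomorphism of the Lie algebra induced by an endomorphism `θ` of the group. -/
noncomputable def lieDiff (θ : G →* G) : GroupLieAlgebra (𝓡 d) G →L[ℝ] GroupLieAlgebra (𝓡 d) G :=
  mfderiv (𝓡 d) (𝓡 d) (fun x : G => θ x) 1

/-- `(G, K)` is a symmetric pair with respect to `θ`: `θ` is an involutive automorphism of the Lie
group `G` and `K` is a closed subgroup lying between the fixed point group of `θ` and its identity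
component. -/
structure IsSymmetricPair (d : ℕ) {G : Type*} [TopologicalSpace G]
    [ChartedSpace (EuclideanSpace ℝ (Fin d)) G] [Group G] (θ : G →* G) (K : Subgroup G) :
    Prop where
  smooth : ContMDiff (𝓡 d) (𝓡 d) ∞ (fun x : G => θ x)
  involutive : ∀ x, θ (θ x) = x
  isClosed : IsClosed (K : Set G)
  identityComponent_subset : connectedComponentIn {x : G | θ x = x} 1 ⊆ K
  subset_fixed : (K : Set G) ⊆ {x : G | θ x = x}

/-- The subspace `𝔪 = {X ∈ 𝔤 | θ X = -X}`. -/
noncomputable def mSpace (d : ℕ) {G : Type*} [TopologicalSpace G]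
    [ChartedSpace (EuclideanSpace ℝ (Fin d)) G] [Group G] (θ : G →* G) :
    Submodule ℝ (GroupLieAlgebra (𝓡 d) G) where
  carrier := {X | lieDiff θ X = -X}
  add_mem' {X Y} hX hY := by
    change lieDiff θ (X + Y) = -(X + Y)
    rw [map_add, show lieDiff θ X = -X from hX, show lieDiff θ Y = -Y from hY, neg_add]
  zero_mem' := by simp
  smul_mem' c X hX := by
    change lieDiff θ (c • X) = -(c • X)
    rw [map_smul, show lieDiff θ X = -X from hX, smul_neg]

/-- The symmetric pair is irreducible: `𝔪` is an irreducible representation of `K`. -/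
def IsIrreduciblePair (d : ℕ) {G : Type*} [TopologicalSpace G]
    [ChartedSpace (EuclideanSpace ℝ (Fin d)) G] [Group G] (θ : G →* G) (K : Subgroup G) : Prop :=
  mSpace d θ ≠ ⊥ ∧ ∀ V : Submodule ℝ (GroupLieAlgebra (𝓡 d) G), V ≤ mSpace d θ →
    (∀ k ∈ K, ∀ X ∈ V, lieAd k X ∈ V) → V = ⊥ ∨ V = mSpace d θ

/-- `𝔞` is a maximal abelian subspace of `𝔪`. -/
def IsMaximalAbelianIn (θ : G →* G) (𝔞 : Submodule ℝ (GroupLieAlgebra (𝓡 d) G)) : Prop :=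
  Maximal (fun 𝔟 : Submodule ℝ (GroupLieAlgebra (𝓡 d) G) =>
    𝔟 ≤ mSpace d θ ∧ ∀ X ∈ 𝔟, ∀ Y ∈ 𝔟, ⁅X, Y⁆ = 0) 𝔞

/-- The endomorphism `Y ↦ [X, Y]` of the Lie algebra. -/
noncomputable def bracketLeft [LieGroup (𝓡 d) ∞ G] (X : GroupLieAlgebra (𝓡 d) G) :
    GroupLieAlgebra (𝓡 d) G →ₗ[ℝ] GroupLieAlgebra (𝓡 d) G where
  toFun Y := ⁅X, Y⁆
  map_add' Y Z := lie_add X Y Z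
  map_smul' c Y := lie_smul c X Y

variable [RiemannianBundle (fun x : G => TangentSpace (𝓡 d) x)]

/-- The norm and the inner product on `𝔤 = T_1 G` given by the inner products on the tangent
spaces of `G`. -/
noncomputable instance instNormedAddCommGroupLieAlg :
    NormedAddCommGroup (GroupLieAlgebra (𝓡 d) G) :=
  inferInstanceAs (NormedAddCommGroup ((fun x : G => TangentSpace (𝓡 d) x) 1))

noncomputable instance instInnerProductSpaceLieAlg :
    InnerProductSpace ℝ (GroupLieAlgebra (𝓡 d) G) :=
  inferInstanceAs (InnerProductSpace ℝ ((fun x : G => TangentSpace (𝓡 d) x) 1))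

/-- The inner product on the Lie algebra `𝔤 = T_1 G` is invariant under `θ` and under the adjoint
representation of `G`. -/
def IsInvariantInner (d : ℕ) {G : Type*} [TopologicalSpace G]
    [ChartedSpace (EuclideanSpace ℝ (Fin d)) G] [Group G]
    [RiemannianBundle (fun x : G => TangentSpace (𝓡 d) x)] (θ : G →* G) : Prop :=
  (∀ X Y : GroupLieAlgebra (𝓡 d) G, ⟪lieDiff θ X, lieDiff θ Y⟫_ℝ = ⟪X, Y⟫_ℝ) ∧
    ∀ (g : G) (X Y : GroupLieAlgebra (𝓡 d) G), ⟪lieAd g X, lieAd g Y⟫_ℝ = ⟪X, Y⟫_ℝ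

/-- The orbit `Ad(K)H` in `𝔪` of the linear isotropy representation. -/
def isotropyOrbit (θ : G →* G) (K : Subgroup G) (H : GroupLieAlgebra (𝓡 d) G) :
    Set (mSpace d θ) :=
  {X | ∃ k ∈ K, (X : GroupLieAlgebra (𝓡 d) G) = lieAd k H}

/-! ### Restricted roots -/

variable [LieGroup (𝓡 d) ∞ G] (𝔞 : Submodule ℝ (GroupLieAlgebra (𝓡 d) G))

/-- The space `𝔤_α = {X ∈ 𝔤^ℂ | [H, X] = √-1 ⟨α, H⟩ X for all H ∈ 𝔞}`, where
`𝔤^ℂ = ℂ ⊗ 𝔤` is the complexification of `𝔤`. -/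
noncomputable def restrictedRootSpace (α : 𝔞) :
    Submodule ℂ (ℂ ⊗[ℝ] GroupLieAlgebra (𝓡 d) G) :=
  ⨅ H : 𝔞, Module.End.eigenspace ((bracketLeft (H : GroupLieAlgebra (𝓡 d) G)).baseChange ℂ)
    (Complex.I * (⟪α, H⟫_ℝ : ℂ))

/-- The restricted root system `R ⊆ 𝔞`. -/
def restrictedRoots : Set 𝔞 :=
  {α | α ≠ 0 ∧ restrictedRootSpace 𝔞 α ≠ ⊥}

/-- The multiplicity `m(α) = dim 𝔤_α` of a restricted root. -/
noncomputable def rootMult (α : 𝔞) : ℕ :=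
  Module.finrank ℂ (restrictedRootSpace 𝔞 α)

variable {𝔞} {r : ℕ} (b : Module.Basis (Fin r) ℝ 𝔞)

/-- The positive restricted roots `R_+` for the lexicographic ordering of `𝔞` with respect to the
basis `b`: the first nonzero coordinate is positive. -/
def positiveRoots : Set 𝔞 :=
  {α | α ∈ restrictedRoots 𝔞 ∧ ∃ i, (∀ j < i, b.repr α j = 0) ∧ 0 < b.repr α i}

/-- The fundamental system `F` of `R`: the positive roots which are not the sum of two positive
roots. -/
def simpleRoots : Set 𝔞 :=
  {α | α ∈ positiveRoots b ∧ ¬ ∃ β ∈ positiveRoots b, ∃ γ ∈ positiveRoots b, α = β + γ}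

/-- The face `C^Δ` of the closed Weyl chamber. -/
def chamberFace (Δ : Set 𝔞) : Set 𝔞 :=
  {H | (∀ α ∈ simpleRoots b, 0 ≤ ⟪α, H⟫_ℝ) ∧ (∀ α ∈ Δ, 0 < ⟪α, H⟫_ℝ) ∧
    ∀ β ∈ simpleRoots b \ Δ, ⟪β, H⟫_ℝ = 0}

/-- `R_+^Δ = R_+ ∩ (F - Δ)_ℤ`, where `(F - Δ)_ℤ` is the set of integral combinations of `F - Δ`. -/
def positiveRootsOfFace (Δ : Set 𝔞) : Set 𝔞 :=
  positiveRoots b ∩ (Submodule.span ℤ (simpleRoots b \ Δ) : Set 𝔞)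

/-- The positive restricted roots which are not orthogonal to `H`; for `H ∈ C^Δ` this is
`R_+ - R_+^Δ`. -/
def rootsNotOrthogonal (H : 𝔞) : Set 𝔞 :=
  {α | α ∈ positiveRoots b ∧ ⟪α, H⟫_ℝ ≠ 0}

/-- The sum of the multiplicities of the elements `μ` of `P` which are parallel to `α`. -/
noncomputable def parallelMult (P : Set 𝔞) (α : 𝔞) : ℕ :=
  ∑ᶠ μ ∈ {μ | μ ∈ P ∧ ∃ c : ℝ, μ = c • α}, rootMult 𝔞 μ

/-- `f` has no fixed points, and there are constants `n_α ≠ 0` and `ε_α = ±1` such that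
`H = n_α (α / ‖α‖ + ε_α f(α) / ‖f(α)‖)` for every `α` in `P`. -/
def IsAusterePairing (H : 𝔞) {P : Set 𝔞} (f : P → P) : Prop :=
  (∀ α, f α ≠ α) ∧ ∃ n ε : P → ℝ, ∀ α : P, n α ≠ 0 ∧ (ε α = 1 ∨ ε α = -1) ∧
    H = n α • (‖(α : 𝔞)‖⁻¹ • (α : 𝔞) + ε α • ‖(f α : 𝔞)‖⁻¹ • (f α : 𝔞))

/-- `R` is of type `BC_l`: for some orthonormal basis `e` of `𝔞` and some `c > 0`, it consists of
the vectors `± c e_i`, `± 2 c e_i` and `c (± e_i ± e_j)` with `i < j`. -/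
def IsTypeBC (R : Set 𝔞) : Prop :=
  ∃ (l : ℕ) (e : OrthonormalBasis (Fin l) ℝ 𝔞) (c : ℝ), 1 ≤ l ∧ 0 < c ∧
    R = {α | ∃ i, ∃ s ∈ ({1, -1, 2, -2} : Set ℝ), α = (s * c) • e i} ∪
      {α | ∃ i j, i < j ∧ ∃ s ∈ ({1, -1} : Set ℝ), ∃ t ∈ ({1, -1} : Set ℝ),
        α = c • (s • e i + t • e j)}

end LieGroup

/-! The tangent space of the orbit at H is [𝔨, H], and by invariance of the inner product a normal
vector ξ ∈ 𝔪 commutes with H. Such a ξ can be carried into 𝔞 by an element of K that fixes H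
(`IsotropyRep.exists_ρ_mem`), so austerity only has to be tested at H and for η ∈ 𝔞 with ⟨H, η⟩ = 0.
There [𝔨, H] is the orthogonal sum of the spaces 𝔪_α, α ∈ P_H, of dimension m(α), and A_η acts on
𝔪_α as the scalar -⟨α, η⟩ / ⟨α, H⟩ (`IsotropyRep.isSymmetricShape_iff`).

With w_α = α / ⟨α, H⟩ - H / ‖H‖² (`principalDir`) this scalar is -⟨w_α, η⟩. Austerity thus says that
for every η ⊥ H the weighted family of the numbers ⟨w_α, η⟩ is symmetric about 0. A generic η
separates the finitely many vectors ±w_α, so this is the same as symmetry of the weighted family of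
the vectors w_α themselves (`forall_sum_eq_iff_exists_pairing`). Two facts translate this into the
statement: w_α = w_β exactly when α and β are parallel, and w_β = -w_α exactly when H is a multiple
n(α/‖α‖ ± β/‖β‖) with n ≠ 0 (`exists_eq_smul_add_iff`). Since H is not a multiple of a root, no w_α
vanishes, and f has no fixed points.

If R is reduced, α ↦ w_α is injective on P_H, so w_{f(α)} = -w_α forces f² = 1, and a
fixed-point-free involution of a finite set gives an even cardinality (`IsPairing.of_reduced`). That
a non-reduced R is of type BC rests on R being an irreducible crystallographic root system:
integrality and reflections come from sl₂-triples (`SymmetricLie.exists_int_and_reflect`),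
irreducibility from the ideal centralizing a part of the root spaces
(`SymmetricLie.IsIrreducible.roots_irreducible`). The classification is
`IsIrreducibleRootSet.exists_orthonormalBasis`. The description of P_H on a face of the chamber is
an induction along the lexicographic order (`inner_nonneg_and_mem_span`).

The group enters only through Ad, and `IsotropyRep` and `SmoothAction` record what is needed: a
smooth parametrization of Ad near the identity by the fixed vectors of θ, whose logarithmic
derivatives are brackets. It is obtained by computing in a chart that ad is the derivative of Ad
(`fderiv_modelAd`) and by linearizing θ near 1 (`exists_linearizing_chart`). From it follow that an
orbit is locally a graph over its tangent space (`SmoothAction.exists_graph`) and the formula for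
its shape operator (`SmoothAction.isShapeOperator_iff`). -/

set_option linter.unusedSectionVars false

/-! ### The group law and the adjoint representation in a chart at the identity. -/

section LieChart

open Filter Topology

variable {d : ℕ} {G : Type*} [TopologicalSpace G] [ChartedSpace (EuclideanSpace ℝ (Fin d)) G]
  [Group G]

/-- The preferred chart at the identity. -/
noncomputable def oneChart (d : ℕ) (G : Type*) [TopologicalSpace G]
    [ChartedSpace (EuclideanSpace ℝ (Fin d)) G] [Group G] :
    PartialEquiv G (EuclideanSpace ℝ (Fin d)) :=
  extChartAt (𝓡 d) (1 : G)

/-- The group multiplication in the chart at the identity. -/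
noncomputable def chartMul (d : ℕ) (G : Type*) [TopologicalSpace G]
    [ChartedSpace (EuclideanSpace ℝ (Fin d)) G] [Group G]
    (p : EuclideanSpace ℝ (Fin d) × EuclideanSpace ℝ (Fin d)) : EuclideanSpace ℝ (Fin d) :=
  oneChart d G ((oneChart d G).symm p.1 * (oneChart d G).symm p.2)

theorem oneChart_symm_one : (oneChart d G).symm (oneChart d G 1) = 1 :=
  extChartAt_to_inv 1

theorem oneChart_one_mem_target : oneChart d G 1 ∈ (oneChart d G).target :=
  mem_extChartAt_target 1

theorem isOpen_oneChart_target : IsOpen (oneChart d G).target :=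
  isOpen_extChartAt_target 1

theorem oneChart_source_mem_nhds : (oneChart d G).source ∈ 𝓝 (1 : G) :=
  extChartAt_source_mem_nhds 1

theorem mem_chartAt_source_of_mem {g : G} (hg : g ∈ (oneChart d G).source) :
    g ∈ (chartAt (EuclideanSpace ℝ (Fin d)) (1 : G)).source := by
  rwa [oneChart, extChartAt_source] at hg

variable [LieGroup (𝓡 d) ∞ G]

theorem contMDiffAt_oneChart {g : G} (hg : g ∈ (oneChart d G).source) :
    ContMDiffAt (𝓡 d) 𝓘(ℝ, EuclideanSpace ℝ (Fin d)) ∞ (oneChart d G) g :=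
  contMDiffAt_extChartAt' (mem_chartAt_source_of_mem hg)

theorem contMDiffAt_oneChart_symm {x : EuclideanSpace ℝ (Fin d)}
    (hx : x ∈ (oneChart d G).target) :
    ContMDiffAt 𝓘(ℝ, EuclideanSpace ℝ (Fin d)) (𝓡 d) ∞ (oneChart d G).symm x :=
  (contMDiffOn_extChartAt_symm (n := ∞) (1 : G)).contMDiffAt
    (isOpen_oneChart_target.mem_nhds hx)

/-- A map into the group which is smooth and takes a value in the chart domain is smooth in the
chart. -/
theorem contDiffAt_oneChart_comp {V : Type*} [NormedAddCommGroup V] [NormedSpace ℝ V]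
    {f : V → G} {v : V} (hf : ContMDiffAt 𝓘(ℝ, V) (𝓡 d) ∞ f v)
    (hv : f v ∈ (oneChart d G).source) : ContDiffAt ℝ ∞ (fun x => oneChart d G (f x)) v :=
  ((contMDiffAt_oneChart hv).comp v hf).contDiffAt

theorem contDiffAt_chartMul {p : EuclideanSpace ℝ (Fin d) × EuclideanSpace ℝ (Fin d)}
    (h1 : p.1 ∈ (oneChart d G).target) (h2 : p.2 ∈ (oneChart d G).target)
    (h : (oneChart d G).symm p.1 * (oneChart d G).symm p.2 ∈ (oneChart d G).source) :
    ContDiffAt ℝ ∞ (chartMul d G) p := by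
  refine contDiffAt_oneChart_comp ?_ h
  refine ContMDiffAt.mul ?_ ?_
  · exact (contMDiffAt_oneChart_symm h1).comp p contDiffAt_fst.contMDiffAt
  · exact (contMDiffAt_oneChart_symm h2).comp p contDiffAt_snd.contMDiffAt

omit [LieGroup (𝓡 d) ∞ G] in
-- As f fixes the identity, the same chart serves at source and target, and the manifold derivative
-- is an ordinary derivative.
theorem mfderiv_one_eq_fderiv {f : G → G} (hf : MDifferentiableAt (𝓡 d) (𝓡 d) f 1) (h1 : f 1 = 1) :
    (mfderiv (𝓡 d) (𝓡 d) f 1 : EuclideanSpace ℝ (Fin d) →L[ℝ] EuclideanSpace ℝ (Fin d)) =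
      fderiv ℝ (fun x => oneChart d G (f ((oneChart d G).symm x))) (oneChart d G 1) := by
  have : writtenInExtChartAt (𝓡 d) (𝓡 d) (1 : G) f =
      fun x => oneChart d G (f ((oneChart d G).symm x)) := by
    ext1 x
    simp [writtenInExtChartAt, h1, oneChart]
  have h : (mfderiv (𝓡 d) (𝓡 d) f 1 : EuclideanSpace ℝ (Fin d) →L[ℝ] EuclideanSpace ℝ (Fin d)) =
      fderivWithin ℝ (writtenInExtChartAt (𝓡 d) (𝓡 d) (1 : G) f) (range (𝓡 d))
        (extChartAt (𝓡 d) (1 : G) 1) := hf.mfderiv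
  rw [h, this, modelWithCornersSelf_coe, range_id, fderivWithin_univ, oneChart]

theorem contMDiff_conj (g : G) : ContMDiff (𝓡 d) (𝓡 d) ∞ (fun x : G => g * x * g⁻¹) :=
  (contMDiff_mul_right (a := g⁻¹)).comp (contMDiff_mul_left (a := g))

/-- The adjoint representation as an endomorphism of the model space. -/
noncomputable def modelAd (d : ℕ) {G : Type*} [TopologicalSpace G]
    [ChartedSpace (EuclideanSpace ℝ (Fin d)) G] [Group G] (g : G) :
    EuclideanSpace ℝ (Fin d) →L[ℝ] EuclideanSpace ℝ (Fin d) :=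
  fderiv ℝ (fun x => oneChart d G (g * (oneChart d G).symm x * g⁻¹)) (oneChart d G 1)

theorem lieAd_eq_modelAd (g : G) :
    (lieAd g : EuclideanSpace ℝ (Fin d) →L[ℝ] EuclideanSpace ℝ (Fin d)) = modelAd d g :=
  mfderiv_one_eq_fderiv ((contMDiff_conj g 1).mdifferentiableAt (by simp)) (by simp)

/-- A smooth map of the group to itself fixing the identity, in the chart. -/
theorem contDiffAt_chart_map {f : G → G} (hf : ContMDiff (𝓡 d) (𝓡 d) ∞ f) (h1 : f 1 = 1) :
    ContDiffAt ℝ ∞ (fun x => oneChart d G (f ((oneChart d G).symm x))) (oneChart d G 1) := by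
  refine contDiffAt_oneChart_comp (f := fun x => f ((oneChart d G).symm x)) ?_ ?_
  · exact (hf _).comp _ (contMDiffAt_oneChart_symm oneChart_one_mem_target)
  · rw [oneChart_symm_one, h1]
    exact mem_of_mem_nhds oneChart_source_mem_nhds

theorem modelAd_mul (g h : G) : modelAd d (g * h) = (modelAd d g).comp (modelAd d h) := by
  have hh := contDiffAt_chart_map (contMDiff_conj (d := d) h) (by simp)
  have hg := contDiffAt_chart_map (contMDiff_conj (d := d) g) (by simp)
  have e : oneChart d G (h * (oneChart d G).symm (oneChart d G 1) * h⁻¹) = oneChart d G 1 := by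
    rw [oneChart_symm_one]; simp
  have := fderiv_comp (oneChart d G 1)
    (g := fun x => oneChart d G (g * (oneChart d G).symm x * g⁻¹))
    (f := fun x => oneChart d G (h * (oneChart d G).symm x * h⁻¹))
    (by rw [e]; exact hg.differentiableAt (by simp)) (hh.differentiableAt (by simp))
  rw [e] at this
  rw [modelAd, modelAd, modelAd, ← this]
  apply Filter.EventuallyEq.fderiv_eq
  have hc : ContinuousAt (fun x => h * (oneChart d G).symm x * h⁻¹) (oneChart d G 1) :=
    (((contMDiff_conj (d := d) h) _).comp _
      (contMDiffAt_oneChart_symm oneChart_one_mem_target)).continuousAt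
  have hm : ∀ᶠ x in 𝓝 (oneChart d G 1), h * (oneChart d G).symm x * h⁻¹ ∈ (oneChart d G).source := by
    apply hc
    simpa [oneChart_symm_one] using oneChart_source_mem_nhds
  filter_upwards [hm] with x hx
  simp only [Function.comp]
  rw [(oneChart d G).left_inv hx]
  group

theorem modelAd_one : modelAd d (1 : G) = ContinuousLinearMap.id ℝ _ := by
  rw [modelAd, ← fderiv_id (𝕜 := ℝ) (x := oneChart d G 1)]
  apply Filter.EventuallyEq.fderiv_eq
  filter_upwards [isOpen_oneChart_target.mem_nhds oneChart_one_mem_target] with x hx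
  simp [(oneChart d G).right_inv hx]

theorem contDiffAt_chart_conj {p : EuclideanSpace ℝ (Fin d) × EuclideanSpace ℝ (Fin d)}
    (h1 : p.1 ∈ (oneChart d G).target) (h2 : p.2 = oneChart d G 1) :
    ContDiffAt ℝ ∞ (fun p : EuclideanSpace ℝ (Fin d) × EuclideanSpace ℝ (Fin d) =>
      oneChart d G ((oneChart d G).symm p.1 * (oneChart d G).symm p.2 *
        ((oneChart d G).symm p.1)⁻¹)) p := by
  refine contDiffAt_oneChart_comp ?_ ?_
  · have a : ContMDiffAt 𝓘(ℝ, EuclideanSpace ℝ (Fin d) × EuclideanSpace ℝ (Fin d)) (𝓡 d) ∞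
        (fun p => (oneChart d G).symm p.1) p :=
      (contMDiffAt_oneChart_symm h1).comp p contDiffAt_fst.contMDiffAt
    have b : ContMDiffAt 𝓘(ℝ, EuclideanSpace ℝ (Fin d) × EuclideanSpace ℝ (Fin d)) (𝓡 d) ∞
        (fun p => (oneChart d G).symm p.2) p :=
      (contMDiffAt_oneChart_symm (h2 ▸ oneChart_one_mem_target)).comp p
        contDiffAt_snd.contMDiffAt
    exact (a.mul b).mul a.inv
  · rw [h2, oneChart_symm_one]
    simpa using mem_of_mem_nhds oneChart_source_mem_nhds

/-- `Ad` is smooth in the chart. -/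
theorem contDiffAt_modelAd {x : EuclideanSpace ℝ (Fin d)} (hx : x ∈ (oneChart d G).target) :
    ContDiffAt ℝ ∞ (fun x => modelAd d ((oneChart d G).symm x)) x :=
  ContDiffAt.fderiv (n := ∞) (m := ∞) (g := fun _ => oneChart d G 1)
    (f := fun x y => oneChart d G ((oneChart d G).symm x * (oneChart d G).symm y *
        ((oneChart d G).symm x)⁻¹)) (contDiffAt_chart_conj hx rfl) contDiffAt_const (by simp)

theorem chartMul_one_left {x : EuclideanSpace ℝ (Fin d)} (hx : x ∈ (oneChart d G).target) :
    chartMul d G (oneChart d G 1, x) = x := by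
  simp [chartMul, oneChart_symm_one, (oneChart d G).right_inv hx]

theorem chartMul_one_right {x : EuclideanSpace ℝ (Fin d)} (hx : x ∈ (oneChart d G).target) :
    chartMul d G (x, oneChart d G 1) = x := by
  simp [chartMul, oneChart_symm_one, (oneChart d G).right_inv hx]

theorem contDiffAt_chartMul_one_left {x : EuclideanSpace ℝ (Fin d)}
    (hx : x ∈ (oneChart d G).target) : ContDiffAt ℝ ∞ (chartMul d G) (oneChart d G 1, x) := by
  refine contDiffAt_chartMul oneChart_one_mem_target hx ?_
  rw [oneChart_symm_one]
  simpa using (oneChart d G).map_target hx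

theorem contDiffAt_chartMul_one_right {x : EuclideanSpace ℝ (Fin d)}
    (hx : x ∈ (oneChart d G).target) : ContDiffAt ℝ ∞ (chartMul d G) (x, oneChart d G 1) := by
  refine contDiffAt_chartMul hx oneChart_one_mem_target ?_
  rw [oneChart_symm_one]
  simpa using (oneChart d G).map_target hx

/-- This is the identity (g y g⁻¹) g = g y differentiated in y at the identity: right translation of
Ad(g)Y agrees with left translation of Y. -/
theorem fderiv_chartMul_comp_modelAd {x : EuclideanSpace ℝ (Fin d)}
    (hx : x ∈ (oneChart d G).target) (Y : EuclideanSpace ℝ (Fin d)) :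
    fderiv ℝ (chartMul d G) (oneChart d G 1, x) (modelAd d ((oneChart d G).symm x) Y, 0) =
      fderiv ℝ (chartMul d G) (x, oneChart d G 1) (0, Y) := by
  set g := (oneChart d G).symm x with hg
  have hc := contDiffAt_chart_map (contMDiff_conj (d := d) g) (by simp)
  have e : oneChart d G (g * (oneChart d G).symm (oneChart d G 1) * g⁻¹) = oneChart d G 1 := by
    rw [oneChart_symm_one]; simp
  have hc' : HasFDerivAt (fun y => oneChart d G (g * (oneChart d G).symm y * g⁻¹)) (modelAd d g)
      (oneChart d G 1) := (hc.differentiableAt (by simp)).hasFDerivAt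
  have h1 : HasFDerivAt (chartMul d G) (fderiv ℝ (chartMul d G) (oneChart d G 1, x))
      ((fun y => (oneChart d G (g * (oneChart d G).symm y * g⁻¹), x)) (oneChart d G 1)) := by
    simp only [e]
    exact ((contDiffAt_chartMul_one_left hx).differentiableAt (by simp)).hasFDerivAt
  have h2 : HasFDerivAt (chartMul d G) (fderiv ℝ (chartMul d G) (x, oneChart d G 1))
      ((fun y => (x, y)) (oneChart d G 1)) :=
    ((contDiffAt_chartMul_one_right hx).differentiableAt (by simp)).hasFDerivAt
  have k1 := h1.comp (oneChart d G 1) (hc'.prodMk (hasFDerivAt_const x _))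
  have k2 := h2.comp (oneChart d G 1)
    ((hasFDerivAt_const x (oneChart d G 1)).prodMk (hasFDerivAt_id (𝕜 := ℝ) (oneChart d G 1)))
  have hcc : ContinuousAt (fun y => g * (oneChart d G).symm y * g⁻¹) (oneChart d G 1) :=
    (((contMDiff_conj (d := d) g) _).comp _
      (contMDiffAt_oneChart_symm oneChart_one_mem_target)).continuousAt
  have hm : ∀ᶠ y in 𝓝 (oneChart d G 1), g * (oneChart d G).symm y * g⁻¹ ∈ (oneChart d G).source := by
    apply hcc
    simpa [oneChart_symm_one] using oneChart_source_mem_nhds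
  have hev : (chartMul d G ∘ fun y => (oneChart d G (g * (oneChart d G).symm y * g⁻¹), x)) =ᶠ[
      𝓝 (oneChart d G 1)] (chartMul d G ∘ fun y => (x, y)) := by
    filter_upwards [hm] with y hy
    simp only [Function.comp, chartMul]
    rw [(oneChart d G).left_inv hy, ← hg]
    group
  have := (k1.congr_of_eventuallyEq hev.symm).unique k2
  have := congrArg (fun L => L Y) this
  simpa using this

/-- The derivative of the adjoint representation at the identity, in terms of the second derivative
of the multiplication. -/
theorem fderiv_modelAd_eq (X Y : EuclideanSpace ℝ (Fin d)) :
    fderiv ℝ (fun x => modelAd d ((oneChart d G).symm x)) (oneChart d G 1) X Y =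
      fderiv ℝ (fderiv ℝ (chartMul d G)) (oneChart d G 1, oneChart d G 1) (X, 0) (0, Y) -
      fderiv ℝ (fderiv ℝ (chartMul d G)) (oneChart d G 1, oneChart d G 1) (Y, 0) (0, X) := by
  set x0 := oneChart d G 1 with hx0
  have hA : HasFDerivAt (fun x => modelAd d ((oneChart d G).symm x))
      (fderiv ℝ (fun x => modelAd d ((oneChart d G).symm x)) x0) x0 :=
    ((contDiffAt_modelAd oneChart_one_mem_target).differentiableAt (by simp)).hasFDerivAt
  have hmu := contDiffAt_chartMul_one_left (d := d) (G := G) oneChart_one_mem_target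
  have hD : HasFDerivAt (fderiv ℝ (chartMul d G))
      (fderiv ℝ (fderiv ℝ (chartMul d G)) (x0, x0)) (x0, x0) :=
    ((hmu.fderiv_right (m := 1) (by norm_cast)).differentiableAt (by simp)).hasFDerivAt
  have hsymm : IsSymmSndFDerivAt ℝ (chartMul d G) (x0, x0) :=
    hmu.isSymmSndFDerivAt (by simp [minSmoothness_of_isRCLikeNormedField]; norm_cast)
  have hl : HasFDerivAt (fun x => fderiv ℝ (chartMul d G) (x0, x))
      ((fderiv ℝ (fderiv ℝ (chartMul d G)) (x0, x0)).comp
        (ContinuousLinearMap.inr ℝ _ _)) x0 :=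
    HasFDerivAt.comp x0 (g := fderiv ℝ (chartMul d G)) (f := fun x => (x0, x)) hD
      ((hasFDerivAt_const x0 x0).prodMk (hasFDerivAt_id (𝕜 := ℝ) x0))
  have hr : HasFDerivAt (fun x => fderiv ℝ (chartMul d G) (x, x0))
      ((fderiv ℝ (fderiv ℝ (chartMul d G)) (x0, x0)).comp
        (ContinuousLinearMap.inl ℝ _ _)) x0 :=
    HasFDerivAt.comp x0 (g := fderiv ℝ (chartMul d G)) (f := fun x => (x, x0)) hD
      ((hasFDerivAt_id (𝕜 := ℝ) x0).prodMk (hasFDerivAt_const x0 x0))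
  have hAY : HasFDerivAt (fun x => ContinuousLinearMap.inl ℝ (EuclideanSpace ℝ (Fin d))
      (EuclideanSpace ℝ (Fin d)) (modelAd d ((oneChart d G).symm x) Y)) _ x0 :=
    (ContinuousLinearMap.inl ℝ (EuclideanSpace ℝ (Fin d))
      (EuclideanSpace ℝ (Fin d))).hasFDerivAt.comp x0 (hA.clm_apply (hasFDerivAt_const Y x0))
  -- The identity of `fderiv_chartMul_comp_modelAd` is differentiated once more, now in the group
  -- variable x at the identity, with the product rule on each side.
  have h1 := hl.clm_apply hAY
  have h2 := hr.clm_apply (hasFDerivAt_const (0, Y) x0)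
  have hev : (fun x => fderiv ℝ (chartMul d G) (x0, x)
      (ContinuousLinearMap.inl ℝ (EuclideanSpace ℝ (Fin d))
      (EuclideanSpace ℝ (Fin d)) (modelAd d ((oneChart d G).symm x) Y))) =ᶠ[𝓝 x0]
      (fun x => fderiv ℝ (chartMul d G) (x, x0) (0, Y)) := by
    filter_upwards [isOpen_oneChart_target.mem_nhds oneChart_one_mem_target] with x hx
    exact fderiv_chartMul_comp_modelAd hx Y
  have key := congrArg (fun L => L X) ((h1.congr_of_eventuallyEq hev.symm).unique h2)
  have hid : ∀ Z, fderiv ℝ (chartMul d G) (x0, x0) (Z, 0) = Z := by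
    intro Z
    have : HasFDerivAt (chartMul d G ∘ fun y => (y, x0)) _ x0 :=
      HasFDerivAt.comp x0 (g := chartMul d G)
        (hmu.differentiableAt (by simp)).hasFDerivAt
        ((hasFDerivAt_id (𝕜 := ℝ) x0).prodMk (hasFDerivAt_const x0 x0))
    have h' : HasFDerivAt (chartMul d G ∘ fun y => (y, x0)) (ContinuousLinearMap.id ℝ _) x0 := by
      refine (hasFDerivAt_id x0).congr_of_eventuallyEq ?_
      filter_upwards [isOpen_oneChart_target.mem_nhds oneChart_one_mem_target] with x hx
      exact chartMul_one_right hx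
    simpa using congrArg (fun L => L Z) (this.unique h')
  simp [x0, oneChart_symm_one, modelAd_one] at key
  simp only [← hx0] at key
  rw [hid] at key
  -- The product rule leaves the mixed second derivative in the order (0, X), (Y, 0); symmetry of
  -- second derivatives brings it into the order of the claim.
  rw [← key, hsymm.eq (0, X) (Y, 0)]
  abel

end LieChart

/-! ### The Lie bracket as the antisymmetrized second derivative of the multiplication. -/

section LieBracketChart

open Filter Topology VectorField

variable {d : ℕ} {G : Type*} [TopologicalSpace G] [ChartedSpace (EuclideanSpace ℝ (Fin d)) G]
  [Group G] [LieGroup (𝓡 d) ∞ G]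

/-- The left invariant vector fields in the chart at the identity. -/
theorem mpullback_mulInvariantVectorField_oneChart (X : GroupLieAlgebra (𝓡 d) G)
    {x : EuclideanSpace ℝ (Fin d)} (hx : x ∈ (oneChart d G).target) :
    (mpullbackWithin 𝓘(ℝ, EuclideanSpace ℝ (Fin d)) (𝓡 d) (oneChart d G).symm
      (mulInvariantVectorField X) (range (𝓡 d)) x : EuclideanSpace ℝ (Fin d)) =
      fderiv ℝ (chartMul d G) (x, oneChart d G 1) (0, (X : EuclideanSpace ℝ (Fin d))) := by
  set g := (oneChart d G).symm x with hg
  have hgs : g ∈ (oneChart d G).source := (oneChart d G).map_target hx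
  have hinv : (mfderivWithin 𝓘(ℝ, EuclideanSpace ℝ (Fin d)) (𝓡 d) (oneChart d G).symm
      (range (𝓡 d)) x).inverse = mfderiv (𝓡 d) 𝓘(ℝ, EuclideanSpace ℝ (Fin d)) (oneChart d G) g :=
    have : IsManifold (𝓡 d) 1 G := IsManifold.of_le (n := ∞) (by norm_cast)
    ContinuousLinearMap.inverse_eq (mfderivWithin_extChartAt_symm_comp_mfderiv_extChartAt hx)
      (mfderiv_extChartAt_comp_mfderivWithin_extChartAt_symm hx)
  have hφ : MDifferentiableAt (𝓡 d) 𝓘(ℝ, EuclideanSpace ℝ (Fin d)) (oneChart d G) (g * 1) := by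
    rw [mul_one]; exact (contMDiffAt_oneChart hgs).mdifferentiableAt (by simp)
  have hL : MDifferentiableAt (𝓡 d) (𝓡 d) (fun b : G => g * b) 1 :=
    (contMDiff_mul_left (I := 𝓡 d) (n := ∞) (a := g) 1).mdifferentiableAt (by simp)
  have hcomp := mfderiv_comp (1 : G) hφ hL
  have hd : MDifferentiableAt (𝓡 d) 𝓘(ℝ, EuclideanSpace ℝ (Fin d))
      ((oneChart d G) ∘ fun b : G => g * b) 1 := hφ.comp (1 : G) hL
  have h2 := hd.mfderiv
  have hw : writtenInExtChartAt (𝓡 d) 𝓘(ℝ, EuclideanSpace ℝ (Fin d)) (1 : G)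
      ((oneChart d G) ∘ fun b : G => g * b) = fun y => oneChart d G (g * (oneChart d G).symm y) := by
    ext1 y
    simp [writtenInExtChartAt, oneChart]
    rfl
  have h3 : fderiv ℝ (fun y => oneChart d G (g * (oneChart d G).symm y)) (oneChart d G 1) =
      (fderiv ℝ (chartMul d G) (x, oneChart d G 1)).comp (ContinuousLinearMap.inr ℝ _ _) := by
    have h2 : HasFDerivAt (chartMul d G) (fderiv ℝ (chartMul d G) (x, oneChart d G 1))
        ((fun y => (x, y)) (oneChart d G 1)) :=
      ((contDiffAt_chartMul_one_right hx).differentiableAt (by simp)).hasFDerivAt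
    exact (h2.comp (oneChart d G 1)
      ((hasFDerivAt_const x (oneChart d G 1)).prodMk
        (hasFDerivAt_id (𝕜 := ℝ) (oneChart d G 1)))).fderiv
  rw [hw, modelWithCornersSelf_coe, range_id, fderivWithin_univ] at h2
  have h4 : mpullbackWithin 𝓘(ℝ, EuclideanSpace ℝ (Fin d)) (𝓡 d) (oneChart d G).symm
      (mulInvariantVectorField X) (range (𝓡 d)) x =
      mfderiv (𝓡 d) 𝓘(ℝ, EuclideanSpace ℝ (Fin d)) (oneChart d G) g
        (mfderiv (𝓡 d) (𝓡 d) (fun b : G => g * b) 1 X) := by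
    rw [mpullbackWithin_apply, hinv]
    rfl
  have h5 : mfderiv (𝓡 d) 𝓘(ℝ, EuclideanSpace ℝ (Fin d)) (oneChart d G) (g * 1)
        (mfderiv (𝓡 d) (𝓡 d) (fun b : G => g * b) 1 X) = mfderiv (𝓡 d) 𝓘(ℝ, EuclideanSpace ℝ (Fin d)) ((oneChart d G) ∘ fun b : G => g * b) 1 X := by
    rw [hcomp]; rfl
  have h6 : (mfderiv (𝓡 d) 𝓘(ℝ, EuclideanSpace ℝ (Fin d)) ((oneChart d G) ∘ fun b : G => g * b) 1 X
      : EuclideanSpace ℝ (Fin d)) =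
      fderiv ℝ (fun y => oneChart d G (g * (oneChart d G).symm y)) (oneChart d G 1) X := by
    rw [h2]; rfl
  -- The chain rule produces the derivative of the chart at `g * 1`, whose type differs from that at
  -- `g`; on the model space both are the same map.
  have h7 : ∀ g' : G, g' = g → (mfderiv (𝓡 d) 𝓘(ℝ, EuclideanSpace ℝ (Fin d)) (oneChart d G) g' : 
      EuclideanSpace ℝ (Fin d) →L[ℝ] EuclideanSpace ℝ (Fin d)) = 
      mfderiv (𝓡 d) 𝓘(ℝ, EuclideanSpace ℝ (Fin d)) (oneChart d G) g := by
    rintro _ rfl; rfl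
  have h8 := congrArg (fun L : EuclideanSpace ℝ (Fin d) →L[ℝ] EuclideanSpace ℝ (Fin d) =>
    L (mfderiv (𝓡 d) (𝓡 d) (fun b : G => g * b) 1 X)) (h7 (g * 1) (mul_one g))
  have h9 := congrArg (fun L => L (X : EuclideanSpace ℝ (Fin d))) h3
  exact h4.trans (h8.symm.trans (h5.trans (h6.trans h9)))

/-- The bracket of the Lie algebra in terms of the second derivative of the multiplication. -/
theorem bracket_eq_chartMul (X Y : GroupLieAlgebra (𝓡 d) G) :
    ((⁅X, Y⁆ : GroupLieAlgebra (𝓡 d) G) : EuclideanSpace ℝ (Fin d)) =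
      fderiv ℝ (fderiv ℝ (chartMul d G)) (oneChart d G 1, oneChart d G 1)
        ((X : EuclideanSpace ℝ (Fin d)), 0) (0, (Y : EuclideanSpace ℝ (Fin d))) -
      fderiv ℝ (fderiv ℝ (chartMul d G)) (oneChart d G 1, oneChart d G 1)
        ((Y : EuclideanSpace ℝ (Fin d)), 0) (0, (X : EuclideanSpace ℝ (Fin d))) := by
  let F : EuclideanSpace ℝ (Fin d) → EuclideanSpace ℝ (Fin d) → EuclideanSpace ℝ (Fin d) :=
    fun Z => mpullbackWithin 𝓘(ℝ, EuclideanSpace ℝ (Fin d)) (𝓡 d) (oneChart d G).symm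
        (mulInvariantVectorField (Z : GroupLieAlgebra (𝓡 d) G)) (range (𝓡 d))
  -- The chart at 1 has derivative the identity at 1, so the bracket of the invariant fields is the
  -- bracket of their chart representatives.
  have hb : ((⁅X, Y⁆ : GroupLieAlgebra (𝓡 d) G) : EuclideanSpace ℝ (Fin d)) =
      lieBracketWithin ℝ (F X) (F Y) univ (oneChart d G 1) := by
    have : IsManifold (𝓡 d) 1 G := IsManifold.of_le (n := ∞) (by norm_cast)
    have hid : ∀ L : EuclideanSpace ℝ (Fin d) →L[ℝ] EuclideanSpace ℝ (Fin d),
        L = ContinuousLinearMap.id ℝ _ → ∀ v, L.inverse v = v := by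
      rintro _ rfl v
      rw [ContinuousLinearMap.inverse_id, ContinuousLinearMap.id_apply]
    have hset : (univ : Set (EuclideanSpace ℝ (Fin d))) =
        (oneChart d G).symm ⁻¹' univ ∩ range (𝓡 d) := by
      rw [modelWithCornersSelf_coe, range_id, preimage_univ, univ_inter]
    rw [hset]
    exact hid (mfderiv (𝓡 d) 𝓘(ℝ, EuclideanSpace ℝ (Fin d)) (extChartAt (𝓡 d) (1 : G)) 1)
      mfderiv_extChartAt_self _
  have hmu := contDiffAt_chartMul_one_left (d := d) (G := G) oneChart_one_mem_target
  have hD : HasFDerivAt (fderiv ℝ (chartMul d G))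
      (fderiv ℝ (fderiv ℝ (chartMul d G)) (oneChart d G 1, oneChart d G 1))
      (oneChart d G 1, oneChart d G 1) :=
    ((hmu.fderiv_right (m := 1) (by norm_cast)).differentiableAt (by simp)).hasFDerivAt
  have hr : HasFDerivAt (fun x => fderiv ℝ (chartMul d G) (x, oneChart d G 1))
      ((fderiv ℝ (fderiv ℝ (chartMul d G)) (oneChart d G 1, oneChart d G 1)).comp
        (ContinuousLinearMap.inl ℝ _ _)) (oneChart d G 1) :=
    HasFDerivAt.comp _ (g := fderiv ℝ (chartMul d G)) (f := fun x => (x, oneChart d G 1)) hD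
      ((hasFDerivAt_id (𝕜 := ℝ) (oneChart d G 1)).prodMk (hasFDerivAt_const (oneChart d G 1) _))
  have hder : ∀ Z W : EuclideanSpace ℝ (Fin d), fderiv ℝ (F Z) (oneChart d G 1) W =
      fderiv ℝ (fderiv ℝ (chartMul d G)) (oneChart d G 1, oneChart d G 1) (W, 0) (0, Z) := by
    intro Z W
    have h := hr.clm_apply (hasFDerivAt_const ((0 : EuclideanSpace ℝ (Fin d)), Z) (oneChart d G 1))
    have hev : F Z =ᶠ[𝓝 (oneChart d G 1)]
        fun x => fderiv ℝ (chartMul d G) (x, oneChart d G 1) (0, Z) := by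
      filter_upwards [isOpen_oneChart_target.mem_nhds oneChart_one_mem_target] with x hx
      exact mpullback_mulInvariantVectorField_oneChart Z hx
    rw [hev.fderiv_eq, h.fderiv]
    simp
  have hval : ∀ Z : EuclideanSpace ℝ (Fin d), F Z (oneChart d G 1) = Z := by
    intro Z
    refine (mpullback_mulInvariantVectorField_oneChart Z oneChart_one_mem_target).trans ?_
    have : HasFDerivAt (chartMul d G ∘ fun y => (oneChart d G 1, y)) _ (oneChart d G 1) :=
      HasFDerivAt.comp (oneChart d G 1) (g := chartMul d G)
        (hmu.differentiableAt (by simp)).hasFDerivAt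
        ((hasFDerivAt_const (oneChart d G 1) _).prodMk
          (hasFDerivAt_id (𝕜 := ℝ) (oneChart d G 1)))
    have h' : HasFDerivAt (chartMul d G ∘ fun y => (oneChart d G 1, y))
        (ContinuousLinearMap.id ℝ _) (oneChart d G 1) := by
      refine (hasFDerivAt_id (oneChart d G 1)).congr_of_eventuallyEq ?_
      filter_upwards [isOpen_oneChart_target.mem_nhds oneChart_one_mem_target] with x hx
      exact chartMul_one_left hx
    have := congrArg (fun L => L Z) (this.unique h')
    simp at this
    exact this
  have key : ∀ A B : EuclideanSpace ℝ (Fin d),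
      lieBracketWithin ℝ (F A) (F B) univ (oneChart d G 1) =
        fderiv ℝ (fderiv ℝ (chartMul d G)) (oneChart d G 1, oneChart d G 1) (A, 0) (0, B) -
        fderiv ℝ (fderiv ℝ (chartMul d G)) (oneChart d G 1, oneChart d G 1) (B, 0) (0, A) := by
    intro A B
    rw [lieBracketWithin_univ, lieBracket_eq]
    beta_reduce
    rw [hval, hval, hder, hder]
  exact hb.trans (key X Y)

/-- The differential of the adjoint representation of the group is the adjoint representation of
the Lie algebra. -/
theorem fderiv_modelAd (X Y : GroupLieAlgebra (𝓡 d) G) :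
    fderiv ℝ (fun x => modelAd d ((oneChart d G).symm x)) (oneChart d G 1) X Y =
      ((⁅X, Y⁆ : GroupLieAlgebra (𝓡 d) G) : EuclideanSpace ℝ (Fin d)) :=
  (fderiv_modelAd_eq X Y).trans (bracket_eq_chartMul X Y).symm

end LieBracketChart

/-! ### Smooth inverse function theorem. -/

section InverseFunction

open Filter Topology

/-- The inverse function theorem for smooth maps, with an inverse which is smooth on an open set. -/
theorem exists_smooth_openPartialHomeomorph {E F : Type*} [NormedAddCommGroup E] [NormedSpace ℝ E]
    [CompleteSpace E] [NormedAddCommGroup F] [NormedSpace ℝ F] {f : E → F} {a : E} {W : Set E}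
    (hW : IsOpen W) (ha : a ∈ W) (hf : ContDiffOn ℝ ∞ f W) {f' : E ≃L[ℝ] F}
    (hf' : HasFDerivAt f (f' : E →L[ℝ] F) a) :
    ∃ e : OpenPartialHomeomorph E F, a ∈ e.source ∧ e.source ⊆ W ∧ (∀ x, e x = f x) ∧
      ContDiffOn ℝ ∞ e.symm e.target := by
  have hfa : ContDiffAt ℝ ∞ f a := hf.contDiffAt (hW.mem_nhds ha)
  let e0 := hfa.toOpenPartialHomeomorph f hf' (by simp)
  have hc : ContinuousAt (fderiv ℝ f) a :=
    (hfa.fderiv_right (m := ∞) (by simp)).continuousAt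
  -- Invertibility of the derivative is an open condition. Shrinking the source to points where it
  -- holds makes the inverse smooth on its whole domain and not only at the image of a.
  have hr : {x | fderiv ℝ f x ∈ range ((↑) : (E ≃L[ℝ] F) → E →L[ℝ] F)} ∈ 𝓝 a := by
    apply hc
    rw [hf'.fderiv]
    exact ContinuousLinearEquiv.nhds f'
  obtain ⟨s, hs, hso, has⟩ := mem_nhds_iff.1 (inter_mem hr (hW.mem_nhds ha))
  refine ⟨e0.restrOpen s hso, ?_, ?_, fun x => rfl, ?_⟩
  · rw [OpenPartialHomeomorph.restrOpen_source]
    exact ⟨hfa.mem_toOpenPartialHomeomorph_source hf' (by simp), has⟩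
  · rw [OpenPartialHomeomorph.restrOpen_source]
    exact fun x hx => (hs hx.2).2
  · intro y hy
    have hx := (e0.restrOpen s hso).map_target hy
    rw [OpenPartialHomeomorph.restrOpen_source] at hx
    obtain ⟨⟨f₁, hf₁⟩, hxW⟩ := hs hx.2
    have hfx : ContDiffAt ℝ ∞ f ((e0.restrOpen s hso).symm y) := hf.contDiffAt (hW.mem_nhds hxW)
    have hd : HasFDerivAt f (f₁ : E →L[ℝ] F) ((e0.restrOpen s hso).symm y) := by
      rw [hf₁]
      exact (hfx.differentiableAt (by simp)).hasFDerivAt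
    exact ((e0.restrOpen s hso).contDiffAt_symm hy hd hfx).contDiffWithinAt

end InverseFunction

/-! ### The differential of an endomorphism of the group. -/

section FixedPoints

open Filter Topology

variable {d : ℕ} {G : Type*} [TopologicalSpace G] [ChartedSpace (EuclideanSpace ℝ (Fin d)) G]
  [Group G] [LieGroup (𝓡 d) ∞ G]

/-- The differential at the identity of an endomorphism of the group, on the model space. -/
noncomputable def modelDiff (d : ℕ) {G : Type*} [TopologicalSpace G]
    [ChartedSpace (EuclideanSpace ℝ (Fin d)) G] [Group G] (θ : G →* G) :
    EuclideanSpace ℝ (Fin d) →L[ℝ] EuclideanSpace ℝ (Fin d) :=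
  fderiv ℝ (fun x => oneChart d G (θ ((oneChart d G).symm x))) (oneChart d G 1)

theorem lieDiff_eq_modelDiff {θ : G →* G} (hθ : ContMDiff (𝓡 d) (𝓡 d) ∞ (fun x : G => θ x)) :
    (lieDiff θ : EuclideanSpace ℝ (Fin d) →L[ℝ] EuclideanSpace ℝ (Fin d)) = modelDiff d θ :=
  mfderiv_one_eq_fderiv ((hθ 1).mdifferentiableAt (by simp)) (map_one θ)

theorem modelDiff_modelDiff {θ : G →* G} (hθ : ContMDiff (𝓡 d) (𝓡 d) ∞ (fun x : G => θ x))
    (hinv : ∀ x, θ (θ x) = x) (X : EuclideanSpace ℝ (Fin d)) :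
    modelDiff d θ (modelDiff d θ X) = X := by
  have h := contDiffAt_chart_map hθ (map_one θ)
  have e : oneChart d G (θ ((oneChart d G).symm (oneChart d G 1))) = oneChart d G 1 := by
    rw [oneChart_symm_one, map_one]
  have hd : HasFDerivAt (fun x => oneChart d G (θ ((oneChart d G).symm x))) (modelDiff d θ)
      (oneChart d G 1) := (h.differentiableAt (by simp)).hasFDerivAt
  have hd' : HasFDerivAt (fun x => oneChart d G (θ ((oneChart d G).symm x))) (modelDiff d θ)
      (oneChart d G (θ ((oneChart d G).symm (oneChart d G 1)))) := by rwa [e]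
  have hcomp := hd'.comp (oneChart d G 1) hd
  have hc : ContinuousAt (fun x => θ ((oneChart d G).symm x)) (oneChart d G 1) :=
    ((hθ _).comp _ (contMDiffAt_oneChart_symm oneChart_one_mem_target)).continuousAt
  have hm : ∀ᶠ x in 𝓝 (oneChart d G 1), θ ((oneChart d G).symm x) ∈ (oneChart d G).source := by
    apply hc
    simpa [oneChart_symm_one] using oneChart_source_mem_nhds
  have hid : HasFDerivAt ((fun x => oneChart d G (θ ((oneChart d G).symm x))) ∘
      fun x => oneChart d G (θ ((oneChart d G).symm x))) (ContinuousLinearMap.id ℝ _)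
      (oneChart d G 1) := by
    refine (hasFDerivAt_id _).congr_of_eventuallyEq ?_
    filter_upwards [hm, isOpen_oneChart_target.mem_nhds oneChart_one_mem_target] with x hx hx'
    simp only [Function.comp]
    rw [(oneChart d G).left_inv hx, hinv, (oneChart d G).right_inv hx']
    rfl
  exact congrArg (fun L => L X) (hcomp.unique hid)

/-- The differential of an endomorphism of the group intertwines the adjoint representations. -/
theorem modelDiff_modelAd {θ : G →* G} (hθ : ContMDiff (𝓡 d) (𝓡 d) ∞ (fun x : G => θ x))
    (g : G) : (modelDiff d θ).comp (modelAd d g) = (modelAd d (θ g)).comp (modelDiff d θ) := by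
  have h := contDiffAt_chart_map hθ (map_one θ)
  have hg := contDiffAt_chart_map (contMDiff_conj (d := d) g) (by simp)
  have hg' := contDiffAt_chart_map (contMDiff_conj (d := d) (θ g)) (by simp)
  have e : oneChart d G (θ ((oneChart d G).symm (oneChart d G 1))) = oneChart d G 1 := by
    rw [oneChart_symm_one, map_one]
  have e' : oneChart d G (g * (oneChart d G).symm (oneChart d G 1) * g⁻¹) = oneChart d G 1 := by
    rw [oneChart_symm_one]; simp
  have h1 := fderiv_comp (oneChart d G 1)
    (g := fun x => oneChart d G (θ ((oneChart d G).symm x)))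
    (f := fun x => oneChart d G (g * (oneChart d G).symm x * g⁻¹))
    (by rw [e']; exact h.differentiableAt (by simp)) (hg.differentiableAt (by simp))
  have h2 := fderiv_comp (oneChart d G 1)
    (g := fun x => oneChart d G (θ g * (oneChart d G).symm x * (θ g)⁻¹))
    (f := fun x => oneChart d G (θ ((oneChart d G).symm x)))
    (by rw [e]; exact hg'.differentiableAt (by simp)) (h.differentiableAt (by simp))
  rw [e'] at h1
  rw [e] at h2
  rw [modelDiff, modelAd, modelAd, ← h1, ← h2]
  apply Filter.EventuallyEq.fderiv_eq
  have hc : ContinuousAt (fun x => θ ((oneChart d G).symm x)) (oneChart d G 1) :=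
    ((hθ _).comp _ (contMDiffAt_oneChart_symm oneChart_one_mem_target)).continuousAt
  have hm : ∀ᶠ x in 𝓝 (oneChart d G 1), θ ((oneChart d G).symm x) ∈ (oneChart d G).source := by
    apply hc
    simpa [oneChart_symm_one] using oneChart_source_mem_nhds
  have hc' : ContinuousAt (fun x => g * (oneChart d G).symm x * g⁻¹) (oneChart d G 1) :=
    (((contMDiff_conj (d := d) g) _).comp _
      (contMDiffAt_oneChart_symm oneChart_one_mem_target)).continuousAt
  have hm' : ∀ᶠ x in 𝓝 (oneChart d G 1), g * (oneChart d G).symm x * g⁻¹ ∈ (oneChart d G).source := by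
    apply hc'
    simpa [oneChart_symm_one] using oneChart_source_mem_nhds
  filter_upwards [hm, hm'] with x hx hx'
  simp only [Function.comp]
  rw [(oneChart d G).left_inv hx, (oneChart d G).left_inv hx']
  simp

/-- The differential of an endomorphism of the group is a homomorphism of Lie algebras. -/
theorem modelDiff_bracket {θ : G →* G} (hθ : ContMDiff (𝓡 d) (𝓡 d) ∞ (fun x : G => θ x))
    (X Y : EuclideanSpace ℝ (Fin d)) :
    modelDiff d θ (fderiv ℝ (fun x => modelAd d ((oneChart d G).symm x)) (oneChart d G 1) X Y) =
      fderiv ℝ (fun x => modelAd d ((oneChart d G).symm x)) (oneChart d G 1)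
        (modelDiff d θ X) (modelDiff d θ Y) := by
  have h := contDiffAt_chart_map hθ (map_one θ)
  have e : oneChart d G (θ ((oneChart d G).symm (oneChart d G 1))) = oneChart d G 1 := by
    rw [oneChart_symm_one, map_one]
  have hd : HasFDerivAt (fun x => oneChart d G (θ ((oneChart d G).symm x))) (modelDiff d θ)
      (oneChart d G 1) := (h.differentiableAt (by simp)).hasFDerivAt
  have hA : HasFDerivAt (fun x => modelAd d ((oneChart d G).symm x))
      (fderiv ℝ (fun x => modelAd d ((oneChart d G).symm x)) (oneChart d G 1)) (oneChart d G 1) :=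
    ((contDiffAt_modelAd oneChart_one_mem_target).differentiableAt (by simp)).hasFDerivAt
  have hA' : HasFDerivAt (fun x => modelAd d ((oneChart d G).symm x))
      (fderiv ℝ (fun x => modelAd d ((oneChart d G).symm x)) (oneChart d G 1))
      (oneChart d G (θ ((oneChart d G).symm (oneChart d G 1)))) := by rwa [e]
  have h1 := ((modelDiff d θ).hasFDerivAt.comp (oneChart d G 1)
    (hA.clm_apply (hasFDerivAt_const Y (oneChart d G 1))))
  have h2 := (hA'.comp (oneChart d G 1) hd).clm_apply
    (hasFDerivAt_const (modelDiff d θ Y) (oneChart d G 1))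
  have hc : ContinuousAt (fun x => θ ((oneChart d G).symm x)) (oneChart d G 1) :=
    ((hθ _).comp _ (contMDiffAt_oneChart_symm oneChart_one_mem_target)).continuousAt
  have hm : ∀ᶠ x in 𝓝 (oneChart d G 1), θ ((oneChart d G).symm x) ∈ (oneChart d G).source := by
    apply hc
    simpa [oneChart_symm_one] using oneChart_source_mem_nhds
  have hev : (modelDiff d θ ∘ fun x => modelAd d ((oneChart d G).symm x) Y) =ᶠ[𝓝 (oneChart d G 1)]
      (fun x => ((fun x => modelAd d ((oneChart d G).symm x)) ∘
        fun x => oneChart d G (θ ((oneChart d G).symm x))) x (modelDiff d θ Y)) := by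
    filter_upwards [hm] with x hx
    simp only [Function.comp]
    rw [(oneChart d G).left_inv hx]
    exact congrArg (fun L => L Y) (modelDiff_modelAd hθ _)
  have := congrArg (fun L => L X) ((h1.congr_of_eventuallyEq hev.symm).unique h2)
  simpa using this

end FixedPoints

/-! ### Linearization of an involution near the identity. -/

section FixedPointChart

open Filter Topology

variable {d : ℕ} {G : Type*} [TopologicalSpace G] [ChartedSpace (EuclideanSpace ℝ (Fin d)) G]
  [Group G] [LieGroup (𝓡 d) ∞ G]

/-- Near the identity, the fixed point set of an involution of the group is parametrized by the
fixed vectors of its differential. -/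
theorem exists_linearizing_chart {θ : G →* G}
    (hθ : ContMDiff (𝓡 d) (𝓡 d) ∞ (fun x : G => θ x)) (hinv : ∀ x, θ (θ x) = x) :
    ∃ s : EuclideanSpace ℝ (Fin d) → EuclideanSpace ℝ (Fin d), ∃ ε > 0, ∃ ψ : G → _,
      s 0 = oneChart d G 1 ∧ ContDiffOn ℝ ∞ s (Metric.ball 0 ε) ∧
      HasFDerivAt s (ContinuousLinearMap.id ℝ _) 0 ∧
      (∀ v ∈ Metric.ball 0 ε, s v ∈ (oneChart d G).target) ∧
      (∀ v ∈ Metric.ball 0 ε, modelDiff d θ v = v →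
        θ ((oneChart d G).symm (s v)) = (oneChart d G).symm (s v)) ∧
      Tendsto ψ (𝓝 1) (𝓝 0) ∧
      (∀ᶠ g in 𝓝 1, (oneChart d G).symm (s (ψ g)) = g ∧ (θ g = g → modelDiff d θ (ψ g) = ψ g)) := by
  classical
  set x0 := oneChart d G 1 with hx0
  set T := modelDiff d θ with hT
  let τ : EuclideanSpace ℝ (Fin d) → EuclideanSpace ℝ (Fin d) :=
    fun x => oneChart d G (θ ((oneChart d G).symm x))
  have hτ0 : τ x0 = x0 := by simp only [τ, hx0, oneChart_symm_one, map_one]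
  have hTT : ∀ X, T (T X) = X := modelDiff_modelDiff hθ hinv
  let W : Set (EuclideanSpace ℝ (Fin d)) :=
    (oneChart d G).target ∩ (fun x => θ ((oneChart d G).symm x)) ⁻¹' (oneChart d G).source
  have hcont : ContinuousOn (fun x => θ ((oneChart d G).symm x)) (oneChart d G).target :=
    fun x hx => ((hθ _).comp x (contMDiffAt_oneChart_symm hx)).continuousAt.continuousWithinAt
  have hWo : IsOpen W := hcont.isOpen_inter_preimage isOpen_oneChart_target
    (isOpen_extChartAt_source (I := 𝓡 d) (1 : G))
  have hW0 : x0 ∈ W := by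
    refine ⟨oneChart_one_mem_target, ?_⟩
    rw [mem_preimage, hx0, oneChart_symm_one, map_one]
    exact mem_of_mem_nhds oneChart_source_mem_nhds
  have hτW : ContDiffOn ℝ ∞ τ W := fun x hx =>
    (contDiffAt_oneChart_comp (f := fun x => θ ((oneChart d G).symm x))
      ((hθ _).comp x (contMDiffAt_oneChart_symm hx.1)) hx.2).contDiffWithinAt
  have hττ : ∀ x ∈ W, τ (τ x) = x := by
    intro x hx
    simp only [τ]
    rw [(oneChart d G).left_inv hx.2, hinv, (oneChart d G).right_inv hx.1]
  -- Averaging over the group {1, τ}: this p satisfies p ∘ τ = T ∘ p because τ² = 1 and T² = 1, and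
  -- its derivative at x0 is (1 + T²)/2 = 1. In the coordinate p the involution is linear.
  let p : EuclideanSpace ℝ (Fin d) → EuclideanSpace ℝ (Fin d) :=
    fun x => (1 / 2 : ℝ) • ((x - x0) + T (τ x - x0))
  have hp0 : p x0 = 0 := by simp [p, hτ0]
  have hpW : ContDiffOn ℝ ∞ p W :=
    ((contDiffOn_id.sub contDiffOn_const).add
      (T.contDiff.comp_contDiffOn (hτW.sub contDiffOn_const))).const_smul (1 / 2 : ℝ)
  have hτd : HasFDerivAt τ T x0 :=
    ((hτW.contDiffAt (hWo.mem_nhds hW0)).differentiableAt (by simp)).hasFDerivAt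
  have hpd : HasFDerivAt p ((ContinuousLinearEquiv.refl ℝ (EuclideanSpace ℝ (Fin d)) :
      EuclideanSpace ℝ (Fin d) →L[ℝ] EuclideanSpace ℝ (Fin d))) x0 := by
    have h := (((hasFDerivAt_id (𝕜 := ℝ) x0).sub_const x0).add
      (T.hasFDerivAt.comp x0 (hτd.sub_const x0))).const_smul (1 / 2 : ℝ)
    refine (h.congr_fderiv ?_)
    ext1 X
    simp only [_root_.smul_apply, _root_.add_apply,
      ContinuousLinearMap.comp_apply, hTT, ContinuousLinearMap.id_apply,
      ContinuousLinearEquiv.coe_coe, ContinuousLinearEquiv.coe_refl']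
    simp only [id, ← two_smul ℝ X, smul_smul]
    norm_num
  obtain ⟨e, he0, heW, hep, hes⟩ := exists_smooth_openPartialHomeomorph hWo hW0 hpW hpd
  have hpτ : ∀ x ∈ W, p (τ x) = T (p x) := by
    intro x hx
    simp only [p]
    rw [hττ x hx, map_smul, map_add, hTT, add_comm]
  have ht0 : (0 : EuclideanSpace ℝ (Fin d)) ∈ e.target := by
    have := e.map_source he0
    rwa [hep, hp0] at this
  have hs0 : e.symm 0 = x0 := by
    have := e.left_inv he0
    rwa [hep, hp0] at this
  -- the points near `0` whose image under `e.symm` is mapped by `τ` into `e.source`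
  have hτc : ContinuousAt τ x0 := hτd.continuousAt
  have hnear : ∀ᶠ v in 𝓝 (0 : EuclideanSpace ℝ (Fin d)), v ∈ e.target ∧ τ (e.symm v) ∈ e.source := by
    refine Filter.Eventually.and (e.open_target.mem_nhds ht0) ?_
    have h1 : Tendsto e.symm (𝓝 0) (𝓝 x0) := hs0 ▸ e.symm.continuousAt ht0
    have h2 : Tendsto τ (𝓝 x0) (𝓝 x0) := by
      have := hτc.tendsto; rwa [hτ0] at this
    exact (h2.comp h1) (e.open_source.mem_nhds he0)
  obtain ⟨ε, hε, hball⟩ := Metric.eventually_nhds_iff_ball.1 hnear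
  have htgt : ∀ v ∈ Metric.ball (0 : EuclideanSpace ℝ (Fin d)) ε, e.symm v ∈ e.source :=
    fun v hv => e.map_target (hball v hv).1
  refine ⟨e.symm, ε, hε, fun g => p (oneChart d G g), hs0,
    hes.mono fun v hv => (hball v hv).1, ?_, fun v hv => (heW (htgt v hv)).1, ?_, ?_, ?_⟩
  · have hd : HasFDerivAt e ((ContinuousLinearEquiv.refl ℝ (EuclideanSpace ℝ (Fin d)) :
      EuclideanSpace ℝ (Fin d) →L[ℝ] EuclideanSpace ℝ (Fin d))) (e.symm 0) := by
      rw [hs0, show ⇑e = p from funext hep]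
      exact hpd
    exact e.hasFDerivAt_symm ht0 hd
  · intro v hv hTv
    have hx := htgt v hv
    have h1 : p (e.symm v) = v := by rw [← hep]; exact e.right_inv (hball v hv).1
    -- If T v = v, then p takes the same value at e⁻¹(v) and at its image under τ. Both points lie
    -- where p is injective, so they coincide.
    have h2 : e (τ (e.symm v)) = e (e.symm v) := by
      rw [hep, hep, hpτ _ (heW hx), h1, hTv]
    have h3 : τ (e.symm v) = e.symm v := e.injOn (hball v hv).2 hx h2
    have h4 := congrArg (oneChart d G).symm h3
    simp only [τ] at h4
    rwa [(oneChart d G).left_inv (heW hx).2] at h4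
  · have h1 : Tendsto (oneChart d G) (𝓝 1) (𝓝 x0) :=
      (contMDiffAt_oneChart (mem_of_mem_nhds oneChart_source_mem_nhds)).continuousAt
    have h2 : Tendsto p (𝓝 x0) (𝓝 0) := by
      have := hpd.continuousAt.tendsto; rwa [hp0] at this
    exact h2.comp h1
  · have h1 : Tendsto (oneChart d G) (𝓝 1) (𝓝 x0) :=
      (contMDiffAt_oneChart (mem_of_mem_nhds oneChart_source_mem_nhds)).continuousAt
    filter_upwards [oneChart_source_mem_nhds (d := d), h1 (e.open_source.mem_nhds he0)] with g hg hge
    refine ⟨?_, fun hgθ => ?_⟩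
    · rw [← hep, e.left_inv hge, (oneChart d G).left_inv hg]
    · rw [← hpτ _ (heW hge)]
      simp only [τ]
      rw [(oneChart d G).left_inv hg, hgθ]

/-- The derivative of the adjoint representation along a curve of group elements. -/
theorem hasDerivAt_modelAd_curve {h : ℝ → G} {g : G} (h0 : h 0 = g)
    (hh : ContMDiffAt 𝓘(ℝ, ℝ) (𝓡 d) ∞ h 0) :
    ∃ w : EuclideanSpace ℝ (Fin d),
      HasDerivAt (fun t => oneChart d G (g⁻¹ * h t)) w 0 ∧
      HasDerivAt (fun t => modelAd d (h t)) ((modelAd d g).comp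
        (fderiv ℝ (fun x => modelAd d ((oneChart d G).symm x)) (oneChart d G 1) w)) 0 := by
  -- Left translation to the identity: Ad(h t) = Ad(g) Ad(g⁻¹ h t), so only the derivative of Ad at
  -- the identity is needed.
  have hk : ContMDiffAt 𝓘(ℝ, ℝ) (𝓡 d) ∞ (fun t => g⁻¹ * h t) 0 :=
    contMDiffAt_const.mul hh
  have hk0 : g⁻¹ * h 0 = 1 := by rw [h0, inv_mul_cancel]
  have hd := contDiffAt_oneChart_comp (f := fun t => g⁻¹ * h t) hk
    (by rw [hk0]; exact mem_of_mem_nhds oneChart_source_mem_nhds)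
  have hw := (hd.differentiableAt (by simp)).hasDerivAt
  refine ⟨_, hw, ?_⟩
  have hA : HasFDerivAt (fun x => modelAd d ((oneChart d G).symm x))
      (fderiv ℝ (fun x => modelAd d ((oneChart d G).symm x)) (oneChart d G 1))
      (oneChart d G (g⁻¹ * h 0)) := by
    rw [hk0]
    exact ((contDiffAt_modelAd oneChart_one_mem_target).differentiableAt (by simp)).hasFDerivAt
  have h1 := hA.comp_hasDerivAt 0 hw
  have h2 := (hasDerivAt_const (0 : ℝ) (modelAd d g)).clm_comp h1
  simp only [ContinuousLinearMap.zero_comp, zero_add] at h2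
  refine h2.congr_of_eventuallyEq ?_
  have hm : ∀ᶠ t in 𝓝 (0 : ℝ), g⁻¹ * h t ∈ (oneChart d G).source := by
    apply hk.continuousAt
    beta_reduce
    rw [hk0]
    exact oneChart_source_mem_nhds
  filter_upwards [hm] with t ht
  simp only [Function.comp]
  rw [(oneChart d G).left_inv ht, ← modelAd_mul, mul_inv_cancel_left]

/-- A curve of fixed points has a derivative fixed by the differential. -/
theorem modelDiff_eq_of_curve {θ : G →* G}
    (hθ : ContMDiff (𝓡 d) (𝓡 d) ∞ (fun x : G => θ x)) {k : ℝ → G} (h0 : k 0 = 1)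
    (hk : ContinuousAt k 0) (hfix : ∀ᶠ t in 𝓝 0, θ (k t) = k t)
    {w : EuclideanSpace ℝ (Fin d)} (hw : HasDerivAt (fun t => oneChart d G (k t)) w 0) :
    modelDiff d θ w = w := by
  have hd : HasFDerivAt (fun x => oneChart d G (θ ((oneChart d G).symm x))) (modelDiff d θ)
      (oneChart d G (k 0)) := by
    rw [h0]
    exact ((contDiffAt_chart_map hθ (map_one θ)).differentiableAt (by simp)).hasFDerivAt
  have h1 := hd.comp_hasDerivAt 0 hw
  refine (h1.congr_of_eventuallyEq ?_).unique hw
  have hm : ∀ᶠ t in 𝓝 (0 : ℝ), k t ∈ (oneChart d G).source := by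
    apply hk
    rw [h0]
    exact oneChart_source_mem_nhds
  filter_upwards [hm, hfix] with t ht ht'
  simp only [Function.comp]
  rw [(oneChart d G).left_inv ht, ht']

end FixedPointChart

/-! ### Abstract symmetric Lie algebras and isotropy representations. -/

/-- A finite-dimensional Lie algebra with an invariant inner product and an isometric involutive
automorphism. -/
structure SymmetricLie (L : Type*) [NormedAddCommGroup L] [InnerProductSpace ℝ L] where
  /-- the bracket -/
  ad : L →ₗ[ℝ] L →ₗ[ℝ] L
  /-- the involution -/
  θ : L →ₗ[ℝ] L
  ad_swap : ∀ X Y, ad X Y = -ad Y X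
  jacobi : ∀ X Y Z, ad (ad X Y) Z = ad X (ad Y Z) - ad Y (ad X Z)
  θ_θ : ∀ X, θ (θ X) = X
  θ_ad : ∀ X Y, θ (ad X Y) = ad (θ X) (θ Y)
  inner_ad : ∀ X Y Z, ⟪ad X Y, Z⟫_ℝ = -⟪Y, ad X Z⟫_ℝ
  inner_θ : ∀ X Y, ⟪θ X, θ Y⟫_ℝ = ⟪X, Y⟫_ℝ

/-- An isometric representation of a group by automorphisms of `D`, which near the identity is
smoothly parametrized by the fixed vectors of the involution. -/
structure IsotropyRep {L : Type*} [NormedAddCommGroup L] [InnerProductSpace ℝ L]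
    (D : SymmetricLie L) (K : Type*) [Group K] [TopologicalSpace K] where
  /-- the representation -/
  ρ : K →* (L →L[ℝ] L)
  continuous_ρ : Continuous ρ
  inner_ρ : ∀ k X Y, ⟪ρ k X, ρ k Y⟫_ℝ = ⟪X, Y⟫_ℝ
  ρ_θ : ∀ k X, ρ k (D.θ X) = D.θ (ρ k X)
  ρ_ad : ∀ k X Y, ρ k (D.ad X Y) = D.ad (ρ k X) (ρ k Y)
  /-- the local parametrization -/
  chart : L → L →L[ℝ] L
  /-- the radius of the ball where the parametrization is defined -/
  radius : ℝ
  radius_pos : 0 < radius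
  contDiffOn_chart : ContDiffOn ℝ ∞ chart (Metric.ball 0 radius)
  chart_zero : chart 0 = ContinuousLinearMap.id ℝ L
  chart_mem : ∀ v ∈ Metric.ball 0 radius, D.θ v = v → ∃ k, ρ k = chart v
  chart_cover : ∀ ε > 0, ∀ᶠ k in nhds (1 : K), ∃ v, ‖v‖ < ε ∧ D.θ v = v ∧ ρ k = chart v
  fderiv_chart_zero : ∀ w Y, fderiv ℝ chart 0 w Y = D.ad w Y
  fderiv_chart : ∀ v ∈ Metric.ball 0 radius, ∀ w, D.θ v = v → D.θ w = w →
    ∃ z, D.θ z = z ∧ ∀ Y, fderiv ℝ chart v w Y = chart v (D.ad z Y)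

/-! ### The symmetric Lie algebra of the group. -/

section Concrete

open Filter Topology

variable {d : ℕ} {G : Type*} [TopologicalSpace G] [ChartedSpace (EuclideanSpace ℝ (Fin d)) G]
  [Group G]

section Riemannian

variable [RiemannianBundle (fun x : G => TangentSpace (𝓡 d) x)]

instance finiteDimensional_groupLieAlgebra : FiniteDimensional ℝ (GroupLieAlgebra (𝓡 d) G) :=
  inferInstanceAs (FiniteDimensional ℝ (EuclideanSpace ℝ (Fin d)))

/-- The identification of the Lie algebra with the model space. -/
noncomputable def lieModel (d : ℕ) (G : Type*) [TopologicalSpace G]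
    [ChartedSpace (EuclideanSpace ℝ (Fin d)) G] [Group G]
    [RiemannianBundle (fun x : G => TangentSpace (𝓡 d) x)] :
    GroupLieAlgebra (𝓡 d) G ≃L[ℝ] EuclideanSpace ℝ (Fin d) :=
  LinearEquiv.toContinuousLinearEquiv
    ({ toFun := fun X => X, invFun := fun X => X, map_add' := fun _ _ => rfl,
       map_smul' := fun _ _ => rfl, left_inv := fun _ => rfl, right_inv := fun _ => rfl } :
      GroupLieAlgebra (𝓡 d) G ≃ₗ[ℝ] EuclideanSpace ℝ (Fin d))

end Riemannian

variable [LieGroup (𝓡 d) ∞ G]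

/-- Continuity at 1 is read off in the chart; multiplicativity of Ad spreads it to every point. -/
theorem continuous_modelAd : Continuous (fun g : G => modelAd d g) := by
  have h1 : ContinuousAt (fun g : G => modelAd d g) 1 := by
    have h := (contDiffAt_modelAd (d := d) (G := G) oneChart_one_mem_target).continuousAt
    have h2 : ContinuousAt (oneChart d G) 1 :=
      (contMDiffAt_oneChart (mem_of_mem_nhds oneChart_source_mem_nhds)).continuousAt
    refine (h.comp (f := oneChart d G) (x := 1) h2).congr ?_
    filter_upwards [oneChart_source_mem_nhds (d := d)] with g hg
    simp only [Function.comp]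
    rw [(oneChart d G).left_inv hg]
  have : IsTopologicalGroup G := topologicalGroup_of_lieGroup (𝓡 d) ∞
  rw [continuous_iff_continuousAt]
  intro g
  have h2 : ContinuousAt (fun h : G => modelAd d (g⁻¹ * h)) g := by
    refine ContinuousAt.comp (g := fun h : G => modelAd d h) (f := fun h => g⁻¹ * h) ?_ (by fun_prop)
    rwa [inv_mul_cancel]
  refine (continuousAt_const (y := modelAd d g)).clm_comp h2 |>.congr ?_
  filter_upwards with h
  rw [← modelAd_mul, mul_inv_cancel_left]

variable [RiemannianBundle (fun x : G => TangentSpace (𝓡 d) x)]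

theorem lieAd_apply (g : G) (X : GroupLieAlgebra (𝓡 d) G) :
    lieAd g X = (lieModel d G).symm (modelAd d g (lieModel d G X)) :=
  DFunLike.congr_fun (lieAd_eq_modelAd g) X

theorem bracket_eq_fderiv (X Y : GroupLieAlgebra (𝓡 d) G) :
    ⁅X, Y⁆ = (lieModel d G).symm (fderiv ℝ (fun x => modelAd d ((oneChart d G).symm x))
      (oneChart d G 1) (lieModel d G X) (lieModel d G Y)) :=
  (fderiv_modelAd X Y).symm

theorem lieDiff_apply {θ : G →* G} (hθ : ContMDiff (𝓡 d) (𝓡 d) ∞ (fun x : G => θ x))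
    (X : GroupLieAlgebra (𝓡 d) G) :
    lieDiff θ X = (lieModel d G).symm (modelDiff d θ (lieModel d G X)) :=
  DFunLike.congr_fun (lieDiff_eq_modelDiff hθ) X

/-- The function g ↦ ⟨Ad(g)Y, Ad(g)Z⟩ is constant; its derivative at the identity in the direction X
is ⟨[X,Y],Z⟩ + ⟨Y,[X,Z]⟩. -/
theorem inner_bracket {θ : G →* G} (hinner : IsInvariantInner d θ)
    (X Y Z : GroupLieAlgebra (𝓡 d) G) : ⟪⁅X, Y⁆, Z⟫_ℝ = -⟪Y, ⁅X, Z⁆⟫_ℝ := by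
  let e := lieModel d G
  have hA : HasFDerivAt (fun x => modelAd d ((oneChart d G).symm x))
      (fderiv ℝ (fun x => modelAd d ((oneChart d G).symm x)) (oneChart d G 1)) (oneChart d G 1) :=
    ((contDiffAt_modelAd oneChart_one_mem_target).differentiableAt (by simp)).hasFDerivAt
  let B := fderiv ℝ (fun x => modelAd d ((oneChart d G).symm x)) (oneChart d G 1)
  have hV : ∀ V : GroupLieAlgebra (𝓡 d) G, HasFDerivAt
      (fun x => e.symm (modelAd d ((oneChart d G).symm x) (e V)))
      ((e.symm : EuclideanSpace ℝ (Fin d) →L[ℝ] GroupLieAlgebra (𝓡 d) G).comp (B.flip (e V)))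
      (oneChart d G 1) := by
    intro V
    refine ((e.symm : EuclideanSpace ℝ (Fin d) →L[ℝ] GroupLieAlgebra (𝓡 d) G).hasFDerivAt.comp
      (oneChart d G 1) (hA.clm_apply (hasFDerivAt_const (e V) (oneChart d G 1)))).congr_fderiv ?_
    ext1 W
    simp [B]
  have h1 := (hV Y).inner ℝ (hV Z)
  have h2 : HasFDerivAt (fun x => ⟪e.symm (modelAd d ((oneChart d G).symm x) (e Y)),
      e.symm (modelAd d ((oneChart d G).symm x) (e Z))⟫_ℝ)
      (0 : EuclideanSpace ℝ (Fin d) →L[ℝ] ℝ) (oneChart d G 1) := by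
    refine (hasFDerivAt_const ⟪Y, Z⟫_ℝ (oneChart d G 1)).congr_of_eventuallyEq
      (Eventually.of_forall fun x => ?_)
    have := hinner.2 ((oneChart d G).symm x) Y Z
    rwa [lieAd_apply, lieAd_apply] at this
  have h3 := congrArg (fun T => T (e X)) (h1.unique h2)
  simp [oneChart_symm_one, modelAd_one] at h3
  have e1 : e.symm (B (e X) (e Y)) = ⁅X, Y⁆ := (bracket_eq_fderiv X Y).symm
  have e2 : e.symm (B (e X) (e Z)) = ⁅X, Z⁆ := (bracket_eq_fderiv X Z).symm
  rw [e1, e2] at h3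
  linarith

/-- The Lie algebra of a group with an involution. -/
noncomputable def groupSymmetricLie {θ : G →* G}
    (hθ : ContMDiff (𝓡 d) (𝓡 d) ∞ (fun x : G => θ x)) (hinv : ∀ x, θ (θ x) = x)
    (hinner : IsInvariantInner d θ) : SymmetricLie (GroupLieAlgebra (𝓡 d) G) where
  ad := LinearMap.mk₂ ℝ (fun X Y => ⁅X, Y⁆) (fun X Y Z => add_lie X Y Z) (fun c X Y => smul_lie c X Y)
    (fun X Y Z => lie_add X Y Z) (fun c X Y => lie_smul c X Y)
  θ := { toFun := fun X => lieDiff θ X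
         map_add' := fun X Y => map_add (lieDiff θ) X Y
         map_smul' := fun c X => map_smul (lieDiff θ) c X }
  ad_swap X Y := (lie_skew X Y).symm
  jacobi X Y Z := lie_lie X Y Z
  θ_θ X := by
    change lieDiff θ (lieDiff θ X) = X
    rw [lieDiff_apply hθ, lieDiff_apply hθ, ContinuousLinearEquiv.apply_symm_apply,
      modelDiff_modelDiff hθ hinv, ContinuousLinearEquiv.symm_apply_apply]
  θ_ad X Y := by
    change lieDiff θ ⁅X, Y⁆ = ⁅lieDiff θ X, lieDiff θ Y⁆
    rw [lieDiff_apply hθ, lieDiff_apply hθ, lieDiff_apply hθ, bracket_eq_fderiv, bracket_eq_fderiv]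
    simp only [ContinuousLinearEquiv.apply_symm_apply]
    rw [modelDiff_bracket hθ]
  inner_ad := inner_bracket hinner
  inner_θ := hinner.1

end Concrete

/-! ### The isotropy representation of a symmetric pair. -/

section ConcreteRep

open Filter Topology

variable {d : ℕ} {G : Type*} [TopologicalSpace G] [ChartedSpace (EuclideanSpace ℝ (Fin d)) G]
  [Group G] [LieGroup (𝓡 d) ∞ G]

/-- Conjugation of endomorphisms by a linear equivalence. -/
noncomputable def endConj {E L : Type*} [NormedAddCommGroup E] [NormedSpace ℝ E]
    [NormedAddCommGroup L] [NormedSpace ℝ L] (e : L ≃L[ℝ] E) : (E →L[ℝ] E) →L[ℝ] (L →L[ℝ] L) :=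
  (ContinuousLinearMap.compL ℝ L E L (e.symm : E →L[ℝ] L)).comp
    ((ContinuousLinearMap.compL ℝ L E E).flip (e : L →L[ℝ] E))

theorem endConj_apply {E L : Type*} [NormedAddCommGroup E] [NormedSpace ℝ E]
    [NormedAddCommGroup L] [NormedSpace ℝ L] (e : L ≃L[ℝ] E) (A : E →L[ℝ] E) (X : L) :
    endConj e A X = e.symm (A (e X)) := rfl

/-- A linear equivalence of finite-dimensional normed spaces is continuous. -/
noncomputable def normedEquiv {E L : Type*} [NormedAddCommGroup E] [NormedSpace ℝ E]
    [NormedAddCommGroup L] [InnerProductSpace ℝ L] [FiniteDimensional ℝ L] (e : L ≃ₗ[ℝ] E) :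
    L ≃L[ℝ] E :=
  e.toContinuousLinearEquiv

/-- Conjugation by g is an endomorphism of the group with differential Ad(g), so `modelDiff_bracket`
applies. -/
theorem modelAd_bracket (g : G) (X Y : EuclideanSpace ℝ (Fin d)) :
    modelAd d g (fderiv ℝ (fun x => modelAd d ((oneChart d G).symm x)) (oneChart d G 1) X Y) =
      fderiv ℝ (fun x => modelAd d ((oneChart d G).symm x)) (oneChart d G 1)
        (modelAd d g X) (modelAd d g Y) := by
  have h : ContMDiff (𝓡 d) (𝓡 d) ∞ (fun x : G => (MulAut.conj g).toMonoidHom x) := by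
    simpa using contMDiff_conj g
  have e : modelDiff d (MulAut.conj g).toMonoidHom = modelAd d g := by
    simp [modelDiff, modelAd]
  have := modelDiff_bracket h X Y
  rwa [e] at this

/-- The isotropy representation of a symmetric pair. -/
theorem exists_isotropyRep_of_model {L : Type*} [NormedAddCommGroup L] [InnerProductSpace ℝ L]
    (D : SymmetricLie L) (e : L ≃L[ℝ] EuclideanSpace ℝ (Fin d))
    {θ : G →* G} {K : Subgroup G} (hpair : IsSymmetricPair d θ K)
    (hDad : ∀ X Y, e (D.ad X Y) = fderiv ℝ (fun x => modelAd d ((oneChart d G).symm x))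
      (oneChart d G 1) (e X) (e Y))
    (hDθ : ∀ X, e (D.θ X) = modelDiff d θ (e X))
    (hinner : ∀ (g : G) X Y, ⟪e.symm (modelAd d g (e X)), e.symm (modelAd d g (e Y))⟫_ℝ = ⟪X, Y⟫_ℝ) :
    ∃ R : IsotropyRep D K, ∀ (k : K) (X : L), R.ρ k X = e.symm (modelAd d (k : G) (e X)) := by
  obtain ⟨s, ε, hε, ψ, hs0, hs, hsd, hst, hsθ, hψ, hcov⟩ :=
    exists_linearizing_chart (d := d) hpair.smooth hpair.involutive
  let S : EuclideanSpace ℝ (Fin d) → G := fun v => (oneChart d G).symm (s v)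
  have hS0 : S 0 = 1 := by simp only [S, hs0, oneChart_symm_one]
  have hSsmooth : ∀ v ∈ Metric.ball (0 : EuclideanSpace ℝ (Fin d)) ε,
      ContMDiffAt 𝓘(ℝ, EuclideanSpace ℝ (Fin d)) (𝓡 d) ∞ S v := fun v hv =>
    (contMDiffAt_oneChart_symm (hst v hv)).comp v
      (hs.contDiffAt (Metric.isOpen_ball.mem_nhds hv)).contMDiffAt
  let T := modelDiff d θ
  have hθe : ∀ X : L, D.θ X = X ↔ T (e X) = e X := by
    intro X
    rw [← e.injective.eq_iff, hDθ]
  -- The fixed vectors in the ball form a convex set; its image under S is connected, consists of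
  -- fixed points of θ and contains 1, so it lies in the identity component.
  have hSK : ∀ v ∈ Metric.ball (0 : EuclideanSpace ℝ (Fin d)) ε, T v = v → S v ∈ K := by
    intro v hv hTv
    have hconv : Convex ℝ (Metric.ball (0 : EuclideanSpace ℝ (Fin d)) ε ∩ {v | T v = v}) := by
      refine (convex_ball 0 ε).inter ?_
      have : {v | T v = v} = (LinearMap.ker ((T : EuclideanSpace ℝ (Fin d) →ₗ[ℝ] _) -
          LinearMap.id) : Set (EuclideanSpace ℝ (Fin d))) := by
        ext v
        simp [sub_eq_zero]
      rw [this]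
      exact Submodule.convex _
    have hpre : IsPreconnected (S '' (Metric.ball 0 ε ∩ {v | T v = v})) :=
      hconv.isPreconnected.image S fun v hv => (hSsmooth v hv.1).continuousAt.continuousWithinAt
    refine hpair.identityComponent_subset (hpre.subset_connectedComponentIn ?_ ?_
      (mem_image_of_mem S ⟨hv, hTv⟩))
    · exact ⟨0, ⟨Metric.mem_ball_self hε, map_zero T⟩, hS0⟩
    · rintro _ ⟨w, hw, rfl⟩
      exact hsθ w hw.1 hw.2
  let a : EuclideanSpace ℝ (Fin d) → EuclideanSpace ℝ (Fin d) →L[ℝ] EuclideanSpace ℝ (Fin d) :=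
    fun v => modelAd d (S v)
  have ha : ContDiffOn ℝ ∞ a (Metric.ball 0 ε) := fun v hv =>
    ((contDiffAt_modelAd (hst v hv)).comp v
      (hs.contDiffAt (Metric.isOpen_ball.mem_nhds hv))).contDiffWithinAt
  obtain ⟨r, hr, hre⟩ : ∃ r > 0, ∀ X ∈ Metric.ball (0 : L) r,
      e X ∈ Metric.ball (0 : EuclideanSpace ℝ (Fin d)) ε := by
    have : ∀ᶠ X in 𝓝 (0 : L), e X ∈ Metric.ball 0 ε := by
      apply e.continuous.continuousAt
      rw [map_zero]
      exact Metric.ball_mem_nhds _ hε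
    exact Metric.eventually_nhds_iff_ball.1 this
  have hchart : ∀ v ∈ Metric.ball (0 : L) r, ∀ w,
      fderiv ℝ (fun X => endConj e (a (e X))) v w = endConj e (fderiv ℝ a (e v) (e w)) := by
    intro v hv w
    have h1 : HasFDerivAt a (fderiv ℝ a (e v)) (e v) :=
      ((ha.contDiffAt (Metric.isOpen_ball.mem_nhds (hre v hv))).differentiableAt
        (by simp)).hasFDerivAt
    have h2 := (endConj e).hasFDerivAt.comp v (h1.comp v
      (e : L →L[ℝ] EuclideanSpace ℝ (Fin d)).hasFDerivAt)
    exact DFunLike.congr_fun h2.fderiv w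
  refine ⟨{
    ρ := { toFun := fun k => endConj e (modelAd d (k : G))
           map_one' := by
             ext1 X
             simp [endConj_apply, modelAd_one]
           map_mul' := fun k l => by
             ext1 X
             simp [endConj_apply, modelAd_mul] }
    continuous_ρ := (endConj e).continuous.comp
      (continuous_modelAd.comp continuous_subtype_val)
    inner_ρ := fun k X Y => hinner (k : G) X Y
    ρ_θ := fun k X => ?_
    ρ_ad := fun k X Y => by
      apply e.injective
      change e (endConj e _ _) = e (D.ad (endConj e _ _) (endConj e _ _))
      simp only [endConj_apply, hDad, e.apply_symm_apply]
      exact modelAd_bracket _ _ _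
    chart := fun X => endConj e (a (e X))
    radius := r
    radius_pos := hr
    contDiffOn_chart := (endConj e).contDiff.comp_contDiffOn
      (ha.comp e.contDiff.contDiffOn hre)
    chart_zero := by
      ext1 X
      simp [endConj_apply, a, hS0, modelAd_one]
    chart_mem := fun v hv hTv => ⟨⟨S (e v), hSK _ (hre v hv) ((hθe v).1 hTv)⟩, rfl⟩
    chart_cover := fun δ hδ => ?_
    fderiv_chart_zero := fun w Y => ?_
    fderiv_chart := fun v hv w hTv hTw => ?_ }, fun k X => rfl⟩
  · apply e.injective
    change e (endConj e _ _) = e (D.θ (endConj e _ _))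
    simp only [endConj_apply, hDθ, e.apply_symm_apply]
    have := DFunLike.congr_fun (modelDiff_modelAd (d := d) hpair.smooth (k : G)) (e X)
    rw [show θ (k : G) = k from hpair.subset_fixed k.2] at this
    exact this.symm
  · have h1 : Tendsto (fun k : K => e.symm (ψ (k : G))) (𝓝 1) (𝓝 0) := by
      have h : Tendsto (fun k : K => (k : G)) (𝓝 1) (𝓝 1) := continuous_subtype_val.tendsto _
      have h2 := e.symm.continuous.tendsto 0
      rw [map_zero] at h2
      exact h2.comp (hψ.comp h)
    have h2 : ∀ᶠ k : K in 𝓝 1, (oneChart d G).symm (s (ψ k)) = k ∧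
        (θ (k : G) = k → modelDiff d θ (ψ k) = ψ k) :=
      (continuous_subtype_val.tendsto (1 : K)).eventually hcov
    filter_upwards [h1 (Metric.ball_mem_nhds _ hδ), h2] with k hk1 hk2
    refine ⟨e.symm (ψ k), by simpa using hk1, (hθe _).2 ?_, ?_⟩
    · rw [e.apply_symm_apply]
      exact hk2.2 (hpair.subset_fixed k.2)
    · change endConj e (modelAd d (k : G)) = _
      simp only [a, e.apply_symm_apply, S, hk2.1]
  · rw [hchart 0 (Metric.mem_ball_self hr), map_zero, endConj_apply]
    have hA : HasFDerivAt (fun x => modelAd d ((oneChart d G).symm x))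
        (fderiv ℝ (fun x => modelAd d ((oneChart d G).symm x)) (oneChart d G 1)) (s 0) := by
      rw [hs0]
      exact ((contDiffAt_modelAd (G := G) oneChart_one_mem_target).differentiableAt (by simp)).hasFDerivAt
    have h1 : fderiv ℝ a 0 = _ := (hA.comp 0 hsd).fderiv
    rw [h1, e.symm_apply_eq, hDad]
    rfl
  · have hv' := hre v hv
    -- As v and w are fixed, this curve stays in the fixed point group near t = 0. Its left
    -- logarithmic derivative at 0 is therefore fixed by T and serves as z.
    have hl : ContMDiffAt 𝓘(ℝ, ℝ) (𝓡 d) ∞ (fun t : ℝ => S (e v + t • e w)) 0 := by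
      refine ContMDiffAt.comp (I' := 𝓘(ℝ, EuclideanSpace ℝ (Fin d))) (g := S) (f := fun t : ℝ => e v + t • e w) 0 ?_ ?_
      · simpa using hSsmooth _ hv'
      · exact (contDiffAt_const.add (contDiffAt_id.smul contDiffAt_const)).contMDiffAt
    obtain ⟨z, hz1, hz2⟩ := hasDerivAt_modelAd_curve (d := d) (g := S (e v))
      (h := fun t : ℝ => S (e v + t • e w)) (by simp) hl
    have hline : HasDerivAt (fun t : ℝ => e v + t • e w) (e w) 0 := by
      simpa using ((hasDerivAt_id (0 : ℝ)).smul_const (e w)).const_add (e v)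
    have hTz : T z = z := by
      refine modelDiff_eq_of_curve hpair.smooth (k := fun t => (S (e v))⁻¹ * S (e v + t • e w))
        (by simp) (contMDiffAt_const.mul hl).continuousAt ?_ hz1
      have hb : ∀ᶠ t : ℝ in 𝓝 0, e v + t • e w ∈ Metric.ball (0 : EuclideanSpace ℝ (Fin d)) ε := by
        apply hline.continuousAt
        simpa using Metric.isOpen_ball.mem_nhds hv'
      filter_upwards [hb] with t ht
      have h1 := hsθ _ hv' ((hθe v).1 hTv)
      have h2 := hsθ _ ht (by
        change T _ = _
        rw [map_add, map_smul, (hθe v).1 hTv, (hθe w).1 hTw])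
      rw [map_mul, map_inv, h2, h1]
    refine ⟨e.symm z, (hθe _).2 (by rw [e.apply_symm_apply, hTz]), fun Y => ?_⟩
    rw [hchart v hv, endConj_apply, endConj_apply]
    change _ = e.symm (modelAd d (S (e v)) (e (D.ad (e.symm z) Y)))
    have h1 : HasFDerivAt a (fderiv ℝ a (e v)) (e v + (0 : ℝ) • e w) := by
      rw [zero_smul, add_zero]
      exact ((ha.contDiffAt (Metric.isOpen_ball.mem_nhds hv')).differentiableAt
        (by simp)).hasFDerivAt
    have h3 : HasDerivAt (fun t : ℝ => a (e v + t • e w)) (fderiv ℝ a (e v) (e w)) 0 :=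
      HasFDerivAt.comp_hasDerivAt (f := fun t : ℝ => e v + t • e w) 0 h1 hline
    have h2 := h3.unique hz2
    rw [h2, hDad]
    simp only [ContinuousLinearEquiv.apply_symm_apply]
    rfl

end ConcreteRep

section ConcreteRep

variable {d : ℕ} {G : Type*} [TopologicalSpace G] [ChartedSpace (EuclideanSpace ℝ (Fin d)) G]
  [Group G] [LieGroup (𝓡 d) ∞ G] [RiemannianBundle (fun x : G => TangentSpace (𝓡 d) x)]

/-- The isotropy representation of a symmetric pair. -/
theorem exists_isotropyRep {θ : G →* G} {K : Subgroup G} (hpair : IsSymmetricPair d θ K)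
    (hinner : IsInvariantInner d θ) :
    ∃ R : IsotropyRep (groupSymmetricLie hpair.smooth hpair.involutive hinner) K,
      ∀ (k : K) (X : GroupLieAlgebra (𝓡 d) G), R.ρ k X = lieAd (k : G) X := by
  obtain ⟨R, hR⟩ := exists_isotropyRep_of_model
    (groupSymmetricLie hpair.smooth hpair.involutive hinner)
    (normedEquiv (L := GroupLieAlgebra (𝓡 d) G) (lieModel d G).toLinearEquiv) hpair
    (fun X Y => congrArg (lieModel d G) (bracket_eq_fderiv X Y))
    (fun X => congrArg (lieModel d G) (lieDiff_apply hpair.smooth X))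
    (fun g X Y => by
      have := hinner.2 g X Y
      rw [lieAd_apply, lieAd_apply] at this
      exact this)
  exact ⟨R, fun k X => (hR k X).trans (lieAd_apply (k : G) X).symm⟩

/-- With θ the identity, every vector of the Lie algebra is fixed, so the results on isotropy
representations also cover the adjoint representation of the whole group. -/
theorem isSymmetricPair_id :
    IsSymmetricPair d (MonoidHom.id G) (⊤ : Subgroup G) where
  smooth := contMDiff_id
  involutive _ := rfl
  isClosed := by simp
  identityComponent_subset := by simp
  subset_fixed := fun x _ => rfl

theorem lieDiff_id (X : GroupLieAlgebra (𝓡 d) G) : lieDiff (MonoidHom.id G) X = X := by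
  have : (fun x : G => (MonoidHom.id G) x) = id := rfl
  rw [lieDiff, this, mfderiv_id]
  rfl

theorem IsInvariantInner.id {θ : G →* G} (h : IsInvariantInner d θ) :
    IsInvariantInner d (MonoidHom.id G) :=
  ⟨fun X Y => by rw [lieDiff_id, lieDiff_id], h.2⟩

end ConcreteRep

/-! ### Orbits of orthogonal actions as submanifolds. -/

/-- An orthogonal representation of a group on `W` which near the identity is smoothly parametrized
by a vector space `V`, with infinitesimal action `B`. -/
structure SmoothAction (V W K : Type*) [NormedAddCommGroup V] [InnerProductSpace ℝ V]
    [NormedAddCommGroup W] [InnerProductSpace ℝ W] [Group K] [TopologicalSpace K] where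
  /-- the representation -/
  act : K →* (W →L[ℝ] W)
  continuous_act : Continuous act
  inner_act : ∀ k X Y, ⟪act k X, act k Y⟫_ℝ = ⟪X, Y⟫_ℝ
  /-- the infinitesimal action -/
  B : V →ₗ[ℝ] W →ₗ[ℝ] W
  /-- the local parametrization -/
  chart : V → W →L[ℝ] W
  /-- the radius of the ball where the parametrization is defined -/
  radius : ℝ
  radius_pos : 0 < radius
  contDiffOn_chart : ContDiffOn ℝ ∞ chart (Metric.ball 0 radius)
  chart_zero : chart 0 = ContinuousLinearMap.id ℝ W
  chart_mem : ∀ v ∈ Metric.ball 0 radius, ∃ k, act k = chart v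
  chart_cover : ∀ ε > 0, ∀ᶠ k in nhds (1 : K), ∃ v, ‖v‖ < ε ∧ act k = chart v
  fderiv_chart_zero : ∀ w Y, fderiv ℝ chart 0 w Y = B w Y
  fderiv_chart : ∀ v ∈ Metric.ball 0 radius, ∀ w, ∃ z, ∀ Y, fderiv ℝ chart v w Y = chart v (B z Y)
  act_B : ∀ k z, ∃ z', ∀ Y, act k (B z Y) = B z' (act k Y)

namespace SmoothAction

open Filter Topology

variable {V W K : Type*} [NormedAddCommGroup V] [InnerProductSpace ℝ V]
    [NormedAddCommGroup W] [InnerProductSpace ℝ W] [Group K] [TopologicalSpace K]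
    (A : SmoothAction V W K)

/-- The orbit of `H`. -/
def orbit (H : W) : Set W := {X | ∃ k, X = A.act k H}

/-- The tangent space of the orbit at `H`. -/
def tangent (H : W) : Submodule ℝ W := LinearMap.range (A.B.flip H)

theorem act_inv_act (k : K) (X : W) : A.act k⁻¹ (A.act k X) = X := by
  have := congrArg (fun T : W →L[ℝ] W => T X) (A.act.map_mul k⁻¹ k)
  simp at this
  exact this.symm

theorem act_act_inv (k : K) (X : W) : A.act k (A.act k⁻¹ X) = X := by
  simpa using A.act_inv_act k⁻¹ X

theorem act_mul (k l : K) (X : W) : A.act (k * l) X = A.act k (A.act l X) := by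
  rw [map_mul]; rfl

theorem norm_act (k : K) (X : W) : ‖A.act k X‖ = ‖X‖ := by
  have := A.inner_act k X X
  rw [real_inner_self_eq_norm_sq, real_inner_self_eq_norm_sq] at this
  exact (sq_eq_sq₀ (norm_nonneg _) (norm_nonneg _)).1 this

theorem inner_act_left (k : K) (X Y : W) : ⟪A.act k X, Y⟫_ℝ = ⟪X, A.act k⁻¹ Y⟫_ℝ := by
  rw [← A.inner_act k X, A.act_act_inv]

theorem self_mem_orbit (H : W) : H ∈ A.orbit H := ⟨1, by simp⟩

theorem act_mem_orbit {H X : W} (k : K) (hX : X ∈ A.orbit H) : A.act k X ∈ A.orbit H := by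
  obtain ⟨l, rfl⟩ := hX
  exact ⟨k * l, (A.act_mul k l H).symm⟩

theorem continuous_act_apply (H : W) : Continuous fun k => A.act k H :=
  A.continuous_act.clm_apply continuous_const

/-- The points of the orbit close to `H` come from group elements close to the identity. -/
theorem exists_isOpen_act [CompactSpace K] [IsTopologicalGroup K] (H : W) {N : Set K}
    (hN : N ∈ 𝓝 (1 : K)) :
    ∃ O : Set W, IsOpen O ∧ H ∈ O ∧ ∀ k, A.act k H ∈ O → ∃ k' ∈ N, A.act k' H = A.act k H := by
  obtain ⟨N', hN', hN'o, h1⟩ := mem_nhds_iff.1 hN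
  -- C = N'·Stab(H) is open, so its complement is compact and has a closed image in the orbit. That
  -- image misses H because C contains the stabilizer.
  let C : Set K := {k | ∃ l, A.act l H = H ∧ k * l⁻¹ ∈ N'}
  have hC : IsOpen C := by
    have : C = ⋃ l ∈ {l | A.act l H = H}, (fun k => k * l⁻¹) ⁻¹' N' := by
      ext k; simp [C]
    rw [this]
    exact isOpen_biUnion fun l _ => hN'o.preimage (continuous_mul_const _)
  have hcl : IsClosed ((fun k => A.act k H) '' Cᶜ) :=
    (hC.isClosed_compl.isCompact.image (A.continuous_act_apply H)).isClosed
  refine ⟨((fun k => A.act k H) '' Cᶜ)ᶜ, hcl.isOpen_compl, ?_, ?_⟩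
  · rintro ⟨k, hk, hkH⟩
    exact hk ⟨k, hkH, by simpa using h1⟩
  · intro k hk
    have hkC : k ∈ C := by
      by_contra h
      exact hk ⟨k, h, rfl⟩
    obtain ⟨l, hl, hkl⟩ := hkC
    refine ⟨k * l⁻¹, hN' hkl, ?_⟩
    rw [A.act_mul]
    have h2 : A.act l⁻¹ H = H := by
      conv_lhs => rw [← hl]
      exact A.act_inv_act l H
    rw [h2]

variable [FiniteDimensional ℝ V] [FiniteDimensional ℝ W]

/-- Near `H`, the orbit is a graph over its tangent space. -/
theorem exists_graph [CompactSpace K] [IsTopologicalGroup K] (H : W) :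
    ∃ (O : Set W) (U : Set (A.tangent H)) (φ : A.tangent H → W), IsOpen O ∧ H ∈ O ∧ IsOpen U ∧
      ContDiffOn ℝ ∞ φ U ∧ φ '' U = A.orbit H ∩ O ∧
      (∀ x ∈ U, (A.tangent H).orthogonalProjectionOnto (φ x) = x) ∧
      (∀ w, fderiv ℝ φ ((A.tangent H).orthogonalProjectionOnto H) w ∈ A.tangent H) := by
  set T := A.tangent H with hT
  let P : W →L[ℝ] T := T.orthogonalProjectionOnto
  let Kr : Submodule ℝ V := LinearMap.ker (A.B.flip H)
  let Q : V →L[ℝ] Kr := Kr.orthogonalProjectionOnto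
  -- a small ball on which the parametrization is close to the identity
  have hP : ∀ t : T, P t = t := fun t => T.orthogonalProjectionOnto_mem_subspace_eq_self t
  have hc0 : ContinuousAt (fun v => (P.comp (A.chart v)).comp T.subtypeL) 0 := by
    have h := (A.contDiffOn_chart.contDiffAt (Metric.ball_mem_nhds _ A.radius_pos)).continuousAt
    exact (continuousAt_const.clm_comp h).clm_comp continuousAt_const
  have hinj : ∀ᶠ v in 𝓝 (0 : V), ∀ t : T, P (A.chart v t) = 0 → t = 0 := by
    have h1 : range ((↑) : (T ≃L[ℝ] T) → T →L[ℝ] T) ∈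
        𝓝 ((P.comp (A.chart 0)).comp T.subtypeL) := by
      have : (P.comp (A.chart 0)).comp T.subtypeL = (ContinuousLinearEquiv.refl ℝ T : T →L[ℝ] T) := by
        ext1 t
        simp [A.chart_zero, hP]
      rw [this]
      exact ContinuousLinearEquiv.nhds _
    filter_upwards [hc0 h1] with v hv t ht
    obtain ⟨f, hf⟩ := hv
    have : f t = P (A.chart v t) := DFunLike.congr_fun hf t
    rw [ht] at this
    simpa using this
  obtain ⟨r, hr, hrinj⟩ := Metric.eventually_nhds_iff_ball.1
    (Filter.Eventually.and hinj (Metric.ball_mem_nhds (0 : V) A.radius_pos))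
  let Φ : V → W := fun v => A.chart v H
  have hΦ : ContDiffOn ℝ ∞ Φ (Metric.ball 0 r) :=
    (A.contDiffOn_chart.mono fun v hv => (hrinj v hv).2).clm_apply contDiffOn_const
  have hΦd : ∀ v ∈ Metric.ball (0 : V) r, HasFDerivAt Φ ((fderiv ℝ A.chart v).flip H) v := by
    intro v hv
    have h := ((A.contDiffOn_chart.contDiffAt (Metric.isOpen_ball.mem_nhds
      (hrinj v hv).2)).differentiableAt (by simp)).hasFDerivAt
    refine (h.clm_apply (hasFDerivAt_const H v)).congr_fderiv ?_
    ext1 w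
    simp
  -- The parameter v is traded for the projection of the orbit point to T together with the
  -- component of v along the kernel of w ↦ B w H. By rank-nullity this is a local diffeomorphism at
  -- 0; the orbit point will turn out not to depend on the second coordinate.
  let f : V → T × Kr := fun v => (P (Φ v), Q v)
  have hf : ContDiffOn ℝ ∞ f (Metric.ball 0 r) :=
    (P.contDiff.comp_contDiffOn hΦ).prodMk Q.contDiff.contDiffOn
  let f0 : V →ₗ[ℝ] T × Kr := ((A.B.flip H).rangeRestrict).prod (Q : V →ₗ[ℝ] Kr)
  have hf0inj : Function.Injective f0 := by
    rw [← LinearMap.ker_eq_bot, LinearMap.ker_eq_bot']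
    intro v hv
    have h1 : A.B.flip H v = 0 := congrArg (fun p : T × Kr => (p.1 : W)) hv
    have h2 : Q v = 0 := congrArg (fun p : T × Kr => p.2) hv
    have h3 : Q v = ⟨v, h1⟩ := Kr.orthogonalProjectionOnto_mem_subspace_eq_self ⟨v, h1⟩
    rw [h3] at h2
    exact congrArg Subtype.val h2
  have hdim : Module.finrank ℝ V = Module.finrank ℝ (T × Kr) := by
    rw [Module.finrank_prod]
    exact (LinearMap.finrank_range_add_finrank_ker (A.B.flip H)).symm
  let f' : V ≃L[ℝ] T × Kr :=
    (LinearEquiv.ofInjectiveOfFinrankEq f0 hf0inj hdim).toContinuousLinearEquiv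
  have h0r : (0 : V) ∈ Metric.ball (0 : V) r := Metric.mem_ball_self hr
  have hfd : HasFDerivAt f (f' : V →L[ℝ] T × Kr) 0 := by
    refine ((P.hasFDerivAt.comp (0 : V) (hΦd 0 h0r)).prodMk Q.hasFDerivAt).congr_fderiv ?_
    ext1 w
    have h1 : fderiv ℝ A.chart 0 w H = A.B w H := A.fderiv_chart_zero w H
    have h2 : P (A.B w H) = (A.B.flip H).rangeRestrict w :=
      hP ((A.B.flip H).rangeRestrict w)
    change (P (fderiv ℝ A.chart 0 w H), Q w) = ((A.B.flip H).rangeRestrict w, Q w)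
    rw [h1, h2]
    rfl
  obtain ⟨e, he0, her, hef, hes⟩ :=
    exists_smooth_openPartialHomeomorph Metric.isOpen_ball h0r hf hfd
  have hfz : f 0 = (P H, 0) := by
    simp [f, Φ, A.chart_zero]
  have ht0 : (P H, (0 : Kr)) ∈ e.target := by
    have := e.map_source he0
    rwa [hef, hfz] at this
  have hs0 : e.symm (P H, 0) = 0 := by
    have := e.left_inv he0
    rwa [hef, hfz] at this
  obtain ⟨δ, hδ, hδt⟩ : ∃ δ > 0, Metric.ball (P H) δ ×ˢ Metric.ball (0 : Kr) δ ⊆ e.target := by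
    obtain ⟨δ, hδ, h⟩ := Metric.isOpen_iff.1 e.open_target _ ht0
    exact ⟨δ, hδ, by rwa [ball_prod_same]⟩
  let g : T × Kr → W := fun p => Φ (e.symm p)
  have hg : ContDiffOn ℝ ∞ g e.target := hΦ.comp hes fun p hp => her (e.map_target hp)
  have hPg : ∀ p ∈ e.target, P (g p) = p.1 := by
    intro p hp
    have := e.right_inv hp
    rw [hef] at this
    exact congrArg Prod.fst this
  have hgd : ∀ p ∈ e.target, HasFDerivAt g (((fderiv ℝ A.chart (e.symm p)).flip H).comp
      (fderiv ℝ e.symm p)) p := by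
    intro p hp
    exact (hΦd _ (her (e.map_target hp))).comp p
      ((hes.contDiffAt (e.open_target.mem_nhds hp)).differentiableAt (by simp)).hasFDerivAt
  -- This derivative projects to 0 in T, because P ∘ g is the first coordinate. It also has the form
  -- chart(v)(B z H) with B z H in T, and P ∘ chart(v) is injective on T for small v; hence it
  -- vanishes.
  have hgy : ∀ p ∈ e.target, ∀ y : Kr, fderiv ℝ g p (0, y) = 0 := by
    intro p hp y
    have h1 : HasFDerivAt (fun p => P (g p)) (P.comp (fderiv ℝ g p)) p := by
      rw [(hgd p hp).fderiv]
      exact P.hasFDerivAt.comp p (hgd p hp)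
    have h2 : HasFDerivAt (fun p => P (g p)) (ContinuousLinearMap.fst ℝ T Kr) p := by
      refine (hasFDerivAt_fst (p := p)).congr_of_eventuallyEq ?_
      filter_upwards [e.open_target.mem_nhds hp] with q hq
      exact hPg q hq
    have h3 : P (fderiv ℝ g p (0, y)) = 0 := by
      simpa using DFunLike.congr_fun (h1.unique h2) ((0 : T), y)
    rw [(hgd p hp).fderiv] at h3 ⊢
    have hb := her (e.map_target hp)
    obtain ⟨z, hz⟩ := A.fderiv_chart (e.symm p) (hrinj _ hb).2 (fderiv ℝ e.symm p (0, y))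
    have h4 : (((fderiv ℝ A.chart (e.symm p)).flip H).comp (fderiv ℝ e.symm p)) ((0 : T), y) =
        A.chart (e.symm p) (A.B z H) := hz H
    rw [h4] at h3 ⊢
    have h5 := (hrinj _ hb).1 ⟨A.B z H, z, rfl⟩ h3
    rw [show A.B z H = 0 from congrArg Subtype.val h5, map_zero]
  have hconst : ∀ u ∈ Metric.ball (P H) δ, ∀ y ∈ Metric.ball (0 : Kr) δ, g (u, y) = g (u, 0) := by
    intro u hu y hy
    have hd : ∀ y ∈ Metric.ball (0 : Kr) δ, HasFDerivAt (fun y => g (u, y)) (0 : Kr →L[ℝ] W) y := by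
      intro y hy
      have hp := hδt (mk_mem_prod hu hy)
      have h1 : HasFDerivAt g (fderiv ℝ g (u, y)) (u, y) :=
        (hgd _ hp).differentiableAt.hasFDerivAt
      refine (h1.comp y ((hasFDerivAt_const u y).prodMk (hasFDerivAt_id y))).congr_fderiv ?_
      ext1 w
      exact hgy _ hp w
    refine (convex_ball (0 : Kr) δ).is_const_of_fderivWithin_eq_zero (𝕜 := ℝ)
      (fun y hy => (hd y hy).differentiableAt.differentiableWithinAt) ?_ hy (Metric.mem_ball_self hδ)
    intro y hy
    rw [fderivWithin_of_isOpen Metric.isOpen_ball hy]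
    exact (hd y hy).fderiv
  -- the neighbourhood of `0` covered by the product
  have hN : ∀ᶠ v in 𝓝 (0 : V), v ∈ e.source ∧ e v ∈ Metric.ball (P H) δ ×ˢ Metric.ball (0 : Kr) δ := by
    refine Filter.Eventually.and (e.open_source.mem_nhds he0) ?_
    refine e.continuousAt he0 ?_
    rw [hef, hfz]
    exact prod_mem_nhds (Metric.ball_mem_nhds _ hδ) (Metric.ball_mem_nhds _ hδ)
  obtain ⟨ε, hε, hεN⟩ := Metric.eventually_nhds_iff_ball.1 hN
  -- Inside O every point of the orbit comes from a small parameter, so no other sheet of the orbit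
  -- enters O.
  obtain ⟨O, hO, hHO, hcov⟩ := A.exists_isOpen_act H (A.chart_cover ε hε)
  let φ : T → W := fun u => g (u, 0)
  have hφ : ContDiffOn ℝ ∞ φ (Metric.ball (P H) δ) :=
    hg.comp (contDiff_id.prodMk contDiff_const).contDiffOn
      fun u hu => hδt (mk_mem_prod hu (Metric.mem_ball_self hδ))
  have hPφ : ∀ u ∈ Metric.ball (P H) δ, P (φ u) = u := fun u hu =>
    hPg _ (hδt (mk_mem_prod hu (Metric.mem_ball_self hδ)))
  refine ⟨O, Metric.ball (P H) δ ∩ φ ⁻¹' O, φ, hO, hHO,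
    hφ.continuousOn.isOpen_inter_preimage Metric.isOpen_ball hO, hφ.mono inter_subset_left, ?_,
    fun x hx => hPφ x hx.1, ?_⟩
  · ext q
    constructor
    · rintro ⟨u, hu, rfl⟩
      refine ⟨?_, hu.2⟩
      have hb := her (e.map_target (hδt (mk_mem_prod hu.1 (Metric.mem_ball_self hδ))))
      obtain ⟨k, hk⟩ := A.chart_mem _ (hrinj _ hb).2
      exact ⟨k, by rw [hk]⟩
    · rintro ⟨⟨k, rfl⟩, hq⟩
      obtain ⟨k', ⟨v, hv, hkv⟩, hk'⟩ := hcov k hq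
      obtain ⟨hvs, hve⟩ := hεN v (by simpa using hv)
      have h1 : g (e v) = A.act k H := by
        simp only [g]
        rw [e.left_inv hvs, ← hk', hkv]
      have h2 : φ (e v).1 = A.act k H := by
        rw [← h1]
        exact (hconst _ hve.1 _ hve.2).symm
      exact ⟨(e v).1, ⟨hve.1, by rw [mem_preimage, h2]; exact hq⟩, h2⟩
  · intro w
    have h1 : HasFDerivAt (g ∘ fun u : T => (u, (0 : Kr))) _ (P H) :=
      HasFDerivAt.comp (f := fun u : T => (u, (0 : Kr))) (P H) (hgd _ ht0)
        ((hasFDerivAt_id (𝕜 := ℝ) (P H)).prodMk (hasFDerivAt_const (0 : Kr) (P H)))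
    change fderiv ℝ φ (P H) w ∈ T
    rw [show φ = g ∘ fun u : T => (u, (0 : Kr)) from rfl, h1.fderiv, hs0]
    exact ⟨_, (A.fderiv_chart_zero _ H).symm⟩

end SmoothAction

/-! ### Tangent spaces and shape operators of orbits. -/

namespace SmoothAction

open Filter Topology

variable {V W K : Type*} [NormedAddCommGroup V] [InnerProductSpace ℝ V]
    [NormedAddCommGroup W] [InnerProductSpace ℝ W] [Group K] [TopologicalSpace K]
    (A : SmoothAction V W K)

theorem orbit_act (k : K) (H : W) : A.orbit (A.act k H) = A.orbit H := by
  ext X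
  constructor
  · rintro ⟨l, rfl⟩
    exact ⟨l * k, (A.act_mul l k H).symm⟩
  · rintro ⟨l, rfl⟩
    exact ⟨l * k⁻¹, by rw [A.act_mul, A.act_inv_act]⟩

theorem act_mem_tangent {H X : W} (k : K) (hX : X ∈ A.tangent H) :
    A.act k X ∈ A.tangent (A.act k H) := by
  obtain ⟨z, rfl⟩ := hX
  obtain ⟨z', hz'⟩ := A.act_B k z
  exact ⟨z', (hz' H).symm⟩

theorem act_inv_mem_tangent {H X : W} (k : K) (hX : X ∈ A.tangent (A.act k H)) :
    A.act k⁻¹ X ∈ A.tangent H := by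
  have := A.act_mem_tangent k⁻¹ hX
  rwa [A.act_inv_act] at this

/-- The action between tangent spaces of the orbit. -/
noncomputable def tangentEquiv (k : K) (H : W) : A.tangent H ≃ₗ[ℝ] A.tangent (A.act k H) where
  toFun X := ⟨A.act k X, A.act_mem_tangent k X.2⟩
  invFun X := ⟨A.act k⁻¹ X, A.act_inv_mem_tangent k X.2⟩
  map_add' X Y := Subtype.ext (map_add (A.act k) (X : W) Y)
  map_smul' c X := Subtype.ext (map_smul (A.act k) c (X : W))
  left_inv X := Subtype.ext (A.act_inv_act k X)
  right_inv X := Subtype.ext (A.act_act_inv k X)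

variable [FiniteDimensional ℝ V] [FiniteDimensional ℝ W]

theorem isSmoothSubmanifold_orbit [CompactSpace K] [IsTopologicalGroup K] (H : W) :
    IsSmoothSubmanifold (A.orbit H) := by
  refine ⟨Module.finrank ℝ (A.tangent H), ?_⟩
  rintro p ⟨k, rfl⟩
  have hdim : Module.finrank ℝ (A.tangent (A.act k H)) = Module.finrank ℝ (A.tangent H) :=
    (A.tangentEquiv k H).finrank_eq.symm
  obtain ⟨O, U, φ, hO, hp, hU, hφ, himg, hP, -⟩ := A.exists_graph (A.act k H)
  rw [A.orbit_act] at himg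
  let L : A.tangent (A.act k H) ≃L[ℝ]
      EuclideanSpace ℝ (Fin (Module.finrank ℝ (A.tangent H))) :=
    ContinuousLinearEquiv.ofFinrankEq (by rw [hdim, finrank_euclideanSpace_fin])
  refine ⟨O, L.symm ⁻¹' U, φ ∘ L.symm, fun x => L ((A.tangent _).orthogonalProjectionOnto x),
    hO, hp, hU.preimage L.symm.continuous, ?_, ?_, ?_, ?_⟩
  · exact hφ.comp L.symm.contDiff.contDiffOn fun x hx => hx
  · exact (L.contDiff.comp ((A.tangent (A.act k H)).orthogonalProjectionOnto).contDiff).contDiffOn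
  · rw [image_comp, image_preimage_eq _ L.symm.surjective, himg]
  · intro x hx
    simp only [Function.comp]
    rw [hP _ hx, L.apply_symm_apply]

/-- A curve in the orbit factors near time 0 through the graph of `exists_graph`, so its velocity
lies in B(V, H). Conversely the parametrization of the action provides a curve with each such
velocity, up to scaling. -/
theorem tangentSpaceOf_orbit [CompactSpace K] [IsTopologicalGroup K] (H : W) :
    tangentSpaceOf (A.orbit H) H = A.tangent H := by
  apply le_antisymm
  · refine Submodule.span_le.2 ?_
    rintro _ ⟨c, hc, hcM, hc0, rfl⟩
    obtain ⟨O, U, φ, hO, hH, hU, hφ, himg, hP, hd⟩ := A.exists_graph H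
    set P := (A.tangent H).orthogonalProjectionOnto
    have hx : ∀ q ∈ A.orbit H ∩ O, P q ∈ U ∧ φ (P q) = q := by
      intro q hq
      rw [← himg] at hq
      obtain ⟨u, hu, rfl⟩ := hq
      rw [hP u hu]
      exact ⟨hu, rfl⟩
    have hHU := (hx H ⟨A.self_mem_orbit H, hH⟩).1
    have hev : c =ᶠ[𝓝 0] fun t => φ (P (c t)) := by
      have : ∀ᶠ t in 𝓝 (0 : ℝ), c t ∈ O := by
        apply hc.continuous.continuousAt
        rw [hc0]
        exact hO.mem_nhds hH
      filter_upwards [this] with t ht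
      exact (hx _ ⟨hcM t, ht⟩).2.symm
    have hcd : HasDerivAt c (deriv c 0) 0 := (hc.differentiable (by simp) 0).hasDerivAt
    have hφd : HasFDerivAt φ (fderiv ℝ φ (P H)) (P (c 0)) := by
      rw [hc0]
      exact ((hφ.contDiffAt (hU.mem_nhds hHU)).differentiableAt (by simp)).hasFDerivAt
    have h1 : HasDerivAt (fun t => φ (P (c t))) (fderiv ℝ φ (P H) (P (deriv c 0))) 0 :=
      HasFDerivAt.comp_hasDerivAt (f := fun t => P (c t)) 0 hφd
        (P.hasFDerivAt.comp_hasDerivAt 0 hcd)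
    have h2 := (h1.congr_of_eventuallyEq hev).unique hcd
    rw [← h2]
    exact hd _
  · rintro _ ⟨z, rfl⟩
    -- The curve must be smooth and stay in the orbit for all real times while the chart lives on a
    -- ball. The parameter a sin(t) z stays in the ball and has velocity a z at 0.
    obtain ⟨a, ha, har⟩ : ∃ a : ℝ, 0 < a ∧ a * ‖z‖ < A.radius := by
      refine ⟨A.radius / (‖z‖ + 1), div_pos A.radius_pos (by positivity), ?_⟩
      rw [div_mul_eq_mul_div, div_lt_iff₀ (by positivity)]
      nlinarith [A.radius_pos, norm_nonneg z]
    have hball : ∀ t : ℝ, (a * Real.sin t) • z ∈ Metric.ball (0 : V) A.radius := by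
      intro t
      rw [mem_ball_zero_iff, norm_smul, Real.norm_eq_abs, abs_mul, abs_of_pos ha]
      refine lt_of_le_of_lt ?_ har
      have := Real.abs_sin_le_one t
      gcongr
      nlinarith
    have hcd : ∀ v ∈ Metric.ball (0 : V) A.radius, ContDiffAt ℝ ∞ A.chart v := fun v hv =>
      A.contDiffOn_chart.contDiffAt (Metric.isOpen_ball.mem_nhds hv)
    have hs : ContDiff ℝ ∞ fun t : ℝ => (a * Real.sin t) • z :=
      (contDiff_const.mul Real.contDiff_sin).smul contDiff_const
    have hmem : a • A.B z H ∈ tangentSpaceOf (A.orbit H) H := by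
      refine Submodule.subset_span ⟨fun t => A.chart ((a * Real.sin t) • z) H, ?_, ?_, ?_, ?_⟩
      · refine ContDiff.clm_apply ?_ contDiff_const
        exact contDiff_iff_contDiffAt.2 fun t => (hcd _ (hball t)).comp t hs.contDiffAt
      · intro t
        obtain ⟨k, hk⟩ := A.chart_mem _ (hball t)
        exact ⟨k, by rw [hk]⟩
      · simp [A.chart_zero]
      · have h1 : HasDerivAt (fun t : ℝ => (a * Real.sin t) • z) (a • z) 0 := by
          have := ((Real.hasDerivAt_sin 0).const_mul a).smul_const z
          simpa using this
        have h2 : HasFDerivAt A.chart (fderiv ℝ A.chart 0) ((a * Real.sin 0) • z) := by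
          rw [Real.sin_zero, mul_zero, zero_smul]
          exact ((hcd 0 (Metric.mem_ball_self A.radius_pos)).differentiableAt (by simp)).hasFDerivAt
        have h3 := (HasFDerivAt.comp_hasDerivAt (f := fun t : ℝ => (a * Real.sin t) • z) 0 h2
          h1).clm_apply (hasDerivAt_const 0 H)
        have h4 := h3.deriv
        simp only [map_zero, add_zero] at h4
        refine h4.trans ?_
        rw [map_smul]
        change a • fderiv ℝ A.chart 0 z H = _
        rw [A.fderiv_chart_zero]
    have := Submodule.smul_mem _ a⁻¹ hmem
    rwa [smul_smul, inv_mul_cancel₀ ha.ne', one_smul] at this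

theorem tangentSpaceOf_orbit_of_mem [CompactSpace K] [IsTopologicalGroup K] {H p : W}
    (hp : p ∈ A.orbit H) : tangentSpaceOf (A.orbit H) p = A.tangent p := by
  obtain ⟨k, rfl⟩ := hp
  rw [← A.orbit_act k H, A.tangentSpaceOf_orbit]

theorem mem_sphereNormalSpace [CompactSpace K] [IsTopologicalGroup K] {H p ξ : W}
    (hp : p ∈ A.orbit H) : ξ ∈ sphereNormalSpace (A.orbit H) p ↔
      ⟪p, ξ⟫_ℝ = 0 ∧ ∀ z, ⟪A.B z p, ξ⟫_ℝ = 0 := by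
  rw [sphereNormalSpace, A.tangentSpaceOf_orbit_of_mem hp, Submodule.mem_inf,
    Submodule.mem_orthogonal_singleton_iff_inner_right, Submodule.mem_orthogonal]
  refine and_congr Iff.rfl ⟨fun h z => h _ ⟨z, rfl⟩, ?_⟩
  rintro h _ ⟨z, rfl⟩
  exact h z

/-- The shape operator of an orbit. -/
theorem isShapeOperator_iff [CompactSpace K] [IsTopologicalGroup K] {H p ξ : W}
    (hp : p ∈ A.orbit H) (hξ : ξ ∈ sphereNormalSpace (A.orbit H) p)
    (S : tangentSpaceOf (A.orbit H) p →ₗ[ℝ] tangentSpaceOf (A.orbit H) p) :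
    IsShapeOperator (A.orbit H) p ξ S ↔
      ∀ z (u : tangentSpaceOf (A.orbit H) p), (u : W) = A.B z p →
        ∀ z', ⟪(S u : W), A.B z' p⟫_ℝ = -⟪A.B z ξ, A.B z' p⟫_ℝ := by
  have hT := A.tangentSpaceOf_orbit_of_mem hp
  obtain ⟨h1, h2⟩ := (A.mem_sphereNormalSpace hp).1 hξ
  -- Since ξ is orthogonal to p, the projection in the connection of the sphere does not affect the
  -- pairing with ξ.
  have hcov : ∀ x : W, ⟪(ℝ ∙ p)ᗮ.starProjection x, ξ⟫_ℝ = ⟪x, ξ⟫_ℝ := by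
    intro x
    rw [Submodule.inner_starProjection_left_eq_right, Submodule.starProjection_eq_self_iff.2]
    exact hξ.1
  have key : ∀ z (Y : W → W), ContDiff ℝ ∞ Y → (∀ q ∈ A.orbit H, Y q ∈ tangentSpaceOf (A.orbit H) q) →
      ⟪fderiv ℝ Y p (A.B z p), ξ⟫_ℝ = -⟪A.B z ξ, Y p⟫_ℝ := by
    intro z Y hY hYt
    have hc : ∀ X : W, HasDerivAt (fun t : ℝ => A.chart (t • z) X) (A.B z X) 0 := by
      intro X
      have h1 : HasDerivAt (fun t : ℝ => t • z) z 0 := by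
        simpa using (hasDerivAt_id (0 : ℝ)).smul_const z
      have h2 : HasFDerivAt A.chart (fderiv ℝ A.chart 0) ((0 : ℝ) • z) := by
        rw [zero_smul]
        exact ((A.contDiffOn_chart.contDiffAt (Metric.ball_mem_nhds _
          A.radius_pos)).differentiableAt (by simp)).hasFDerivAt
      have h3 := (HasFDerivAt.comp_hasDerivAt (f := fun t : ℝ => t • z) 0 h2
          h1).clm_apply (hasDerivAt_const 0 X)
      simp only [map_zero, add_zero, A.fderiv_chart_zero] at h3
      exact h3
    have hYd : HasFDerivAt Y (fderiv ℝ Y p) (A.chart ((0 : ℝ) • z) p) := by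
      rw [zero_smul, A.chart_zero]
      exact (hY.differentiable (by simp) _).hasFDerivAt
    have h3 : HasDerivAt (fun t : ℝ => Y (A.chart (t • z) p)) (fderiv ℝ Y p (A.B z p)) 0 :=
      HasFDerivAt.comp_hasDerivAt (f := fun t : ℝ => A.chart (t • z) p) 0 hYd (hc p)
    have h4 := h3.inner ℝ (hc ξ)
    -- The action carries ξ to a normal vector at the moved point, so a tangent field stays
    -- orthogonal to it along the curve. Differentiating ⟨Y(k p), k ξ⟩ = 0 gives the formula.
    have h5 : HasDerivAt (fun t : ℝ => ⟪Y (A.chart (t • z) p), A.chart (t • z) ξ⟫_ℝ) 0 0 := by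
      refine (hasDerivAt_const (0 : ℝ) (0 : ℝ)).congr_of_eventuallyEq ?_
      have hb : ∀ᶠ t : ℝ in 𝓝 0, t • z ∈ Metric.ball (0 : V) A.radius := by
        have : ContinuousAt (fun t : ℝ => t • z) 0 := by fun_prop
        apply this
        simpa using Metric.ball_mem_nhds _ A.radius_pos
      filter_upwards [hb] with t ht
      obtain ⟨k, hk⟩ := A.chart_mem _ ht
      rw [← hk]
      have hq := A.act_mem_orbit k hp
      have h6 := hYt _ hq
      rw [A.tangentSpaceOf_orbit_of_mem hq] at h6
      obtain ⟨z', hz'⟩ := A.act_inv_mem_tangent k h6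
      have hz'' : A.B z' p = A.act k⁻¹ (Y (A.act k p)) := hz'
      have := h2 z'
      rw [hz'', A.inner_act_left, inv_inv] at this
      exact this
    have h6 := h4.unique h5
    simp only [zero_smul, A.chart_zero, ContinuousLinearMap.id_apply] at h6
    rw [real_inner_comm (Y p)]
    linarith
  constructor
  · intro hS z u hu z'
    have h3 := hS u (fun q => A.B z' q) (LinearMap.toContinuousLinearMap (A.B z')).contDiff
      (fun q hq => by
        rw [A.tangentSpaceOf_orbit_of_mem hq]
        exact ⟨z', rfl⟩)
    rw [h3, sphereCovDeriv, hcov, hu]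
    refine key z _ (LinearMap.toContinuousLinearMap (A.B z')).contDiff ?_
    intro q hq
    rw [A.tangentSpaceOf_orbit_of_mem hq]
    exact ⟨z', rfl⟩
  · intro hS u Y hY hYt
    obtain ⟨z, hz⟩ : ∃ z, A.B z p = u := by
      exact hT.le u.2
    obtain ⟨z', hz'⟩ : ∃ z', A.B z' p = Y p := by
      have := hYt p hp
      rw [hT] at this
      exact this
    rw [sphereCovDeriv, hcov, ← hz, key z Y hY hYt, ← hz', hS z u hz.symm z']

/-- The eigenvalues of the shape operator at `p` in the normal direction `ξ` are symmetric. -/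
def IsSymmetricShape (p ξ : W) : Prop :=
  ∃ S : A.tangent p →ₗ[ℝ] A.tangent p,
    (∀ z (u : A.tangent p), (u : W) = A.B z p → ∀ z', ⟪(S u : W), A.B z' p⟫_ℝ = -⟪A.B z ξ, A.B z' p⟫_ℝ) ∧
    ∀ c : ℝ, Module.finrank ℝ (Module.End.eigenspace S c) =
      Module.finrank ℝ (Module.End.eigenspace S (-c))

-- The action is isometric and permutes the infinitesimal generators, so conjugating the shape
-- operator by `tangentEquiv` gives the one at the moved point, with the same eigenspace dimensions.
omit [FiniteDimensional ℝ V] [FiniteDimensional ℝ W] in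
theorem IsSymmetricShape.act {p ξ : W} (h : A.IsSymmetricShape p ξ) (k : K) :
    A.IsSymmetricShape (A.act k p) (A.act k ξ) := by
  obtain ⟨S, hS, hc⟩ := h
  let e := A.tangentEquiv k p
  have he : ∀ c, Module.finrank ℝ (Module.End.eigenspace
      (e.toLinearMap ∘ₗ S ∘ₗ e.symm.toLinearMap) c) =
      Module.finrank ℝ (Module.End.eigenspace S c) := by
    intro c
    rw [← LinearEquiv.finrank_map_eq e (Module.End.eigenspace S c)]
    suffices h : Module.End.eigenspace (e.toLinearMap ∘ₗ S ∘ₗ e.symm.toLinearMap) c =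
        Submodule.map e.toLinearMap (Module.End.eigenspace S c) by rw [h]
    ext X
    rw [Module.End.mem_eigenspace_iff, Submodule.mem_map]
    constructor
    · intro hX
      refine ⟨e.symm X, ?_, e.apply_symm_apply X⟩
      rw [Module.End.mem_eigenspace_iff]
      apply e.injective
      rw [map_smul, e.apply_symm_apply]
      exact hX
    · rintro ⟨Y, hY, rfl⟩
      rw [Module.End.mem_eigenspace_iff] at hY
      change e (S (e.symm (e Y))) = c • e Y
      rw [e.symm_apply_apply, hY, map_smul]
  refine ⟨e.toLinearMap ∘ₗ S ∘ₗ e.symm.toLinearMap, ?_, fun c => by rw [he, he, hc]⟩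
  intro z u hu z'
  obtain ⟨w, hw⟩ := A.act_B k⁻¹ z
  obtain ⟨w', hw'⟩ := A.act_B k⁻¹ z'
  have h1 : ((e.symm u : A.tangent p) : W) = A.B w p := by
    change A.act k⁻¹ u = _
    rw [hu, hw, A.act_inv_act]
  have h2 := hS w (e.symm u) h1 w'
  change ⟪A.act k (S (e.symm u)), A.B z' (A.act k p)⟫_ℝ = _
  rw [A.inner_act_left, hw', A.act_inv_act, h2, ← A.inner_act k⁻¹ (A.B z _), hw, hw', A.act_inv_act,
    A.act_inv_act]

/-- An orbit is austere if and only if the shape operators at one point have symmetric spectra. -/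
theorem isAustereInSphere_orbit_iff [CompactSpace K] [IsTopologicalGroup K] (H : W) :
    IsAustereInSphere ‖H‖ (A.orbit H) ↔
      ∀ ξ, ⟪H, ξ⟫_ℝ = 0 → (∀ z, ⟪A.B z H, ξ⟫_ℝ = 0) → A.IsSymmetricShape H ξ := by
  have hshape : ∀ p ∈ A.orbit H, ∀ ξ ∈ sphereNormalSpace (A.orbit H) p,
      ((∃ S : tangentSpaceOf (A.orbit H) p →ₗ[ℝ] tangentSpaceOf (A.orbit H) p,
        IsShapeOperator (A.orbit H) p ξ S ∧ ∀ c : ℝ,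
          Module.finrank ℝ (Module.End.eigenspace S c) =
          Module.finrank ℝ (Module.End.eigenspace S (-c))) ↔ A.IsSymmetricShape p ξ) := by
    intro p hp ξ hξ
    have h := A.isShapeOperator_iff hp hξ
    simp only [h]
    rw [A.tangentSpaceOf_orbit_of_mem hp]
    rfl
  constructor
  · rintro ⟨-, -, h⟩ ξ h1 h2
    have hξ := (A.mem_sphereNormalSpace (A.self_mem_orbit H)).2 ⟨h1, h2⟩
    exact (hshape H (A.self_mem_orbit H) ξ hξ).1 (h H (A.self_mem_orbit H) ξ hξ)
  · intro h
    refine ⟨?_, A.isSmoothSubmanifold_orbit H, ?_⟩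
    · rintro _ ⟨k, rfl⟩
      rw [mem_sphere_zero_iff_norm, A.norm_act]
    · intro p hp ξ hξ
      rw [hshape p hp ξ hξ]
      obtain ⟨h1, h2⟩ := (A.mem_sphereNormalSpace hp).1 hξ
      obtain ⟨k, rfl⟩ := hp
      have h3 := (h (A.act k⁻¹ ξ) ?_ ?_).act A k
      · rwa [A.act_act_inv] at h3
      · rw [← A.inner_act_left, h1]
      · intro z
        obtain ⟨z', hz'⟩ := A.act_B k z
        rw [← A.inner_act_left, hz', h2]

end SmoothAction

/-! ### The decomposition into 𝔨 and 𝔪, and maximal abelian subspaces. -/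

namespace SymmetricLie

variable {L : Type*} [NormedAddCommGroup L] [InnerProductSpace ℝ L] (D : SymmetricLie L)

/-- The `-1` eigenspace of the involution. -/
def m : Submodule ℝ L where
  carrier := {X | D.θ X = -X}
  add_mem' {X Y} hX hY := by
    change D.θ (X + Y) = -(X + Y)
    rw [map_add, show D.θ X = -X from hX, show D.θ Y = -Y from hY, neg_add]
  zero_mem' := by simp
  smul_mem' c X hX := by
    change D.θ (c • X) = -(c • X)
    rw [map_smul, show D.θ X = -X from hX, smul_neg]

/-- The fixed space of the involution. -/
def k : Submodule ℝ L where
  carrier := {X | D.θ X = X}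
  add_mem' {X Y} hX hY := by
    change D.θ (X + Y) = X + Y
    rw [map_add, show D.θ X = X from hX, show D.θ Y = Y from hY]
  zero_mem' := by simp
  smul_mem' c X hX := by
    change D.θ (c • X) = c • X
    rw [map_smul, show D.θ X = X from hX]

variable {D}

theorem mem_m {X : L} : X ∈ D.m ↔ D.θ X = -X := Iff.rfl

theorem mem_k {X : L} : X ∈ D.k ↔ D.θ X = X := Iff.rfl

theorem ad_self (X : L) : D.ad X X = 0 := by
  have h : (2 : ℝ) • D.ad X X = 0 := by
    rw [two_smul]
    nth_rewrite 1 [D.ad_swap]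
    exact neg_add_cancel _
  exact (smul_eq_zero.1 h).resolve_left two_ne_zero

theorem ad_k_m {X Y : L} (hX : X ∈ D.k) (hY : Y ∈ D.m) : D.ad X Y ∈ D.m := by
  rw [mem_m, D.θ_ad, mem_k.1 hX, mem_m.1 hY, map_neg]

theorem ad_m_k {X Y : L} (hX : X ∈ D.m) (hY : Y ∈ D.k) : D.ad X Y ∈ D.m := by
  rw [mem_m, D.θ_ad, mem_m.1 hX, mem_k.1 hY, map_neg, LinearMap.neg_apply]

theorem ad_m_m {X Y : L} (hX : X ∈ D.m) (hY : Y ∈ D.m) : D.ad X Y ∈ D.k := by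
  rw [mem_k, D.θ_ad, mem_m.1 hX, mem_m.1 hY, map_neg, LinearMap.map_neg, LinearMap.neg_apply,
    neg_neg]

theorem inner_ad_right (X Y Z : L) : ⟪Y, D.ad X Z⟫_ℝ = -⟪D.ad X Y, Z⟫_ℝ := by
  rw [D.inner_ad, neg_neg]

/-- The invariance of the inner product in its cyclic form. -/
theorem inner_ad_cyclic (X Y Z : L) : ⟪D.ad X Y, Z⟫_ℝ = ⟪X, D.ad Y Z⟫_ℝ := by
  rw [D.ad_swap, inner_neg_left, D.inner_ad, neg_neg]

theorem inner_k_m {X Y : L} (hX : X ∈ D.k) (hY : Y ∈ D.m) : ⟪X, Y⟫_ℝ = 0 := by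
  have := D.inner_θ X Y
  rw [mem_k.1 hX, mem_m.1 hY, inner_neg_right] at this
  linarith

theorem θ_add_mem_k (X : L) : X + D.θ X ∈ D.k := by
  rw [mem_k, map_add, D.θ_θ, add_comm]

theorem θ_sub_mem_m (X : L) : X - D.θ X ∈ D.m := by
  rw [mem_m, map_sub, D.θ_θ, neg_sub]

/-- `𝔞` is a maximal abelian subspace of `𝔪`. -/
structure IsMaxAbelian (D : SymmetricLie L) (𝔞 : Submodule ℝ L) : Prop where
  le_m : 𝔞 ≤ D.m
  ad_eq_zero : ∀ X ∈ 𝔞, ∀ Y ∈ 𝔞, D.ad X Y = 0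
  mem_of_commute : ∀ X ∈ D.m, (∀ A ∈ 𝔞, D.ad A X = 0) → X ∈ 𝔞

/-- If X ∈ 𝔪 commutes with 𝔞, then 𝔞 + ℝX is again abelian and contained in 𝔪, so maximality absorbs
X. -/
theorem IsMaxAbelian.of_maximal {𝔞 : Submodule ℝ L}
    (h : Maximal (fun 𝔟 : Submodule ℝ L => 𝔟 ≤ D.m ∧ ∀ X ∈ 𝔟, ∀ Y ∈ 𝔟, D.ad X Y = 0) 𝔞) :
    D.IsMaxAbelian 𝔞 := by
  refine ⟨h.prop.1, h.prop.2, fun X hX hc => ?_⟩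
  have h2 : 𝔞 ⊔ ℝ ∙ X ≤ 𝔞 := by
    refine h.le_of_ge ⟨sup_le h.prop.1 ((Submodule.span_singleton_le_iff_mem _ _).2 hX), ?_⟩ le_sup_left
    intro Y hY Z hZ
    obtain ⟨A, hA, _, hx, rfl⟩ := Submodule.mem_sup.1 hY
    obtain ⟨B, hB, _, hy, rfl⟩ := Submodule.mem_sup.1 hZ
    obtain ⟨a, rfl⟩ := Submodule.mem_span_singleton.1 hx
    obtain ⟨b, rfl⟩ := Submodule.mem_span_singleton.1 hy
    have h3 : D.ad X B = 0 := by rw [D.ad_swap, hc B hB, neg_zero]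
    simp [h.prop.2 A hA B hB, hc A hA, h3, ad_self]
  exact h2 (Submodule.mem_sup_right (Submodule.mem_span_singleton_self X))

end SymmetricLie

/-! ### The isotropy action on 𝔪. -/

/-- The map `T ↦ p ∘ T ∘ i` on continuous endomorphisms. -/
noncomputable def sandwich {L W : Type*} [NormedAddCommGroup L] [NormedSpace ℝ L]
    [NormedAddCommGroup W] [NormedSpace ℝ W] (p : L →L[ℝ] W) (i : W →L[ℝ] L) :
    (L →L[ℝ] L) →L[ℝ] (W →L[ℝ] W) :=
  (ContinuousLinearMap.compL ℝ W L W p).comp ((ContinuousLinearMap.compL ℝ W L L).flip i)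

namespace IsotropyRep

variable {L K : Type*} [NormedAddCommGroup L] [InnerProductSpace ℝ L] [FiniteDimensional ℝ L]
  [Group K] [TopologicalSpace K] {D : SymmetricLie L} (R : IsotropyRep D K)

open SymmetricLie

theorem ρ_mem_m (k : K) {X : L} (hX : X ∈ D.m) : R.ρ k X ∈ D.m := by
  rw [mem_m, ← R.ρ_θ, mem_m.1 hX, map_neg]

theorem ρ_mem_k (k : K) {X : L} (hX : X ∈ D.k) : R.ρ k X ∈ D.k := by
  rw [mem_k, ← R.ρ_θ, mem_k.1 hX]

/-- The compression of an endomorphism to `𝔪`. -/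
noncomputable def compressM (D : SymmetricLie L) :=
  sandwich D.m.orthogonalProjectionOnto D.m.subtypeL

theorem compressM_apply (T : L →L[ℝ] L) (X : D.m) :
    compressM D T X = D.m.orthogonalProjectionOnto (T X) := rfl

theorem compressM_apply_of_mem {T : L →L[ℝ] L} {X : D.m} (h : T X ∈ D.m) :
    ((compressM D T X : D.m) : L) = T X := by
  rw [compressM_apply]
  exact congrArg Subtype.val (D.m.orthogonalProjectionOnto_mem_subspace_eq_self ⟨T X, h⟩)

theorem compressM_ρ (k : K) (X : D.m) : ((compressM D (R.ρ k) X : D.m) : L) = R.ρ k X :=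
  compressM_apply_of_mem (R.ρ_mem_m k X.2)

/-- The isotropy representation on `𝔪`. -/
noncomputable def toSmoothAction : SmoothAction D.k D.m K where
  act := { toFun := fun k => compressM D (R.ρ k)
           map_one' := by
             ext1 X
             apply Subtype.ext
             rw [R.compressM_ρ, map_one]
             rfl
           map_mul' := fun k l => by
             ext1 X
             apply Subtype.ext
             change _ = ((compressM D (R.ρ k) (compressM D (R.ρ l) X) : D.m) : L)
             rw [R.compressM_ρ, R.compressM_ρ, R.compressM_ρ, map_mul]
             rfl }
  continuous_act := (compressM D).continuous.comp R.continuous_ρ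
  inner_act k X Y := by
    change ⟪((compressM D (R.ρ k) X : D.m) : L), ((compressM D (R.ρ k) Y : D.m) : L)⟫_ℝ = _
    rw [R.compressM_ρ, R.compressM_ρ, R.inner_ρ]
    rfl
  B := LinearMap.mk₂ ℝ (fun z X => ⟨D.ad z X, ad_k_m z.2 X.2⟩)
    (fun _ _ _ => Subtype.ext (by simp)) (fun _ _ _ => Subtype.ext (by simp))
    (fun _ _ _ => Subtype.ext (by simp)) (fun _ _ _ => Subtype.ext (by simp))
  chart v := compressM D (R.chart v)
  radius := R.radius
  radius_pos := R.radius_pos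
  contDiffOn_chart := (compressM D).contDiff.comp_contDiffOn
    (R.contDiffOn_chart.comp D.k.subtypeL.contDiff.contDiffOn fun v hv => mem_ball_zero_iff.2 (mem_ball_zero_iff.1 hv))
  chart_zero := by
    ext1 X
    apply Subtype.ext
    rw [show R.chart ((0 : D.k) : L) = ContinuousLinearMap.id ℝ L from R.chart_zero,
      compressM_apply_of_mem]
    · rfl
    · exact X.2
  chart_mem v hv := by
    obtain ⟨k, hk⟩ := R.chart_mem v (mem_ball_zero_iff.2 (mem_ball_zero_iff.1 hv)) v.2
    refine ⟨k, ?_⟩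
    change compressM D (R.ρ k) = _
    rw [hk]
  chart_cover ε hε := by
    filter_upwards [R.chart_cover ε hε] with k hk
    obtain ⟨v, hv, hθ, hk⟩ := hk
    refine ⟨⟨v, hθ⟩, hv, ?_⟩
    change compressM D (R.ρ k) = _
    rw [hk]
  fderiv_chart_zero w Y := by
    have h : HasFDerivAt R.chart (fderiv ℝ R.chart 0) (D.k.subtypeL 0) := by
      rw [map_zero]
      exact ((R.contDiffOn_chart.contDiffAt (Metric.ball_mem_nhds _ R.radius_pos)).differentiableAt
        (by simp)).hasFDerivAt
    have h1 : HasFDerivAt (fun v : D.k => compressM D (R.chart v)) _ 0 :=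
      (compressM D).hasFDerivAt.comp (0 : D.k) (h.comp (0 : D.k) D.k.subtypeL.hasFDerivAt)
    rw [h1.fderiv]
    apply Subtype.ext
    have h2 := R.fderiv_chart_zero w Y
    change ((compressM D (fderiv ℝ R.chart 0 w) Y : D.m) : L) = D.ad w Y
    rw [compressM_apply_of_mem, h2]
    rw [h2]
    exact ad_k_m w.2 Y.2
  fderiv_chart v hv w := by
    have hv' : (v : L) ∈ Metric.ball (0 : L) R.radius :=
      mem_ball_zero_iff.2 (mem_ball_zero_iff.1 hv)
    have h : HasFDerivAt R.chart (fderiv ℝ R.chart v) (D.k.subtypeL v) :=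
      ((R.contDiffOn_chart.contDiffAt (Metric.isOpen_ball.mem_nhds hv')).differentiableAt
        (by simp)).hasFDerivAt
    have h1 : HasFDerivAt (fun v : D.k => compressM D (R.chart v)) _ v :=
      (compressM D).hasFDerivAt.comp v (h.comp v D.k.subtypeL.hasFDerivAt)
    obtain ⟨z, hz, hz'⟩ := R.fderiv_chart v hv' w v.2 w.2
    obtain ⟨k, hk⟩ := R.chart_mem v hv' v.2
    refine ⟨⟨z, hz⟩, fun Y => ?_⟩
    rw [h1.fderiv]
    apply Subtype.ext
    change ((compressM D (fderiv ℝ R.chart v w) Y : D.m) : L) =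
      ((compressM D (R.chart v) ⟨D.ad z Y, ad_k_m hz Y.2⟩ : D.m) : L)
    have h3 : R.chart v (D.ad z Y) ∈ D.m := by
      rw [← hk]
      exact R.ρ_mem_m k (ad_k_m hz Y.2)
    rw [compressM_apply_of_mem (by rw [hz']; exact h3), compressM_apply_of_mem h3, hz']
  act_B k z := by
    refine ⟨⟨R.ρ k z, R.ρ_mem_k k z.2⟩, fun Y => ?_⟩
    apply Subtype.ext
    change ((compressM D (R.ρ k) ⟨D.ad z Y, ad_k_m z.2 Y.2⟩ : D.m) : L) =
      D.ad (R.ρ k z) ((compressM D (R.ρ k) Y : D.m) : L)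
    rw [R.compressM_ρ, R.compressM_ρ, R.ρ_ad]

theorem coe_act (k : K) (X : D.m) : ((R.toSmoothAction.act k X : D.m) : L) = R.ρ k X :=
  R.compressM_ρ k X

end IsotropyRep

/-! ### Real restricted root spaces. -/

namespace SymmetricLie

variable {L : Type*} [NormedAddCommGroup L] [InnerProductSpace ℝ L] (D : SymmetricLie L)
  {𝔞 : Submodule ℝ L}

/-- The real form of `𝔤_α + 𝔤_{-α}`. -/
def rootSpace (α : 𝔞) : Submodule ℝ L where
  carrier := {X | ∀ A B : 𝔞, D.ad A (D.ad B X) = -(⟪α, A⟫_ℝ * ⟪α, B⟫_ℝ) • X}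
  add_mem' {X Y} hX hY A B := by rw [map_add, map_add, hX A B, hY A B, smul_add]
  zero_mem' A B := by simp
  smul_mem' c X hX A B := by rw [map_smul, map_smul, hX A B, smul_comm]

/-- The rotation `X ↦ |α|⁻² [α, X]` of the root space of `α`. -/
noncomputable def rot (α : 𝔞) : L →ₗ[ℝ] L := (‖α‖ ^ 2)⁻¹ • D.ad α

variable (𝔞) in
/-- The restricted roots. -/
def roots : Set 𝔞 := {α | α ≠ 0 ∧ D.rootSpace α ≠ ⊥}

/-- The multiplicity of a restricted root. -/
noncomputable def mult (α : 𝔞) : ℕ := Module.finrank ℝ (D.rootSpace α ⊓ D.m : Submodule ℝ L)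

variable {D}

theorem mem_rootSpace {α : 𝔞} {X : L} :
    X ∈ D.rootSpace α ↔ ∀ A B : 𝔞, D.ad A (D.ad B X) = -(⟪α, A⟫_ℝ * ⟪α, B⟫_ℝ) • X := Iff.rfl

theorem rot_apply (α : 𝔞) (X : L) : D.rot α X = (‖α‖ ^ 2)⁻¹ • D.ad α X := rfl

theorem norm_sq_ad (A X : L) : ‖D.ad A X‖ ^ 2 = -⟪X, D.ad A (D.ad A X)⟫_ℝ := by
  rw [← real_inner_self_eq_norm_sq, D.inner_ad]

/-- If C ∈ 𝔞 is orthogonal to α, then ad(C)² kills X, and ‖[C,X]‖² = -⟨X, ad(C)²X⟩ shows [C,X] = 0.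
Only the component of A along α acts. -/
theorem ad_eq_smul_rot {α : 𝔞} {X : L} (hX : X ∈ D.rootSpace α) (A : 𝔞) :
    D.ad A X = ⟪α, A⟫_ℝ • D.rot α X := by
  have key : ∀ C : 𝔞, ⟪α, C⟫_ℝ = 0 → D.ad C X = 0 := fun C hC => by
    have := norm_sq_ad (D := D) (C : L) X
    rw [hX C C, hC, zero_mul, neg_zero, zero_smul, inner_zero_right, neg_zero] at this
    simpa using this
  rcases eq_or_ne α 0 with rfl | hα
  · rw [key A (inner_zero_left _), inner_zero_left, zero_smul]
  · have h2 : ‖α‖ ^ 2 ≠ 0 := pow_ne_zero _ (norm_ne_zero_iff.2 hα)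
    have h := key (A - (⟪α, A⟫_ℝ * (‖α‖ ^ 2)⁻¹) • α) (by
      rw [inner_sub_right, inner_smul_right, real_inner_self_eq_norm_sq]
      field_simp
      ring)
    rw [Submodule.coe_sub, Submodule.coe_smul, map_sub, map_smul, LinearMap.sub_apply,
      LinearMap.smul_apply, sub_eq_zero] at h
    rw [h, rot_apply, mul_smul]

theorem rootSpace_neg (α : 𝔞) : D.rootSpace (-α) = D.rootSpace α := by
  ext X
  simp [mem_rootSpace]

/-- On the root space ad(α)² is -‖α‖⁴, so the factor ‖α‖⁻² makes the rotation a complex structure.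
It is orthogonal (`norm_rot`) and exchanges the parts in 𝔨 and in 𝔪. -/
theorem rot_rot {α : 𝔞} (hα : α ≠ 0) {X : L} (hX : X ∈ D.rootSpace α) :
    D.rot α (D.rot α X) = -X := by
  have h2 : ‖α‖ ^ 2 ≠ 0 := pow_ne_zero _ (norm_ne_zero_iff.2 hα)
  rw [rot_apply, rot_apply, map_smul, hX α α, real_inner_self_eq_norm_sq, smul_smul, smul_smul]
  rw [show (‖α‖ ^ 2)⁻¹ * (‖α‖ ^ 2)⁻¹ * -(‖α‖ ^ 2 * ‖α‖ ^ 2) = -1 by field_simp, neg_one_smul]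

theorem inner_rot_right (α : 𝔞) (X Y : L) : ⟪X, D.rot α Y⟫_ℝ = -⟪D.rot α X, Y⟫_ℝ := by
  rw [rot_apply, rot_apply, inner_smul_right, inner_smul_left, inner_ad_right]
  simp

theorem norm_rot {α : 𝔞} (hα : α ≠ 0) {X : L} (hX : X ∈ D.rootSpace α) : ‖D.rot α X‖ = ‖X‖ := by
  have h : ‖D.rot α X‖ ^ 2 = ‖X‖ ^ 2 := by
    rw [← real_inner_self_eq_norm_sq, inner_rot_right, rot_rot hα hX, inner_neg_left, neg_neg,
      real_inner_self_eq_norm_sq]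
  exact (pow_left_inj₀ (norm_nonneg _) (norm_nonneg _) two_ne_zero).1 h

theorem θ_mem_rootSpace (h𝔞 : 𝔞 ≤ D.m) {α : 𝔞} {X : L} (hX : X ∈ D.rootSpace α) :
    D.θ X ∈ D.rootSpace α := fun A B => by
  have h := congrArg D.θ (hX A B)
  rw [D.θ_ad, D.θ_ad, mem_m.1 (h𝔞 A.2), mem_m.1 (h𝔞 B.2), map_smul] at h
  simpa using h

theorem rot_mem_k (h𝔞 : 𝔞 ≤ D.m) (α : 𝔞) {X : L} (hX : X ∈ D.m) : D.rot α X ∈ D.k :=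
  D.k.smul_mem _ (ad_m_m (h𝔞 α.2) hX)

theorem rot_mem_m (h𝔞 : 𝔞 ≤ D.m) (α : 𝔞) {X : L} (hX : X ∈ D.k) : D.rot α X ∈ D.m :=
  D.m.smul_mem _ (ad_m_k (h𝔞 α.2) hX)

theorem m_inf_k : D.m ⊓ D.k = ⊥ := by
  refine (Submodule.eq_bot_iff _).2 fun X hX => ?_
  have := inner_k_m hX.2 hX.1
  simpa using this

theorem neg_mem_roots {α : 𝔞} (h : α ∈ D.roots 𝔞) : -α ∈ D.roots 𝔞 :=
  ⟨neg_ne_zero.2 h.1, by rw [rootSpace_neg]; exact h.2⟩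

/-- Testing at α and at β gives ‖α‖ = ‖β‖ and ⟨α,β⟩² = ‖α‖⁴, whence ‖α - β‖²‖α + β‖² = 0. -/
theorem eq_or_eq_neg_of_inner_mul_self {E : Type*} [NormedAddCommGroup E] [InnerProductSpace ℝ E]
    {α β : E} (h : ∀ A : E, ⟪α, A⟫_ℝ * ⟪α, A⟫_ℝ = ⟪β, A⟫_ℝ * ⟪β, A⟫_ℝ) : α = β ∨ α = -β := by
  by_contra! hcon
  have e1 := h α
  have e2 := h β
  rw [real_inner_self_eq_norm_sq] at e1 e2
  rw [real_inner_comm α β] at e1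
  have n1 : ‖α - β‖ ^ 2 ≠ 0 := pow_ne_zero _ (norm_ne_zero_iff.2 (sub_ne_zero.2 hcon.1))
  have n2 : ‖α + β‖ ^ 2 ≠ 0 := pow_ne_zero _
    (norm_ne_zero_iff.2 fun h => hcon.2 (eq_neg_of_add_eq_zero_left h))
  apply mul_ne_zero n1 n2
  rw [norm_sub_sq_real, norm_add_sq_real]
  have e3 : ‖α‖ ^ 2 = ‖β‖ ^ 2 :=
    (mul_self_inj (sq_nonneg _) (sq_nonneg _)).1 (e1.trans e2)
  rw [e3] at e1 ⊢
  nlinarith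

/-- Root spaces of roots which are not opposite or equal are orthogonal. -/
theorem inner_rootSpace_eq_zero {α β : 𝔞} (h1 : α ≠ β) (h2 : α ≠ -β) {X Y : L}
    (hX : X ∈ D.rootSpace α) (hY : Y ∈ D.rootSpace β) : ⟪X, Y⟫_ℝ = 0 := by
  by_contra h
  refine (eq_or_eq_neg_of_inner_mul_self fun A => ?_).elim h1 h2
  have e : ⟪D.ad A (D.ad A X), Y⟫_ℝ = ⟪X, D.ad A (D.ad A Y)⟫_ℝ := by
    rw [D.inner_ad, D.inner_ad, neg_neg]
  rw [hX A A, hY A A, inner_smul_left, inner_smul_right] at e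
  have := mul_right_cancel₀ h e
  simpa using this

theorem mem_rootSpace_zero {X : L} :
    X ∈ D.rootSpace (0 : 𝔞) ↔ ∀ A ∈ 𝔞, D.ad A X = 0 := by
  constructor
  · intro h A hA
    have := ad_eq_smul_rot h ⟨A, hA⟩
    rwa [inner_zero_left, zero_smul] at this
  · intro h A B
    rw [h B B.2]
    simp

theorem IsMaxAbelian.commute (h𝔞 : D.IsMaxAbelian 𝔞) (A B : 𝔞) (X : L) :
    D.ad A (D.ad B X) = D.ad B (D.ad A X) := by
  have := D.jacobi A B X
  rw [h𝔞.ad_eq_zero A A.2 B B.2, map_zero, LinearMap.zero_apply] at this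
  exact sub_eq_zero.1 this.symm

theorem rot_mem_rootSpace {α : 𝔞} {X : L} (h𝔞 : D.IsMaxAbelian 𝔞) (hX : X ∈ D.rootSpace α) :
    D.rot α X ∈ D.rootSpace α := by
  intro A B
  rw [rot_apply, map_smul, map_smul, h𝔞.commute B α, h𝔞.commute A α, hX A B, map_smul, smul_comm]

section FiniteDimensional

variable [FiniteDimensional ℝ L]

/-- A joint eigenvector of the operators `ad A ∘ ad B` lies in a root space. -/
theorem IsMaxAbelian.exists_mem_rootSpace (h𝔞 : D.IsMaxAbelian 𝔞) (γ : 𝔞 × 𝔞 → ℝ) :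
    ∃ α : 𝔞, ∀ X : L, (∀ A B : 𝔞, D.ad A (D.ad B X) = γ (A, B) • X) → X ∈ D.rootSpace α := by
  by_cases hne : ∃ X : L, X ≠ 0 ∧ ∀ A B : 𝔞, D.ad A (D.ad B X) = γ (A, B) • X
  swap
  · refine ⟨0, fun X hX => ?_⟩
    by_cases h0 : X = 0
    · rw [h0]; exact zero_mem _
    · exact (hne ⟨X, h0, hX⟩).elim
  obtain ⟨X, hX0, hX⟩ := hne
  -- Because the ad(A) commute, the joint eigenvalue γ behaves like a form of rank at most one.
  have hmul : ∀ A B C E : 𝔞, γ (A, B) * γ (C, E) = γ (A, C) * γ (B, E) := fun A B C E => by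
    have e1 : D.ad A (D.ad B (D.ad C (D.ad E X))) = (γ (C, E) * γ (A, B)) • X := by
      rw [hX C E, map_smul, map_smul, hX A B, smul_smul]
    have e2 : D.ad A (D.ad C (D.ad B (D.ad E X))) = (γ (B, E) * γ (A, C)) • X := by
      rw [hX B E, map_smul, map_smul, hX A C, smul_smul]
    rw [h𝔞.commute B C, e2] at e1
    have := smul_left_injective ℝ hX0 e1
    linarith
  have hsymm : ∀ A B : 𝔞, γ (A, B) = γ (B, A) := fun A B =>
    smul_left_injective ℝ hX0 (by
      change γ (A, B) • X = γ (B, A) • X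
      rw [← hX, ← hX, h𝔞.commute])
  have hnonpos : ∀ A : 𝔞, γ (A, A) ≤ 0 := fun A => by
    have := norm_sq_ad (D := D) (A : L) X
    rw [hX, inner_smul_right, real_inner_self_eq_norm_sq] at this
    have h2 : 0 < ‖X‖ ^ 2 := pow_pos (norm_pos_iff.2 hX0) 2
    nlinarith [sq_nonneg ‖D.ad A X‖]
  by_cases hz : ∀ A : 𝔞, γ (A, A) = 0
  · refine ⟨0, fun Y hY A B => ?_⟩
    have : γ (A, B) = 0 := by
      have h3 := hmul A B A B
      rw [hz A, zero_mul] at h3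
      exact mul_self_eq_zero.1 h3
    rw [hY, this]
    simp
  · push Not at hz
    obtain ⟨A₀, hA₀⟩ := hz
    have hneg : γ (A₀, A₀) < 0 := lt_of_le_of_ne (hnonpos A₀) hA₀
    -- The root is the vector representing s⁻¹γ(A₀, ·): the rank-one relation gives γ(A₀,A)γ(A₀,B) =
    -- γ(A₀,A₀)γ(A,B) = -s²γ(A,B).
    set s : ℝ := Real.sqrt (-γ (A₀, A₀)) with hs
    have hs2 : s * s = -γ (A₀, A₀) := Real.mul_self_sqrt (by linarith)
    have hs0 : s ≠ 0 := (Real.sqrt_pos.2 (by linarith)).ne'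
    let ℓ : 𝔞 →ₗ[ℝ] ℝ := (innerₗ L X) ∘ₗ (D.ad A₀) ∘ₗ (D.ad.flip X) ∘ₗ 𝔞.subtype
    have hℓ : ∀ B : 𝔞, ℓ B = γ (A₀, B) * ‖X‖ ^ 2 := fun B => by
      change ⟪X, D.ad A₀ (D.ad B X)⟫_ℝ = _
      rw [hX, inner_smul_right, real_inner_self_eq_norm_sq]
    have hX2 : ‖X‖ ^ 2 ≠ 0 := pow_ne_zero _ (norm_ne_zero_iff.2 hX0)
    refine ⟨(s⁻¹ * (‖X‖ ^ 2)⁻¹) • (InnerProductSpace.toDual ℝ 𝔞).symm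
      (LinearMap.toContinuousLinearMap ℓ), fun Y hY A B => ?_⟩
    have hin : ∀ B : 𝔞, ⟪(s⁻¹ * (‖X‖ ^ 2)⁻¹) • (InnerProductSpace.toDual ℝ 𝔞).symm
        (LinearMap.toContinuousLinearMap ℓ), B⟫_ℝ = s⁻¹ * γ (A₀, B) := fun B => by
      rw [inner_smul_left, InnerProductSpace.toDual_symm_apply]
      change (s⁻¹ * (‖X‖ ^ 2)⁻¹) * ℓ B = _
      rw [hℓ]
      field_simp
    rw [hY, hin, hin]
    congr 1
    have h4 := hmul A₀ A A₀ B
    have h5 : s⁻¹ * γ (A₀, A) * (s⁻¹ * γ (A₀, B)) = (s * s)⁻¹ * (γ (A₀, A) * γ (A₀, B)) := by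
      rw [mul_inv]; ring
    rw [h5, h4, hs2]
    field_simp

/-- The operators ad(A) ad(B) are symmetric and commute, so they are simultaneously diagonalizable,
and each joint eigenspace lies in a root space. -/
theorem IsMaxAbelian.iSup_rootSpace (h𝔞 : D.IsMaxAbelian 𝔞) : ⨆ α : 𝔞, D.rootSpace α = ⊤ := by
  have hsym : ∀ i : 𝔞 × 𝔞, ((D.ad i.1 : L →ₗ[ℝ] L) ∘ₗ D.ad i.2).IsSymmetric := fun i X Y => by
    change ⟪D.ad i.1 (D.ad i.2 X), Y⟫_ℝ = ⟪X, D.ad i.1 (D.ad i.2 Y)⟫_ℝ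
    rw [D.inner_ad, D.inner_ad, neg_neg, h𝔞.commute]
  have h := LinearMap.IsSymmetric.iSup_iInf_eq_top_of_commute hsym (fun i j _ => by
    ext X
    change D.ad i.1 (D.ad i.2 (D.ad j.1 (D.ad j.2 X))) =
      D.ad j.1 (D.ad j.2 (D.ad i.1 (D.ad i.2 X)))
    rw [h𝔞.commute i.2 j.1, h𝔞.commute i.1 j.1, h𝔞.commute i.2 j.2, h𝔞.commute i.1 j.2])
  rw [eq_top_iff, ← h]
  refine iSup_le fun γ => ?_
  obtain ⟨α, hα⟩ := h𝔞.exists_mem_rootSpace γ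
  refine le_trans (fun X hX => hα X fun A B => ?_) (le_iSup _ α)
  have := (Submodule.mem_iInf _).1 hX (A, B)
  exact Module.End.mem_eigenspace_iff.1 this

/-- Joint eigenspaces of the ad(A)² are independent, so only finitely many are nonzero; a joint
eigenvalue A ↦ -⟨α,A⟩² determines α up to sign. -/
theorem roots_finite : (D.roots 𝔞).Finite := by
  have hsym : ∀ i : 𝔞, ((D.ad i : L →ₗ[ℝ] L) ∘ₗ D.ad i).IsSymmetric := fun i X Y => by
    change ⟪D.ad i (D.ad i X), Y⟫_ℝ = ⟪X, D.ad i (D.ad i Y)⟫_ℝ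
    rw [D.inner_ad, D.inner_ad, neg_neg]
  have h := (LinearMap.IsSymmetric.orthogonalFamily_iInf_eigenspaces hsym).independent
  have hfin := WellFoundedGT.finite_ne_bot_of_iSupIndep h
  let g : 𝔞 → (𝔞 → ℝ) := fun α A => -(⟪α, A⟫_ℝ * ⟪α, A⟫_ℝ)
  refine (Set.Finite.preimage' hfin (f := g) fun γ hγ => ?_).subset fun α hα => ?_
  · by_cases hne : ∃ β, g β = γ
    · obtain ⟨β, rfl⟩ := hne
      refine (Set.toFinite {β, -β}).subset fun α hα => ?_
      exact eq_or_eq_neg_of_inner_mul_self fun A => neg_injective (congrFun hα A)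
    · convert Set.finite_empty
      ext α
      simp only [mem_preimage, mem_singleton_iff, mem_empty_iff_false, iff_false]
      exact fun h => hne ⟨α, h⟩
  · intro hbot
    apply hα.2
    rw [eq_bot_iff, ← hbot]
    exact fun X hX => (Submodule.mem_iInf _).2 fun A => Module.End.mem_eigenspace_iff.2 (hX A A)

end FiniteDimensional

end SymmetricLie

/-! ### Complex root spaces and multiplicities. -/

section Complexification

variable {L : Type*} [AddCommGroup L] [Module ℝ L]

/-- The element `X + i Y` of the complexification. -/
noncomputable def cplx (X Y : L) : ℂ ⊗[ℝ] L := (1 : ℂ) ⊗ₜ X + Complex.I ⊗ₜ Y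

theorem exists_cplx (z : ℂ ⊗[ℝ] L) : ∃ X Y, z = cplx X Y := by
  induction z with
  | zero => exact ⟨0, 0, by simp [cplx]⟩
  | tmul c X =>
    refine ⟨c.re • X, c.im • X, ?_⟩
    rw [cplx, ← TensorProduct.smul_tmul, ← TensorProduct.smul_tmul, ← TensorProduct.add_tmul]
    congr 1
    simp only [Complex.real_smul, mul_one]
    exact (Complex.re_add_im c).symm
  | add z w hz hw =>
    obtain ⟨X, Y, rfl⟩ := hz
    obtain ⟨X', Y', rfl⟩ := hw
    refine ⟨X + X', Y + Y', ?_⟩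
    simp only [cplx, TensorProduct.tmul_add]
    abel

theorem cplx_inj {X Y X' Y' : L} (h : cplx X Y = cplx X' Y') : X = X' ∧ Y = Y' := by
  have hre := congrArg (fun z => TensorProduct.lid ℝ L (LinearMap.rTensor L Complex.reLm z)) h
  have him := congrArg (fun z => TensorProduct.lid ℝ L (LinearMap.rTensor L Complex.imLm z)) h
  simp [cplx] at hre him
  exact ⟨hre, him⟩

theorem baseChange_cplx (f : L →ₗ[ℝ] L) (X Y : L) :
    f.baseChange ℂ (cplx X Y) = cplx (f X) (f Y) := by simp [cplx]

theorem smul_cplx (a b : ℝ) (X Y : L) :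
    ((a : ℂ) + Complex.I * b) • cplx X Y = cplx (a • X - b • Y) (b • X + a • Y) := by
  simp only [cplx, smul_add, TensorProduct.smul_tmul', smul_eq_mul, mul_one, sub_eq_add_neg,
    TensorProduct.tmul_add, TensorProduct.tmul_neg, ← TensorProduct.smul_tmul, Complex.real_smul,
    add_mul, TensorProduct.add_tmul]
  rw [mul_comm Complex.I (b : ℂ), mul_assoc (b : ℂ), Complex.I_mul_I, mul_neg, mul_one,
    TensorProduct.neg_tmul]
  abel

end Complexification

namespace SymmetricLie

variable {L : Type*} [NormedAddCommGroup L] [InnerProductSpace ℝ L] (D : SymmetricLie L)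
  {𝔞 : Submodule ℝ L}

/-- The complex root space `𝔤_α`. -/
noncomputable def complexRootSpace (α : 𝔞) : Submodule ℂ (ℂ ⊗[ℝ] L) :=
  ⨅ H : 𝔞, Module.End.eigenspace ((D.ad H).baseChange ℂ) (Complex.I * (⟪α, H⟫_ℝ : ℂ))

variable {D}

theorem cplx_mem_complexRootSpace {α : 𝔞} {X Y : L} :
    cplx X Y ∈ D.complexRootSpace α ↔
      ∀ A : 𝔞, D.ad A X = -(⟪α, A⟫_ℝ • Y) ∧ D.ad A Y = ⟪α, A⟫_ℝ • X := by
  rw [complexRootSpace, Submodule.mem_iInf]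
  refine forall_congr' fun A => ?_
  rw [Module.End.mem_eigenspace_iff, baseChange_cplx]
  have h := smul_cplx 0 ⟪α, A⟫_ℝ X Y
  rw [Complex.ofReal_zero, zero_add, zero_smul, zero_smul, zero_sub, add_zero] at h
  erw [h]
  exact ⟨cplx_inj, fun h => by rw [h.1, h.2]⟩

/-- A complex root vector is determined by its real part, which may be any element of the real root
space: this links the roots of the statement with the real spaces used in the proof. -/
theorem cplx_mem_complexRootSpace_iff {α : 𝔞} (hα : α ≠ 0) {X Y : L} :
    cplx X Y ∈ D.complexRootSpace α ↔ X ∈ D.rootSpace α ∧ Y = -D.rot α X := by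
  rw [cplx_mem_complexRootSpace]
  have h2 : ‖α‖ ^ 2 ≠ 0 := pow_ne_zero _ (norm_ne_zero_iff.2 hα)
  constructor
  · intro h
    refine ⟨fun A B => ?_, ?_⟩
    · rw [(h B).1, map_neg, map_smul, (h A).2, smul_smul, neg_smul, mul_comm]
    · rw [rot_apply, (h α).1, real_inner_self_eq_norm_sq, smul_neg, neg_neg, smul_smul,
        inv_mul_cancel₀ h2, one_smul]
  · rintro ⟨hX, rfl⟩ A
    refine ⟨by rw [ad_eq_smul_rot hX, smul_neg, neg_neg], ?_⟩
    rw [rot_apply, map_neg, map_smul, hX A α, real_inner_self_eq_norm_sq, smul_smul, mul_neg,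
      neg_smul, neg_neg]
    congr 1
    field_simp

theorem complexRootSpace_eq_bot_iff {α : 𝔞} (hα : α ≠ 0) :
    D.complexRootSpace α = ⊥ ↔ D.rootSpace α = ⊥ := by
  constructor
  · intro h
    refine (Submodule.eq_bot_iff _).2 fun X hX => ?_
    have := (cplx_mem_complexRootSpace_iff hα).2 ⟨hX, rfl⟩
    rw [h, Submodule.mem_bot] at this
    exact (cplx_inj (this.trans (by simp [cplx] : (0 : ℂ ⊗[ℝ] L) = cplx 0 0))).1
  · intro h
    refine (Submodule.eq_bot_iff _).2 fun z hz => ?_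
    obtain ⟨X, Y, rfl⟩ := exists_cplx z
    obtain ⟨hX, rfl⟩ := (cplx_mem_complexRootSpace_iff hα).1 hz
    rw [h, Submodule.mem_bot] at hX
    simp [hX, cplx]

variable [FiniteDimensional ℝ L]

theorem half_smul_θ_decomp (X : L) :
    X = (2⁻¹ : ℝ) • (X - D.θ X) + (2⁻¹ : ℝ) • (X + D.θ X) := by
  rw [← smul_add, sub_add_add_cancel, ← two_smul ℝ X, smul_smul, inv_mul_cancel₀ two_ne_zero,
    one_smul]

/-- θ preserves the root space and splits it into parts in 𝔪 and 𝔨; the rotation embeds each part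
into the other, so they have equal dimension. -/
theorem finrank_rootSpace (h𝔞 : D.IsMaxAbelian 𝔞) {α : 𝔞} (hα : α ≠ 0) :
    Module.finrank ℝ (D.rootSpace α) = 2 * D.mult α := by
  have hsup : D.rootSpace α ⊓ D.m ⊔ D.rootSpace α ⊓ D.k = D.rootSpace α := by
    refine le_antisymm (sup_le inf_le_left inf_le_left) fun X hX => ?_
    rw [half_smul_θ_decomp (D := D) X]
    have hθ := θ_mem_rootSpace h𝔞.le_m hX
    exact Submodule.add_mem_sup
      (Submodule.smul_mem _ _ ⟨sub_mem hX hθ, θ_sub_mem_m X⟩)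
      (Submodule.smul_mem _ _ ⟨add_mem hX hθ, θ_add_mem_k X⟩)
  have hinf : (D.rootSpace α ⊓ D.m) ⊓ (D.rootSpace α ⊓ D.k) = ⊥ := by
    rw [eq_bot_iff, ← m_inf_k (D := D)]
    exact inf_le_inf inf_le_right inf_le_right
  have h := Submodule.finrank_sup_add_finrank_inf_eq (D.rootSpace α ⊓ D.m) (D.rootSpace α ⊓ D.k)
  rw [hsup, hinf, finrank_bot, add_zero] at h
  have hinj : ∀ X ∈ D.rootSpace α, D.rot α X = 0 → X = 0 := fun X hX h0 => by
    have := norm_rot hα hX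
    rw [h0, norm_zero] at this
    exact norm_eq_zero.1 this.symm
  have h1 : Module.finrank ℝ (D.rootSpace α ⊓ D.m : Submodule ℝ L) ≤
      Module.finrank ℝ (D.rootSpace α ⊓ D.k : Submodule ℝ L) := by
    refine LinearMap.finrank_le_finrank_of_injective (f := (D.rot α).restrict fun X hX =>
      ⟨rot_mem_rootSpace h𝔞 hX.1, rot_mem_k h𝔞.le_m α hX.2⟩) ?_
    refine (injective_iff_map_eq_zero _).2 fun X hX => Subtype.ext (hinj X X.2.1 ?_)
    exact congrArg Subtype.val hX
  have h2 : Module.finrank ℝ (D.rootSpace α ⊓ D.k : Submodule ℝ L) ≤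
      Module.finrank ℝ (D.rootSpace α ⊓ D.m : Submodule ℝ L) := by
    refine LinearMap.finrank_le_finrank_of_injective (f := (D.rot α).restrict fun X hX =>
      ⟨rot_mem_rootSpace h𝔞 hX.1, rot_mem_m h𝔞.le_m α hX.2⟩) ?_
    refine (injective_iff_map_eq_zero _).2 fun X hX => Subtype.ext (hinj X X.2.1 ?_)
    exact congrArg Subtype.val hX
  rw [h, mult]
  omega

/-- X ↦ X - i rot(X) is a real isomorphism onto the complex root space. Hence twice its complex
dimension is the real dimension of the real root space, that is, twice `D.mult α`. -/
theorem finrank_complexRootSpace (h𝔞 : D.IsMaxAbelian 𝔞) {α : 𝔞} (hα : α ≠ 0) :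
    Module.finrank ℂ (D.complexRootSpace α) = D.mult α := by
  let f : D.rootSpace α →ₗ[ℝ] D.complexRootSpace α :=
    { toFun := fun X => ⟨cplx X (-D.rot α X), (cplx_mem_complexRootSpace_iff hα).2 ⟨X.2, rfl⟩⟩
      map_add' := fun X Y => Subtype.ext (by
        simp only [cplx, Submodule.coe_add, map_add, neg_add, TensorProduct.tmul_add]
        abel)
      map_smul' := fun c X => Subtype.ext (by
        change cplx (c • (X : L)) (-D.rot α (c • (X : L))) = c • cplx (X : L) (-D.rot α X)
        rw [cplx, cplx, map_smul, ← smul_neg, TensorProduct.tmul_smul, TensorProduct.tmul_smul,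
          smul_add]) }
  have hf : Function.Bijective f := by
    constructor
    · intro X Y h
      exact Subtype.ext (cplx_inj (congrArg Subtype.val h)).1
    · rintro ⟨z, hz⟩
      obtain ⟨X, Y, rfl⟩ := exists_cplx z
      obtain ⟨hX, rfl⟩ := (cplx_mem_complexRootSpace_iff hα).1 hz
      exact ⟨⟨X, hX⟩, rfl⟩
  have h := (LinearEquiv.ofBijective f hf).finrank_eq
  rw [finrank_rootSpace h𝔞 hα, ← Module.finrank_mul_finrank ℝ ℂ, Complex.finrank_real_complex] at h
  omega

end SymmetricLie

/-! ### Eigenspaces of an operator that is diagonal along a direct sum. -/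

section DirectSum

variable {E F ι : Type*} [AddCommGroup E] [Module ℝ E] [AddCommGroup F] [Module ℝ F]
  [FiniteDimensional ℝ F] [Fintype ι]

theorem finrank_iSup_eq_sum {W : ι → Submodule ℝ F} (hW : iSupIndep W) :
    Module.finrank ℝ (⨆ i, W i : Submodule ℝ F) = ∑ i, Module.finrank ℝ (W i) := by
  classical
  rw [← Module.finrank_directSum (R := ℝ) (fun i => W i), Submodule.iSup_eq_range_dfinsupp_lsum]
  exact LinearMap.finrank_range_of_inj (R := ℝ)
    (f := (DFinsupp.lsum ℕ fun i => (W i).subtype : (Π₀ i, W i) →ₗ[ℝ] F)) hW.dfinsupp_lsum_injective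

/-- The dimension of an eigenspace of an endomorphism which is diagonal with respect to a
decomposition into a direct sum. -/
theorem finrank_eigenspace_of_iSup {W : ι → Submodule ℝ F} (hW : iSupIndep W) {j : E →ₗ[ℝ] F}
    (hj : Function.Injective j) (hrange : LinearMap.range j = ⨆ i, W i) {S : Module.End ℝ E}
    {l : ι → ℝ} (hS : ∀ i x, j x ∈ W i → S x = l i • x) (c : ℝ) [DecidablePred fun i => l i = c] :
    Module.finrank ℝ (Module.End.eigenspace S c) = ∑ i with l i = c, Module.finrank ℝ (W i) := by
  have hmap : Submodule.map j (Module.End.eigenspace S c) = ⨆ i : {i // l i = c}, W i := by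
    apply le_antisymm
    · rintro _ ⟨x, hx, rfl⟩
      have hx' : S x = c • x := Module.End.mem_eigenspace_iff.1 hx
      have h1 : j x ∈ ⨆ i, W i := hrange ▸ LinearMap.mem_range_self j x
      obtain ⟨v, hv, hsum⟩ := (Submodule.mem_iSup_iff_exists_finsupp W _).1 h1
      have h2 : ∀ i, ∃ y, j y = v i := fun i => by
        have : v i ∈ LinearMap.range j := hrange ▸ Submodule.mem_iSup_of_mem i (hv i)
        exact this
      choose y hy using h2
      rw [Finsupp.sum_fintype _ _ fun _ => rfl] at hsum
      have h3 : x = ∑ i, y i := hj (by rw [map_sum, ← hsum]; exact Finset.sum_congr rfl fun i _ => (hy i).symm)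
      -- Applying S - c to the decomposed eigenvector; independence then kills each component with l
      -- i ≠ c.
      have h4 : ∑ i, (l i - c) • v i = 0 := by
        have : j (S x - c • x) = 0 := by rw [hx', sub_self, map_zero]
        rw [← this]
        nth_rewrite 2 [h3]
        rw [h3, map_sum, Finset.smul_sum, ← Finset.sum_sub_distrib, map_sum]
        refine Finset.sum_congr rfl fun i _ => ?_
        rw [hS i (y i) ((hy i).symm ▸ hv i), ← sub_smul, map_smul, hy]
      have h5 := (iSupIndep_iff_finsetSum_eq_zero_imp_eq_zero W).1 hW Finset.univ
        (fun i => (l i - c) • v i) (fun i _ => (W i).smul_mem _ (hv i)) h4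
      rw [← hsum]
      refine Submodule.sum_mem _ fun i _ => ?_
      by_cases hi : l i = c
      · exact Submodule.mem_iSup_of_mem (p := fun i : {i // l i = c} => W i) ⟨i, hi⟩ (hv i)
      · rw [(smul_eq_zero.1 (h5 i (Finset.mem_univ i))).resolve_left (sub_ne_zero.2 hi)]
        exact zero_mem _
    · refine iSup_le fun i => ?_
      intro w hw
      have : w ∈ LinearMap.range j := hrange ▸ Submodule.mem_iSup_of_mem i.1 hw
      obtain ⟨x, rfl⟩ := this
      refine ⟨x, ?_, rfl⟩
      apply Module.End.mem_eigenspace_iff.2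
      rw [hS i x hw, i.2]
  rw [(Submodule.equivMapOfInjective j hj _).finrank_eq, hmap,
    finrank_iSup_eq_sum (W := fun i : {i // l i = c} => W i) (hW.comp Subtype.val_injective)]
  exact (Finset.sum_subtype _ (fun i => by simp) (fun i => Module.finrank ℝ (W i))).symm

end DirectSum

/-! ### The tangent space and the shape operators in terms of roots. -/

namespace SymmetricLie

variable {L : Type*} [NormedAddCommGroup L] [InnerProductSpace ℝ L] {D : SymmetricLie L}
  {𝔞 : Submodule ℝ L}

/-- `P` contains exactly one of `α`, `-α` for each root `α` which is not orthogonal to `H`. -/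
structure IsHalf (D : SymmetricLie L) (H : 𝔞) (P : Set 𝔞) : Prop where
  mem_roots : ∀ α ∈ P, α ∈ D.roots 𝔞
  inner_ne_zero : ∀ α ∈ P, ⟪α, H⟫_ℝ ≠ 0
  mem_or_neg_mem : ∀ α ∈ D.roots 𝔞, ⟪α, H⟫_ℝ ≠ 0 → α ∈ P ∨ -α ∈ P
  neg_notMem : ∀ α ∈ P, -α ∉ P

theorem ad_k_eq {α : 𝔞} {Z : L} (hZ : Z ∈ D.rootSpace α) (A : 𝔞) :
    D.ad Z A = -(⟪α, A⟫_ℝ • D.rot α Z) := by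
  rw [D.ad_swap, ad_eq_smul_rot hZ]

variable [FiniteDimensional ℝ L]

theorem IsHalf.iSupIndep {H : 𝔞} {P : Set 𝔞} (hP : D.IsHalf H P) :
    iSupIndep fun α : P => (D.rootSpace (α : 𝔞) ⊓ D.m : Submodule ℝ L) := by
  refine OrthogonalFamily.independent (𝕜 := ℝ) (OrthogonalFamily.of_pairwise fun α β h => ?_)
  refine Submodule.isOrtho_iff_inner_eq.2 fun X hX Y hY => ?_
  refine inner_rootSpace_eq_zero (fun h' => h (Subtype.ext h')) (fun h' => ?_) hX.1 hY.1
  exact hP.neg_notMem β β.2 (h' ▸ α.2)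

/-- For Z ∈ 𝔨 in the root space of α, [Z, H] = -⟨α,H⟩ rot(Z). So exactly the roots not orthogonal to
H contribute, each with its full part in 𝔪, and α and -α have the same space. -/
theorem IsHalf.range_ad (h𝔞 : D.IsMaxAbelian 𝔞) {H : 𝔞} {P : Set 𝔞} (hP : D.IsHalf H P) :
    Submodule.map (D.ad.flip H) D.k =
      ⨆ α : P, (D.rootSpace (α : 𝔞) ⊓ D.m : Submodule ℝ L) := by
  apply le_antisymm
  -- Precomposing with 1 + θ, which is 2 on 𝔨, gives a linear map on all of L that can be checked on
  -- root spaces one at a time.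
  · let f : L →ₗ[ℝ] L := (D.ad.flip H) ∘ₗ (LinearMap.id + D.θ)
    have hf : (⊤ : Submodule ℝ L) ≤ Submodule.comap f
        (⨆ α : P, (D.rootSpace (α : 𝔞) ⊓ D.m : Submodule ℝ L)) := by
      rw [← h𝔞.iSup_rootSpace]
      refine iSup_le fun α X hX => ?_
      change D.ad (X + D.θ X) H ∈ (⨆ α : P, (D.rootSpace (α : 𝔞) ⊓ D.m : Submodule ℝ L))
      have hZ := add_mem hX (θ_mem_rootSpace h𝔞.le_m hX)
      rw [ad_k_eq hZ H]
      by_cases hα : ⟪α, H⟫_ℝ = 0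
      · rw [hα, zero_smul, neg_zero]; exact zero_mem _
      refine neg_mem (Submodule.smul_mem _ _ ?_)
      by_cases hbot : D.rootSpace α = ⊥
      · rw [hbot, Submodule.mem_bot] at hZ
        rw [hZ, map_zero]; exact zero_mem _
      have hr : α ∈ D.roots 𝔞 := ⟨fun h => hα (by rw [h, inner_zero_left]), hbot⟩
      have hmem : D.rot α (X + D.θ X) ∈ D.rootSpace α ⊓ D.m :=
        ⟨rot_mem_rootSpace h𝔞 hZ, rot_mem_m h𝔞.le_m α (θ_add_mem_k X)⟩
      rcases hP.mem_or_neg_mem α hr hα with h | h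
      · exact Submodule.mem_iSup_of_mem (p := fun α : P => D.rootSpace (α : 𝔞) ⊓ D.m) ⟨α, h⟩ hmem
      · refine Submodule.mem_iSup_of_mem (p := fun α : P => D.rootSpace (α : 𝔞) ⊓ D.m) ⟨-α, h⟩ ?_
        rw [rootSpace_neg]
        exact hmem
    rintro _ ⟨Z, hZ, rfl⟩
    have h := hf (Submodule.mem_top (x := (2⁻¹ : ℝ) • Z))
    change D.ad ((2⁻¹ : ℝ) • Z + D.θ ((2⁻¹ : ℝ) • Z)) H ∈
      (⨆ α : P, (D.rootSpace (α : 𝔞) ⊓ D.m : Submodule ℝ L)) at h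
    rw [map_smul, mem_k.1 hZ, ← add_smul] at h
    norm_num at h
    exact h
  · refine iSup_le fun α X hX => ?_
    have hα := hP.inner_ne_zero α α.2
    refine ⟨(⟪(α : 𝔞), H⟫_ℝ)⁻¹ • D.rot (α : 𝔞) X, D.k.smul_mem _ (rot_mem_k h𝔞.le_m _ hX.2), ?_⟩
    rw [LinearMap.flip_apply, map_smul, LinearMap.smul_apply, ad_k_eq (rot_mem_rootSpace h𝔞 hX.1),
      rot_rot (hP.mem_roots α α.2).1 hX.1, smul_neg, smul_neg, smul_neg, neg_neg, smul_smul,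
      inv_mul_cancel₀ hα, one_smul]

end SymmetricLie

namespace IsotropyRep

open SymmetricLie

variable {L K : Type*} [NormedAddCommGroup L] [InnerProductSpace ℝ L] [FiniteDimensional ℝ L]
  [Group K] [TopologicalSpace K] {D : SymmetricLie L} (R : IsotropyRep D K) {𝔞 : Submodule ℝ L}

/-- The spectrum of the shape operator in a normal direction in `𝔞`. -/
theorem isSymmetricShape_iff (h𝔞 : D.IsMaxAbelian 𝔞) {H : 𝔞} {P : Finset 𝔞}
    (hP : D.IsHalf H (P : Set 𝔞)) (η : 𝔞) :
    R.toSmoothAction.IsSymmetricShape ⟨H, h𝔞.le_m H.2⟩ ⟨η, h𝔞.le_m η.2⟩ ↔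
      ∀ c : ℝ, ∑ α ∈ P with ⟪α, η⟫_ℝ = c * ⟪α, H⟫_ℝ, D.mult α =
        ∑ α ∈ P with ⟪α, η⟫_ℝ = -c * ⟪α, H⟫_ℝ, D.mult α := by
  classical
  set A := R.toSmoothAction with hA
  set p : D.m := ⟨H, h𝔞.le_m H.2⟩ with hp
  set ξ : D.m := ⟨η, h𝔞.le_m η.2⟩ with hξ
  have hB : ∀ (z : D.k) (X Y : D.m), ⟪A.B z X, Y⟫_ℝ = ⟪D.ad z X, (Y : L)⟫_ℝ := fun _ _ _ => rfl
  let j : A.tangent p →ₗ[ℝ] L := D.m.subtype ∘ₗ (A.tangent p).subtype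
  have hj : Function.Injective j := Subtype.val_injective.comp Subtype.val_injective
  have hrange : LinearMap.range j =
      ⨆ α : (P : Set 𝔞), (D.rootSpace (α : 𝔞) ⊓ D.m : Submodule ℝ L) := by
    rw [← hP.range_ad h𝔞]
    ext X
    constructor
    · rintro ⟨⟨_, z, rfl⟩, rfl⟩
      exact ⟨z, z.2, rfl⟩
    · rintro ⟨z, hz, rfl⟩
      exact ⟨⟨A.B ⟨z, hz⟩ p, ⟨⟨z, hz⟩, rfl⟩⟩, rfl⟩
  -- the shape operator exists
  have hex : ∃ S : A.tangent p →ₗ[ℝ] A.tangent p, ∀ z (u : A.tangent p), (u : D.m) = A.B z p →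
      ∀ z', ⟪(S u : D.m), A.B z' p⟫_ℝ = -⟪A.B z ξ, A.B z' p⟫_ℝ := by
    obtain ⟨g, hg⟩ := (A.B.flip p).rangeRestrict.exists_rightInverse_of_surjective
      (LinearMap.range_rangeRestrict _)
    refine ⟨-((A.tangent p).orthogonalProjectionOnto.toLinearMap ∘ₗ A.B.flip ξ ∘ₗ g),
      fun z u hu z' => ?_⟩
    have hgu : A.B (g u) p = u := congrArg Subtype.val (LinearMap.congr_fun hg u)
    have h1 : ⟪(((A.tangent p).orthogonalProjectionOnto (A.B (g u) ξ) : A.tangent p) : D.m),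
        A.B z' p⟫_ℝ = ⟪A.B (g u) ξ, A.B z' p⟫_ℝ :=
      (A.tangent p).inner_orthogonalProjectionOnto_eq_of_mem_right ⟨A.B z' p, ⟨z', rfl⟩⟩ (A.B (g u) ξ)
    change ⟪-(((A.tangent p).orthogonalProjectionOnto (A.B (g u) ξ) : A.tangent p) : D.m),
        A.B z' p⟫_ℝ = _
    rw [inner_neg_left, h1, neg_inj, ← sub_eq_zero, ← inner_sub_left, ← LinearMap.sub_apply,
      ← map_sub]
    -- Independence of the chosen preimage: if Z kills H, the Jacobi identity and [H, η] = 0 make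
    -- [Z, η] orthogonal to every [z', H].
    have h2 : D.ad ((g u - z : D.k) : L) H = 0 := by
      have : A.B (g u - z) p = 0 := by rw [map_sub, LinearMap.sub_apply, hgu, hu, sub_self]
      exact congrArg Subtype.val this
    rw [hB]
    change ⟪D.ad ((g u - z : D.k) : L) η, D.ad z' H⟫_ℝ = 0
    have h3 := D.jacobi ((g u - z : D.k) : L) z' H
    rw [h2, map_zero, sub_zero] at h3
    rw [D.inner_ad, ← h3, D.ad_swap _ (H : L), inner_neg_right, inner_ad_right,
      h𝔞.ad_eq_zero H H.2 η η.2, inner_zero_left, neg_zero, neg_zero, neg_zero]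
  have hval : ∀ S : A.tangent p →ₗ[ℝ] A.tangent p, (∀ z (u : A.tangent p), (u : D.m) = A.B z p →
      ∀ z', ⟪(S u : D.m), A.B z' p⟫_ℝ = -⟪A.B z ξ, A.B z' p⟫_ℝ) →
      ∀ c, Module.finrank ℝ (Module.End.eigenspace S c) =
        ∑ α ∈ P with ⟪α, η⟫_ℝ = -c * ⟪α, H⟫_ℝ, D.mult α := by
    intro S hS c
    have hdiag : ∀ (α : (P : Set 𝔞)) (x : A.tangent p), j x ∈ D.rootSpace (α : 𝔞) ⊓ D.m →
        S x = (-(⟪(α : 𝔞), η⟫_ℝ * (⟪(α : 𝔞), H⟫_ℝ)⁻¹)) • x := by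
      intro α x hx
      have hα := hP.inner_ne_zero α α.2
      have hα0 := (hP.mem_roots α α.2).1
      -- The element of 𝔨 with [z, H] = x. Then [z, η] is the multiple ⟨α,η⟩/⟨α,H⟩ of x, which is
      -- minus the eigenvalue.
      set z : D.k := ⟨(⟪(α : 𝔞), H⟫_ℝ)⁻¹ • D.rot (α : 𝔞) (j x),
        D.k.smul_mem _ (rot_mem_k h𝔞.le_m _ hx.2)⟩ with hz
      have hz' : ∀ A' : 𝔞, D.ad z A' = (⟪(α : 𝔞), A'⟫_ℝ * (⟪(α : 𝔞), H⟫_ℝ)⁻¹) • j x := fun A' => by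
        rw [hz]
        change D.ad ((⟪(α : 𝔞), H⟫_ℝ)⁻¹ • D.rot (α : 𝔞) (j x)) A' = _
        rw [map_smul, LinearMap.smul_apply, ad_k_eq (rot_mem_rootSpace h𝔞 hx.1),
          rot_rot hα0 hx.1, smul_neg, smul_neg, smul_neg, neg_neg, smul_smul, mul_comm]
      have hxz : (x : D.m) = A.B z p := Subtype.ext (by
        change j x = D.ad z H
        rw [hz' H, mul_inv_cancel₀ hα, one_smul])
      have h1 := hS z x hxz
      have h2 : A.B z ξ = (⟪(α : 𝔞), η⟫_ℝ * (⟪(α : 𝔞), H⟫_ℝ)⁻¹) • (x : D.m) := Subtype.ext (hz' η)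
      rw [← sub_eq_zero]
      refine Subtype.ext (inner_self_eq_zero (𝕜 := ℝ).1 ?_)
      obtain ⟨z', hz'⟩ := (S x - (-(⟪(α : 𝔞), η⟫_ℝ * (⟪(α : 𝔞), H⟫_ℝ)⁻¹)) • x).2
      change A.B z' p = _ at hz'
      rw [← hz']
      nth_rewrite 1 [hz']
      rw [Submodule.coe_sub, Submodule.coe_smul, inner_sub_left, h1, h2, inner_smul_left,
        inner_smul_left]
      simp
    rw [finrank_eigenspace_of_iSup hP.iSupIndep hj hrange hdiag c, Finset.sum_filter,
      Finset.sum_filter, ← Finset.sum_coe_sort P]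
    refine Finset.sum_congr rfl fun α _ => ?_
    have hα := hP.inner_ne_zero α α.2
    have e : (-(⟪(α : 𝔞), η⟫_ℝ * (⟪(α : 𝔞), H⟫_ℝ)⁻¹) = c) ↔ (⟪(α : 𝔞), η⟫_ℝ = -c * ⟪(α : 𝔞), H⟫_ℝ) := by
      rw [neg_eq_iff_eq_neg, ← div_eq_mul_inv, div_eq_iff hα]
    simp only [e]
    rfl
  constructor
  · rintro ⟨S, hS, hc⟩ c
    have := hc c
    rw [hval S hS, hval S hS, neg_neg] at this
    exact this.symm
  · intro h
    obtain ⟨S, hS⟩ := hex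
    refine ⟨S, hS, fun c => ?_⟩
    rw [hval S hS, hval S hS, neg_neg]
    exact (h c).symm

end IsotropyRep

/-! ### Conjugating normal vectors into 𝔞. -/

/-- A perturbation `a + t b` does not vanish on a finite set where `(a, b) ≠ 0`, for suitable
arbitrarily small `t`. -/
theorem exists_mem_Ioo_add_mul_ne_zero {ι : Type*} {s : Set ι} (hs : s.Finite) (a b : ι → ℝ)
    {τ : ℝ} (hτ : 0 < τ) : ∃ t ∈ Ioo 0 τ, ∀ i ∈ s, a i + t * b i = 0 → a i = 0 ∧ b i = 0 := by
  have hfin : ((fun i => -a i / b i) '' s).Finite := hs.image _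
  obtain ⟨t, ht, hts⟩ := ((Ioo_infinite hτ).sdiff hfin).nonempty
  refine ⟨t, ht, fun i hi h => ?_⟩
  by_cases hb : b i = 0
  · rw [hb, mul_zero, add_zero] at h
    exact ⟨h, hb⟩
  · refine (hts ⟨i, hi, ?_⟩).elim
    change -a i / b i = t
    rw [div_eq_iff hb]
    linarith

namespace SymmetricLie

variable {L : Type*} [NormedAddCommGroup L] [InnerProductSpace ℝ L] {D : SymmetricLie L}
  {𝔞 : Submodule ℝ L} [FiniteDimensional ℝ L]

/-- If every root which vanishes on `A` vanishes on `C`, then the centralizer of `A` is contained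
in that of `C`. -/
theorem IsMaxAbelian.ad_eq_zero_of_ad_eq_zero (h𝔞 : D.IsMaxAbelian 𝔞) {A C : 𝔞}
    (h : ∀ β ∈ D.roots 𝔞, ⟪β, A⟫_ℝ = 0 → ⟪β, C⟫_ℝ = 0) {X : L} (hX : D.ad A X = 0) :
    D.ad C X = 0 := by
  have hsym : ∀ (A : 𝔞) (Y Z : L), ⟪D.ad A (D.ad A Y), Z⟫_ℝ = ⟪Y, D.ad A (D.ad A Z)⟫_ℝ :=
    fun A Y Z => by rw [D.inner_ad, D.inner_ad, neg_neg]
  have key : D.ad C (D.ad C X) = 0 := by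
    -- For Y in the root space of β the pairing is -⟨β,C⟩²⟨X,Y⟩. If ⟨β,A⟩ = 0 then ⟨β,C⟩ = 0;
    -- otherwise X ⊥ Y, since ad(A)² kills X and acts on Y by a nonzero scalar.
    have : ⨆ β : 𝔞, D.rootSpace β ≤ (ℝ ∙ D.ad C (D.ad C X))ᗮ := by
      refine iSup_le fun β Y hY => Submodule.mem_orthogonal_singleton_iff_inner_right.2 ?_
      rw [hsym, hY C C, inner_smul_right]
      by_cases hβ : β ∈ D.roots 𝔞
      · by_cases hA : ⟪β, A⟫_ℝ = 0
        · rw [h β hβ hA]; simp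
        · have h2 := hsym A X Y
          rw [hX, map_zero, inner_zero_left, hY A A, inner_smul_right] at h2
          have h3 : ⟪X, Y⟫_ℝ = 0 :=
            (mul_eq_zero.1 h2.symm).resolve_left (neg_ne_zero.2 (mul_ne_zero hA hA))
          rw [h3, mul_zero]
      · by_cases h0 : β = 0
        · rw [h0, inner_zero_left]; simp
        · have hbot : D.rootSpace β = ⊥ := by
            by_contra hne
            exact hβ ⟨h0, hne⟩
          rw [hbot, Submodule.mem_bot] at hY
          rw [hY, inner_zero_right, mul_zero]
    rw [h𝔞.iSup_rootSpace] at this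
    have h2 := Submodule.mem_orthogonal_singleton_iff_inner_right.1
      (this (Submodule.mem_top (x := D.ad C (D.ad C X))))
    exact inner_self_eq_zero.1 h2
  have h4 := norm_sq_ad (D := D) (C : L) X
  rw [key, inner_zero_right, neg_zero] at h4
  simpa using h4

theorem exists_isMaxAbelian_ge {𝔟 : Submodule ℝ L} (h1 : 𝔟 ≤ D.m)
    (h2 : ∀ X ∈ 𝔟, ∀ Y ∈ 𝔟, D.ad X Y = 0) : ∃ 𝔠, 𝔟 ≤ 𝔠 ∧ D.IsMaxAbelian 𝔠 := by
  obtain ⟨𝔠, ⟨hle, hc⟩, hmax⟩ := (wellFounded_gt (α := Submodule ℝ L)).has_min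
    {𝔠 | 𝔟 ≤ 𝔠 ∧ 𝔠 ≤ D.m ∧ ∀ X ∈ 𝔠, ∀ Y ∈ 𝔠, D.ad X Y = 0} ⟨𝔟, le_rfl, h1, h2⟩
  refine ⟨𝔠, hle, IsMaxAbelian.of_maximal ⟨hc, fun 𝔢 he hce => ?_⟩⟩
  by_contra hne
  exact hmax 𝔢 ⟨hle.trans hce, he⟩ (lt_of_le_not_ge hce hne)

variable (D 𝔞) in
theorem exists_regular : ∃ A : 𝔞, ∀ α ∈ D.roots 𝔞, ⟪α, A⟫_ℝ ≠ 0 := by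
  have : Finite (D.roots 𝔞) := roots_finite
  obtain ⟨A, hA⟩ := Module.Dual.exists_forall_ne_zero_of_forall_exists
    (fun α : D.roots 𝔞 => (innerₗ 𝔞 (α : 𝔞) : Module.Dual ℝ 𝔞)) fun α =>
      ⟨α, by simpa using α.2.1⟩
  exact ⟨A, fun α hα => hA ⟨α, hα⟩⟩

theorem IsMaxAbelian.mem_of_regular (h𝔞 : D.IsMaxAbelian 𝔞) {A : 𝔞}
    (hA : ∀ α ∈ D.roots 𝔞, ⟪α, A⟫_ℝ ≠ 0) {X : L} (hX : X ∈ D.m) (h : D.ad A X = 0) : X ∈ 𝔞 :=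
  h𝔞.mem_of_commute X hX fun B hB =>
    h𝔞.ad_eq_zero_of_ad_eq_zero (C := ⟨B, hB⟩) (fun β hβ h0 => (hA β hβ h0).elim) h

/-- Taking z = [X, Y] ∈ 𝔨 gives ⟨[z, X], Y⟩ = ‖[X, Y]‖². So a vector normal to the orbit at X
commutes with X. -/
theorem ad_eq_zero_of_inner {X Y : L} (hX : X ∈ D.m) (hY : Y ∈ D.m)
    (h : ∀ z ∈ D.k, ⟪D.ad z X, Y⟫_ℝ = 0) : D.ad X Y = 0 := by
  have := h _ (ad_m_m hX hY)
  rw [inner_ad_cyclic] at this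
  exact inner_self_eq_zero.1 this

end SymmetricLie

namespace IsotropyRep

open SymmetricLie

variable {L K : Type*} [NormedAddCommGroup L] [InnerProductSpace ℝ L] [FiniteDimensional ℝ L]
  [Group K] [TopologicalSpace K] {D : SymmetricLie L} (R : IsotropyRep D K) {𝔞 : Submodule ℝ L}

theorem ρ_inv_apply (k : K) (X : L) : R.ρ k⁻¹ (R.ρ k X) = X := by
  have := congrArg (fun T : L →L[ℝ] L => T X) (R.ρ.map_mul k⁻¹ k)
  simpa using this.symm

theorem ρ_apply_inv (k : K) (X : L) : R.ρ k (R.ρ k⁻¹ X) = X := by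
  have := congrArg (fun T : L →L[ℝ] L => T X) (R.ρ.map_mul k k⁻¹)
  simpa using this.symm

theorem norm_ρ (k : K) (X : L) : ‖R.ρ k X‖ = ‖X‖ := by
  have h : ‖R.ρ k X‖ ^ 2 = ‖X‖ ^ 2 := by
    rw [← real_inner_self_eq_norm_sq, R.inner_ρ, real_inner_self_eq_norm_sq]
  exact (pow_left_inj₀ (norm_nonneg _) (norm_nonneg _) two_ne_zero).1 h

/-- At a maximum of `k ↦ ⟪ρ k Y, C⟫` the vectors `ρ k Y` and `C` commute. -/
theorem ad_eq_zero_of_isMax {Y C : L} (hY : Y ∈ D.m) (hC : C ∈ D.m) {k : K}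
    (hk : ∀ l, ⟪R.ρ l Y, C⟫_ℝ ≤ ⟪R.ρ k Y, C⟫_ℝ) : D.ad (R.ρ k Y) C = 0 := by
  refine ad_eq_zero_of_inner (R.ρ_mem_m k hY) hC fun z hz => ?_
  have h : HasFDerivAt R.chart (fderiv ℝ R.chart 0) ((0 : ℝ) • z) := by
    rw [zero_smul]
    exact ((R.contDiffOn_chart.contDiffAt (Metric.ball_mem_nhds _ R.radius_pos)).differentiableAt
      (by simp)).hasFDerivAt
  have h1 : HasDerivAt (fun t : ℝ => t • z) z 0 := by
    simpa using (hasDerivAt_id (0 : ℝ)).smul_const z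
  have h2 : HasDerivAt (fun t : ℝ => R.chart (t • z)) (fderiv ℝ R.chart 0 z) 0 :=
    HasFDerivAt.comp_hasDerivAt (f := fun t : ℝ => t • z) (0 : ℝ) h h1
  have h3 : HasDerivAt (fun t : ℝ => ⟪R.chart (t • z) (R.ρ k Y), C⟫_ℝ)
      ⟪D.ad z (R.ρ k Y), C⟫_ℝ 0 := by
    have h4 := (h2.clm_apply (hasDerivAt_const (0 : ℝ) (R.ρ k Y))).inner ℝ
      (hasDerivAt_const (0 : ℝ) C)
    rw [R.fderiv_chart_zero] at h4
    simpa using h4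
  -- Near 0 the chart takes values in the group, so maximality of k forces ⟨[z, ρ(k)Y], C⟩ = 0 for
  -- every z ∈ 𝔨.
  have hmax : IsLocalMax (fun t : ℝ => ⟪R.chart (t • z) (R.ρ k Y), C⟫_ℝ) 0 := by
    have hball : ∀ᶠ t : ℝ in nhds 0, t • z ∈ Metric.ball (0 : L) R.radius := by
      have hc : ContinuousAt (fun t : ℝ => t • z) 0 := h1.continuousAt
      apply hc
      change Metric.ball (0 : L) R.radius ∈ nhds ((0 : ℝ) • z)
      rw [zero_smul]
      exact Metric.ball_mem_nhds _ R.radius_pos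
    filter_upwards [hball] with t ht
    obtain ⟨l, hl⟩ := R.chart_mem _ ht (D.k.smul_mem t hz)
    rw [← hl, zero_smul, R.chart_zero]
    have := hk (l * k)
    rw [map_mul] at this
    exact this
  exact hmax.hasDerivAt_eq_zero h3

variable [CompactSpace K] [IsTopologicalGroup K]

/-- A normal vector at `H` is conjugate to an element of `𝔞` by an element fixing `H`. -/
theorem exists_ρ_mem (h𝔞 : D.IsMaxAbelian 𝔞) (H : 𝔞) {ξ : L} (hξ : ξ ∈ D.m)
    (hHξ : D.ad H ξ = 0) : ∃ k, R.ρ k H = H ∧ R.ρ k ξ ∈ 𝔞 := by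
  obtain ⟨A₀, hA₀⟩ := exists_regular D 𝔞
  set A := R.toSmoothAction
  set p : D.m := ⟨H, h𝔞.le_m H.2⟩ with hp
  -- an abelian subspace containing `H` and `ξ`
  have hξH : D.ad ξ H = 0 := by rw [D.ad_swap, hHξ, neg_zero]
  obtain ⟨𝔟, hle, h𝔟⟩ := exists_isMaxAbelian_ge (D := D) (𝔟 := Submodule.span ℝ {(H : L), ξ})
    (by
      rw [Submodule.span_le, insert_subset_iff, singleton_subset_iff]
      exact ⟨h𝔞.le_m H.2, hξ⟩)
    (by
      intro X hX Y hY
      obtain ⟨a, b, rfl⟩ := Submodule.mem_span_pair.1 hX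
      obtain ⟨a', b', rfl⟩ := Submodule.mem_span_pair.1 hY
      simp [ad_self, hHξ, hξH])
  have hH𝔟 : (H : L) ∈ 𝔟 := hle (Submodule.subset_span (mem_insert _ _))
  have hξ𝔟 : ξ ∈ 𝔟 := hle (Submodule.subset_span (mem_insert_of_mem _ rfl))
  obtain ⟨O, U, φ, hO, hHO, -, -, himg, hproj, -⟩ := A.exists_graph p
  obtain ⟨r, hr, hrO⟩ := Metric.isOpen_iff.1 hO p hHO
  -- Comparing the maximum found below with its value at 1 bounds ‖ρ(k)H - H‖² by 4τ(M - 1), and τ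
  -- is chosen so that 4τM ≤ r². The summand 1 gives positivity of M and the strict inequality.
  set M : ℝ := ‖(H : L)‖ * ‖A₀‖ + ‖ξ‖ * (‖(H : L)‖ + ‖A₀‖) + 1 with hM
  have hM0 : 0 < M := by positivity
  set τ : ℝ := min 1 (r ^ 2 / (4 * M)) with hτ
  have hτ0 : 0 < τ := lt_min one_pos (by positivity)
  -- δ makes C = H + δA₀ regular in 𝔞; ε makes every root of 𝔟 that vanishes on Y = H + εξ vanish on
  -- both H and ξ.
  obtain ⟨δ, hδ, hδ'⟩ := exists_mem_Ioo_add_mul_ne_zero (roots_finite (D := D) (𝔞 := 𝔞))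
    (fun α => ⟪α, H⟫_ℝ) (fun α => ⟪α, A₀⟫_ℝ) hτ0
  obtain ⟨ε, hε, hε'⟩ := exists_mem_Ioo_add_mul_ne_zero (roots_finite (D := D) (𝔞 := 𝔟))
    (fun β => ⟪(β : L), H⟫_ℝ) (fun β => ⟪(β : L), ξ⟫_ℝ) hτ0
  set Y : L := H + ε • ξ with hY
  set C : 𝔞 := H + δ • A₀ with hC
  have hYm : Y ∈ D.m := D.m.add_mem (h𝔞.le_m H.2) (D.m.smul_mem _ hξ)
  have hCreg : ∀ α ∈ D.roots 𝔞, ⟪α, C⟫_ℝ ≠ 0 := fun α hα h0 => by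
    rw [hC, inner_add_right, inner_smul_right] at h0
    exact hA₀ α hα (hδ' α hα h0).2
  have hcont : Continuous fun k => ⟪R.ρ k Y, (C : L)⟫_ℝ :=
    (R.continuous_ρ.clm_apply continuous_const).inner continuous_const
  -- Maximizing over the compact group makes ρ(k)Y commute with the regular element C, which puts
  -- ρ(k)Y into 𝔞.
  obtain ⟨k, -, hk⟩ := isCompact_univ.exists_isMaxOn univ_nonempty hcont.continuousOn
  have hk' : ∀ l, ⟪R.ρ l Y, (C : L)⟫_ℝ ≤ ⟪R.ρ k Y, (C : L)⟫_ℝ := fun l => hk (mem_univ l)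
  have hYa : R.ρ k Y ∈ 𝔞 := by
    refine h𝔞.mem_of_regular hCreg (R.ρ_mem_m k hYm) ?_
    rw [D.ad_swap, R.ad_eq_zero_of_isMax hYm (h𝔞.le_m C.2) hk', neg_zero]
  -- `H` and `ξ` are moved into `𝔞`
  have hmem : ∀ Z : 𝔟, (∀ β ∈ D.roots 𝔟, ⟪(β : L), H⟫_ℝ = 0 → ⟪(β : L), ξ⟫_ℝ = 0 → ⟪β, Z⟫_ℝ = 0) →
      R.ρ k Z ∈ 𝔞 := by
    intro Z hZ
    refine h𝔞.mem_of_commute _ (R.ρ_mem_m k (h𝔟.le_m Z.2)) fun B hB => ?_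
    have h1 : D.ad Y (R.ρ k⁻¹ B) = 0 := by
      have := h𝔞.ad_eq_zero _ hYa B hB
      have h2 := congrArg (R.ρ k⁻¹) this
      rwa [R.ρ_ad, R.ρ_inv_apply, map_zero] at h2
    have h2 : D.ad Z (R.ρ k⁻¹ B) = 0 :=
      h𝔟.ad_eq_zero_of_ad_eq_zero (A := ⟨Y, 𝔟.add_mem hH𝔟 (𝔟.smul_mem _ hξ𝔟)⟩) (fun β hβ h0 => by
        change ⟪(β : L), Y⟫_ℝ = 0 at h0
        rw [hY, inner_add_right, inner_smul_right] at h0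
        obtain ⟨e1, e2⟩ := hε' β hβ h0
        exact hZ β hβ e1 e2) h1
    have h3 := congrArg (R.ρ k) h2
    rw [R.ρ_ad, R.ρ_apply_inv, map_zero] at h3
    rw [D.ad_swap, h3, neg_zero]
  have hHa : R.ρ k H ∈ 𝔞 := hmem ⟨H, hH𝔟⟩ fun β _ h _ => h
  have hξa : R.ρ k ξ ∈ 𝔞 := hmem ⟨ξ, hξ𝔟⟩ fun β _ _ h => h
  refine ⟨k, ?_, hξa⟩
  -- `ρ k H` is close to `H`
  have hdist : ‖R.ρ k H - H‖ ^ 2 < r ^ 2 := by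
    have h1 := hk' 1
    rw [map_one] at h1
    change ⟪Y, (C : L)⟫_ℝ ≤ _ at h1
    have hCc : (C : L) = H + δ • (A₀ : L) := rfl
    rw [hY, hCc, map_add, map_smul] at h1
    simp only [inner_add_left, inner_add_right, inner_smul_left, inner_smul_right,
      real_inner_self_eq_norm_sq, RCLike.conj_to_real] at h1
    have h2 : ‖R.ρ k H - H‖ ^ 2 = 2 * ‖(H : L)‖ ^ 2 - 2 * ⟪R.ρ k H, (H : L)⟫_ℝ := by
      rw [norm_sub_sq_real, R.norm_ρ]; ring
    have b1 := abs_le.1 (abs_real_inner_le_norm (R.ρ k H) (A₀ : L))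
    have b2 := abs_le.1 (abs_real_inner_le_norm (H : L) (A₀ : L))
    have b3 := abs_le.1 (abs_real_inner_le_norm (R.ρ k ξ) (A₀ : L))
    have b4 := abs_le.1 (abs_real_inner_le_norm ξ (A₀ : L))
    have b5 := abs_le.1 (abs_real_inner_le_norm (R.ρ k ξ) (H : L))
    have b6 := abs_le.1 (abs_real_inner_le_norm ξ (H : L))
    rw [R.norm_ρ] at b1 b3 b5
    have hA0 : ‖(A₀ : L)‖ = ‖A₀‖ := rfl
    rw [hA0] at b1 b2 b3 b4
    have hδ1 : δ ≤ 1 := hδ.2.le.trans (min_le_left _ _)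
    have c1 : δ * (⟪R.ρ k H, (A₀ : L)⟫_ℝ - ⟪(H : L), (A₀ : L)⟫_ℝ) ≤ δ * (2 * (‖(H : L)‖ * ‖A₀‖)) :=
      mul_le_mul_of_nonneg_left (by linarith) hδ.1.le
    have c2 : ε * (⟪R.ρ k ξ, (H : L)⟫_ℝ - ⟪ξ, (H : L)⟫_ℝ) ≤ ε * (2 * (‖ξ‖ * ‖(H : L)‖)) :=
      mul_le_mul_of_nonneg_left (by linarith) hε.1.le
    have c3 : δ * (ε * (⟪R.ρ k ξ, (A₀ : L)⟫_ℝ - ⟪ξ, (A₀ : L)⟫_ℝ)) ≤ 1 * (ε * (2 * (‖ξ‖ * ‖A₀‖))) := by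
      refine (mul_le_mul_of_nonneg_left (mul_le_mul_of_nonneg_left
        (show _ ≤ 2 * (‖ξ‖ * ‖A₀‖) by linarith) hε.1.le) hδ.1.le).trans ?_
      exact mul_le_mul_of_nonneg_right hδ1 (mul_nonneg hε.1.le (by positivity))
    have d1 : δ * (2 * (‖(H : L)‖ * ‖A₀‖)) ≤ τ * (2 * (‖(H : L)‖ * ‖A₀‖)) :=
      mul_le_mul_of_nonneg_right hδ.2.le (by positivity)
    have d2 : ε * (2 * (‖ξ‖ * ‖(H : L)‖) + 2 * (‖ξ‖ * ‖A₀‖)) ≤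
        τ * (2 * (‖ξ‖ * ‖(H : L)‖) + 2 * (‖ξ‖ * ‖A₀‖)) :=
      mul_le_mul_of_nonneg_right hε.2.le (by positivity)
    have d3 : τ * (4 * M) ≤ r ^ 2 := by
      rw [← le_div_iff₀ (by positivity)]
      exact min_le_right _ _
    have d4 : τ * (4 * M) = 2 * (τ * (2 * (‖(H : L)‖ * ‖A₀‖))) +
        2 * (τ * (2 * (‖ξ‖ * ‖(H : L)‖) + 2 * (‖ξ‖ * ‖A₀‖))) + 4 * τ := by
      rw [hM]; ring
    linarith
  -- Near H the orbit is a graph over its tangent space, and vectors of 𝔞 are orthogonal to that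
  -- space. Both ρ(k)H and H lie in 𝔞, so they have the same projection 0 and are the same point of
  -- the graph.
  have hk2 : A.act k p ∈ A.orbit p ∩ O := by
    refine ⟨⟨k, rfl⟩, hrO ?_⟩
    rw [mem_ball_iff_norm]
    change ‖((A.act k p - p : D.m) : L)‖ < r
    rw [Submodule.coe_sub, R.coe_act]
    exact lt_of_pow_lt_pow_left₀ 2 hr.le hdist
  have hP : ∀ Z : D.m, (Z : L) ∈ 𝔞 → (A.tangent p).orthogonalProjectionOnto Z = 0 := by
    intro Z hZ
    refine (A.tangent p).orthogonalProjectionOnto_apply_of_mem_orthogonal ?_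
    refine (Submodule.mem_orthogonal _ _).2 ?_
    rintro _ ⟨z, rfl⟩
    change ⟪D.ad z H, (Z : L)⟫_ℝ = 0
    rw [inner_ad_cyclic, h𝔞.ad_eq_zero H H.2 Z hZ, inner_zero_right]
  rw [← himg] at hk2
  have hk3 : p ∈ φ '' U := by rw [himg]; exact ⟨A.self_mem_orbit p, hHO⟩
  obtain ⟨x, hx, hxk⟩ := hk2
  obtain ⟨y, hy, hyp⟩ := hk3
  have e1 := hproj x hx
  have e2 := hproj y hy
  rw [hxk, hP _ (by rw [R.coe_act]; exact hHa)] at e1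
  rw [hyp, hP _ H.2] at e2
  have : A.act k p = p := by rw [← hxk, ← hyp, ← e1, ← e2]
  rw [← R.coe_act k p, this]

/-- The orbit of `H` is austere in the sphere if and only if the spectra of the shape operators in
the normal directions in `𝔞` are symmetric. -/
theorem isAustereInSphere_orbit_iff (h𝔞 : D.IsMaxAbelian 𝔞) {H : 𝔞} {P : Finset 𝔞}
    (hP : D.IsHalf H (P : Set 𝔞)) :
    IsAustereInSphere ‖H‖ (R.toSmoothAction.orbit ⟨H, h𝔞.le_m H.2⟩) ↔
      ∀ η : 𝔞, ⟪H, η⟫_ℝ = 0 → ∀ c : ℝ, ∑ α ∈ P with ⟪α, η⟫_ℝ = c * ⟪α, H⟫_ℝ, D.mult α =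
        ∑ α ∈ P with ⟪α, η⟫_ℝ = -c * ⟪α, H⟫_ℝ, D.mult α := by
  refine (R.toSmoothAction.isAustereInSphere_orbit_iff ⟨H, h𝔞.le_m H.2⟩).trans ?_
  constructor
  · intro h η hη
    refine (R.isSymmetricShape_iff h𝔞 hP η).1 (h _ hη fun z => ?_)
    change ⟪D.ad z H, (η : L)⟫_ℝ = 0
    rw [inner_ad_cyclic, h𝔞.ad_eq_zero H H.2 η η.2, inner_zero_right]
  · intro h ξ hξ hz
    have hHξ : D.ad H ξ = 0 := ad_eq_zero_of_inner (h𝔞.le_m H.2) ξ.2 fun z hz' => hz ⟨z, hz'⟩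
    obtain ⟨k, hkH, hkξ⟩ := R.exists_ρ_mem h𝔞 H ξ.2 hHξ
    have h1 : ⟪H, (⟨R.ρ k ξ, hkξ⟩ : 𝔞)⟫_ℝ = 0 := by
      change ⟪(H : L), R.ρ k ξ⟫_ℝ = 0
      rw [← hkH, R.inner_ρ]
      exact hξ
    have h2 := SmoothAction.IsSymmetricShape.act _
      ((R.isSymmetricShape_iff h𝔞 hP ⟨R.ρ k ξ, hkξ⟩).2 (h _ h1)) k⁻¹
    convert h2 using 1
    · apply Subtype.ext
      rw [R.coe_act]
      change (H : L) = R.ρ k⁻¹ H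
      have := R.ρ_inv_apply k H
      rw [hkH] at this
      exact this.symm
    · apply Subtype.ext
      rw [R.coe_act]
      exact (R.ρ_inv_apply k ξ).symm

end IsotropyRep

/-! ### Principal directions and the pairing f. -/

section Pairing

variable {E : Type*} [NormedAddCommGroup E] [InnerProductSpace ℝ E] {H : E} {P : Set E}

/-- The principal direction of the root `α` at `H`: the projection of `α / ⟪α, H⟫` to the
orthogonal complement of `H`. -/
noncomputable def principalDir (H α : E) : E := (⟪α, H⟫_ℝ)⁻¹ • α - (‖H‖ ^ 2)⁻¹ • H

/-- The condition that `f` has no fixed points and that `H` is a multiple of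
`α / ‖α‖ ± f(α) / ‖f(α)‖` for every `α`. -/
def IsPairing (H : E) {P : Set E} (f : P → P) : Prop :=
  (∀ α, f α ≠ α) ∧ ∃ n ε : P → ℝ, ∀ α : P, n α ≠ 0 ∧ (ε α = 1 ∨ ε α = -1) ∧
    H = n α • (‖(α : E)‖⁻¹ • (α : E) + ε α • ‖(f α : E)‖⁻¹ • (f α : E))

theorem ne_zero_of_inner_ne_zero {α : E} (h : ⟪α, H⟫_ℝ ≠ 0) : α ≠ 0 ∧ H ≠ 0 :=
  ⟨fun h0 => h (by rw [h0, inner_zero_left]), fun h0 => h (by rw [h0, inner_zero_right])⟩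

theorem inner_principalDir {α : E} (h : ⟪α, H⟫_ℝ ≠ 0) : ⟪principalDir H α, H⟫_ℝ = 0 := by
  have hH : ‖H‖ ^ 2 ≠ 0 := pow_ne_zero _ (norm_ne_zero_iff.2 (ne_zero_of_inner_ne_zero h).2)
  rw [principalDir, inner_sub_left, inner_smul_left, inner_smul_left, real_inner_self_eq_norm_sq]
  simp [inv_mul_cancel₀ h, inv_mul_cancel₀ hH]

theorem inner_principalDir_right {α η : E} (hη : ⟪H, η⟫_ℝ = 0) :
    ⟪principalDir H α, η⟫_ℝ = (⟪α, H⟫_ℝ)⁻¹ * ⟪α, η⟫_ℝ := by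
  rw [principalDir, inner_sub_left, inner_smul_left, inner_smul_left, hη]
  simp

theorem principalDir_eq_iff {α β : E} (hα : ⟪α, H⟫_ℝ ≠ 0) (hβ : ⟪β, H⟫_ℝ ≠ 0) :
    principalDir H β = principalDir H α ↔ ∃ c : ℝ, β = c • α := by
  rw [principalDir, principalDir, sub_left_inj]
  constructor
  · intro h
    refine ⟨⟪β, H⟫_ℝ * (⟪α, H⟫_ℝ)⁻¹, ?_⟩
    rw [mul_smul, ← h, smul_smul, mul_inv_cancel₀ hβ, one_smul]
  · rintro ⟨c, rfl⟩
    rw [inner_smul_left] at hβ ⊢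
    rw [smul_smul]
    congr 1
    simp only [RCLike.conj_to_real, mul_eq_zero, not_or, ne_eq] at hβ ⊢
    field_simp [hβ.1]

/-- The direction vanishes only if H is a multiple of α; this is where the assumption that H is not
on the line of a root enters. -/
theorem principalDir_ne_zero {α : E} (hα : ⟪α, H⟫_ℝ ≠ 0) (h : ¬ ∃ x : ℝ, H = x • α) :
    principalDir H α ≠ 0 := by
  intro h0
  have hH : ‖H‖ ^ 2 ≠ 0 := pow_ne_zero _ (norm_ne_zero_iff.2 (ne_zero_of_inner_ne_zero hα).2)
  refine h ⟨‖H‖ ^ 2 * (⟪α, H⟫_ℝ)⁻¹, ?_⟩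
  rw [mul_smul, sub_eq_zero.1 h0, smul_smul, mul_inv_cancel₀ hH, one_smul]

/-- The relation between `α` and `f(α)` in terms of the principal directions. -/
theorem exists_eq_smul_add_iff {α β : E} (hα : ⟪α, H⟫_ℝ ≠ 0) (hβ : ⟪β, H⟫_ℝ ≠ 0) :
    (∃ n ε : ℝ, n ≠ 0 ∧ (ε = 1 ∨ ε = -1) ∧ H = n • (‖α‖⁻¹ • α + ε • ‖β‖⁻¹ • β)) ↔
      principalDir H β = -principalDir H α := by
  have hH : ‖H‖ ^ 2 ≠ 0 := pow_ne_zero _ (norm_ne_zero_iff.2 (ne_zero_of_inner_ne_zero hα).2)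
  have hα0 : ‖α‖ ≠ 0 := norm_ne_zero_iff.2 (ne_zero_of_inner_ne_zero hα).1
  have hβ0 : ‖β‖ ≠ 0 := norm_ne_zero_iff.2 (ne_zero_of_inner_ne_zero hβ).1
  have hsum : principalDir H β + principalDir H α =
      (⟪α, H⟫_ℝ)⁻¹ • α + (⟪β, H⟫_ℝ)⁻¹ • β - (2 * (‖H‖ ^ 2)⁻¹) • H := by
    rw [principalDir, principalDir, two_mul, add_smul]
    abel
  rw [eq_neg_iff_add_eq_zero, hsum, sub_eq_zero]
  constructor
  · rintro ⟨n, ε, hn, hε, h⟩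
    have hε2 : ε * ε = 1 := by rcases hε with rfl | rfl <;> norm_num
    have hu : ⟪α, α⟫_ℝ = ‖α‖ * ‖α‖ := real_inner_self_eq_norm_mul_norm α
    have hv : ⟪β, β⟫_ℝ = ‖β‖ * ‖β‖ := real_inner_self_eq_norm_mul_norm β
    have e1 : ⟪α, H⟫_ℝ = n * (‖α‖ + ε * ‖β‖⁻¹ * ⟪α, β⟫_ℝ) := by
      rw [h, inner_smul_right, inner_add_right, inner_smul_right, inner_smul_right,
        inner_smul_right, hu, ← mul_assoc, inv_mul_cancel₀ hα0, one_mul, mul_assoc]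
    have e2 : ⟪β, H⟫_ℝ = n * (‖α‖⁻¹ * ⟪α, β⟫_ℝ + ε * ‖β‖) := by
      rw [h, inner_smul_right, inner_add_right, inner_smul_right, inner_smul_right,
        inner_smul_right, hv, real_inner_comm α β, inv_mul_cancel_left₀ hβ0]
    -- `⟪β, H⟫ / ‖β‖ = ε ⟪α, H⟫ / ‖α‖`
    have e3 : ⟪β, H⟫_ℝ * ‖α‖ = ε * ‖β‖ * ⟪α, H⟫_ℝ := by
      rw [e1, e2]
      field_simp
      linear_combination (-⟪α, β⟫_ℝ) * hε2
    have e4 : (⟪β, H⟫_ℝ)⁻¹ = (⟪α, H⟫_ℝ)⁻¹ * ‖α‖ * (ε * ‖β‖⁻¹) := by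
      rw [inv_eq_iff_eq_inv, mul_inv, mul_inv, inv_inv, mul_inv, inv_inv]
      rw [show ε⁻¹ = ε from inv_eq_of_mul_eq_one_left hε2]
      field_simp
      linarith
    have e5 : (⟪α, H⟫_ℝ)⁻¹ • α + (⟪β, H⟫_ℝ)⁻¹ • β = ((⟪α, H⟫_ℝ)⁻¹ * ‖α‖ * n⁻¹) • H := by
      rw [mul_smul, (inv_smul_eq_iff₀ hn).2 h, smul_add, smul_smul, smul_smul, smul_smul, e4,
        mul_assoc (⟪α, H⟫_ℝ)⁻¹ ‖α‖ ‖α‖⁻¹, mul_inv_cancel₀ hα0, mul_one]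
      simp only [mul_assoc]
    have e6 := congrArg (fun x => ⟪x, H⟫_ℝ) e5
    simp only [inner_add_left, inner_smul_left, RCLike.conj_to_real,
      real_inner_self_eq_norm_sq] at e6
    rw [inv_mul_cancel₀ hα, inv_mul_cancel₀ hβ] at e6
    rw [e5]
    congr 1
    rw [eq_mul_inv_iff_mul_eq₀ hH, ← e6]
    norm_num
  · intro h
    -- α/⟨α,H⟩ and β/⟨β,H⟩ have the same component along H and opposite components orthogonal to it,
    -- hence equal norms.
    have hsq : (⟪α, H⟫_ℝ)⁻¹ ^ 2 * ‖α‖ ^ 2 = (⟪β, H⟫_ℝ)⁻¹ ^ 2 * ‖β‖ ^ 2 := by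
      have e1 : (⟪β, H⟫_ℝ)⁻¹ • β = (2 * (‖H‖ ^ 2)⁻¹) • H - (⟪α, H⟫_ℝ)⁻¹ • α :=
        eq_sub_of_add_eq' h
      have e2 := congrArg (fun x => ‖x‖ ^ 2) e1
      simp only [norm_sub_sq_real, norm_smul, mul_pow, Real.norm_eq_abs, sq_abs, inner_smul_left,
        inner_smul_right, RCLike.conj_to_real] at e2
      rw [e2, real_inner_comm α H]
      field_simp
      ring
    set a : ℝ := (⟪α, H⟫_ℝ)⁻¹ * ‖α‖ with ha
    set b : ℝ := (⟪β, H⟫_ℝ)⁻¹ * ‖β‖ with hb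
    have ha0 : a ≠ 0 := mul_ne_zero (inv_ne_zero hα) hα0
    -- The sum α/⟨α,H⟩ + β/⟨β,H⟩ = 2H/‖H‖² is solved for H and written with unit vectors; `hsq` says
    -- that the ratio b/a is ±1.
    refine ⟨‖H‖ ^ 2 * 2⁻¹ * a, b * a⁻¹, mul_ne_zero (mul_ne_zero hH (by norm_num)) ha0, ?_, ?_⟩
    · have : (b * a⁻¹) ^ 2 = 1 := by
        rw [mul_pow, inv_pow, mul_inv_eq_one₀ (pow_ne_zero _ ha0), ha, hb, mul_pow, mul_pow, hsq]
      rw [← one_pow 2] at this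
      exact sq_eq_sq_iff_eq_or_eq_neg.1 this
    · have e1 : a • ‖α‖⁻¹ • α = (⟪α, H⟫_ℝ)⁻¹ • α := by
        rw [smul_smul, ha, mul_assoc, mul_inv_cancel₀ hα0, mul_one]
      have e2 : b • ‖β‖⁻¹ • β = (⟪β, H⟫_ℝ)⁻¹ • β := by
        rw [smul_smul, hb, mul_assoc, mul_inv_cancel₀ hβ0, mul_one]
      rw [mul_smul _ a, smul_add, smul_smul a (b * a⁻¹), mul_comm a, mul_assoc,
        inv_mul_cancel₀ ha0, mul_one, e1, e2, h, smul_smul]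
      rw [show ‖H‖ ^ 2 * 2⁻¹ * (2 * (‖H‖ ^ 2)⁻¹) = 1 by
        rw [mul_assoc, inv_mul_cancel_left₀ two_ne_zero, mul_inv_cancel₀ hH], one_smul]

/-- The absence of fixed points is automatic here: a fixed point would have principal direction w =
-w = 0. -/
theorem isPairing_iff (hP : ∀ α ∈ P, ⟪α, H⟫_ℝ ≠ 0) (hH : ∀ α ∈ P, ¬ ∃ x : ℝ, H = x • α)
    (f : P → P) :
    IsPairing H f ↔ ∀ α : P, principalDir H (f α : E) = -principalDir H (α : E) := by
  constructor
  · rintro ⟨-, n, ε, h⟩ α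
    exact (exists_eq_smul_add_iff (hP α α.2) (hP _ (f α).2)).1 ⟨n α, ε α, h α⟩
  · intro h
    refine ⟨fun α hα => principalDir_ne_zero (hP α α.2) (hH α α.2) ?_, ?_⟩
    · have := h α
      rw [hα, eq_neg_iff_add_eq_zero, ← two_smul ℝ] at this
      exact (smul_eq_zero.1 this).resolve_left two_ne_zero
    · have h2 := fun α : P => (exists_eq_smul_add_iff (hP α α.2) (hP _ (f α).2)).2 (h α)
      choose n ε h3 using h2
      exact ⟨n, ε, h3⟩

/-- The sum of the weights of the elements of `P` which are parallel to `α`. -/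
noncomputable def parallelSum (m : E → ℕ) (P : Set E) (α : E) : ℕ :=
  ∑ᶠ μ ∈ {μ | μ ∈ P ∧ ∃ c : ℝ, μ = c • α}, m μ

-- Parallel elements of P are those with the same principal direction, so the sum is the total
-- weight of a fibre of the direction map.
open Classical in
theorem parallelSum_eq (m : E → ℕ) {P : Finset E} (hP : ∀ α ∈ P, ⟪α, H⟫_ℝ ≠ 0) {α : E}
    (hα : α ∈ P) : parallelSum m (P : Set E) α =
      ∑ μ ∈ P with principalDir H μ = principalDir H α, m μ := by
  rw [parallelSum, ← finsum_mem_coe_finset]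
  refine finsum_mem_congr ?_ fun _ _ => rfl
  ext μ
  simp only [Finset.coe_filter, mem_ofPred_eq, Finset.mem_coe]
  exact and_congr_right fun hμ => (principalDir_eq_iff (hP α hα) (hP μ hμ)).symm

open Classical in
/-- The symmetry of the spectra is equivalent to the existence of a pairing. -/
theorem forall_sum_eq_iff_exists_pairing {m : E → ℕ} {P : Finset E} (hm : ∀ α ∈ P, 0 < m α)
    (hP : ∀ α ∈ P, ⟪α, H⟫_ℝ ≠ 0) (hH : ∀ α ∈ P, ¬ ∃ x : ℝ, H = x • α) :
    (∀ η : E, ⟪H, η⟫_ℝ = 0 → ∀ c : ℝ, ∑ α ∈ P with ⟪α, η⟫_ℝ = c * ⟪α, H⟫_ℝ, m α =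
        ∑ α ∈ P with ⟪α, η⟫_ℝ = -c * ⟪α, H⟫_ℝ, m α) ↔
      ∃ f : ↥(P : Set E) → ↥(P : Set E), IsPairing H f ∧
        ∀ α : (P : Set E), parallelSum m (P : Set E) α = parallelSum m (P : Set E) (f α) := by
  set w : E → E := principalDir H with hw
  set N : E → ℕ := fun v => ∑ μ ∈ P with w μ = v, m μ with hN
  have hpar : ∀ α : (P : Set E), parallelSum m (P : Set E) α = N (w α) := fun α =>
    parallelSum_eq m hP α.2
  have hη : ∀ η, ⟪H, η⟫_ℝ = 0 → ∀ c : ℝ, (P.filter fun α => ⟪α, η⟫_ℝ = c * ⟪α, H⟫_ℝ) =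
      P.filter fun α => ⟪w α, η⟫_ℝ = c := fun η hη c => by
    refine Finset.filter_congr fun α hα => ?_
    rw [hw, inner_principalDir_right hη, inv_mul_eq_iff_eq_mul₀ (hP α hα), mul_comm]
  have hperp : ∀ α ∈ P, w α ∈ (ℝ ∙ H)ᗮ := fun α hα =>
    Submodule.mem_orthogonal_singleton_iff_inner_left.2 (inner_principalDir (hP α hα))
  constructor
  · intro h
    -- An η ⊥ H outside the hyperplanes of these finitely many vectors separates distinct directions
    -- and detects opposite ones, turning symmetry of numbers into symmetry of vectors.
    let D : Set E := (image2 (fun u v => u - v) (w '' P) (w '' P) ∪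
      image2 (fun u v => u + v) (w '' P) (w '' P)) \ {0}
    have hD : D.Finite := by
      have := (P.finite_toSet.image w)
      exact ((this.image2 _ this).union (this.image2 _ this)).sdiff
    have hDperp : ∀ d ∈ D, d ∈ (ℝ ∙ H)ᗮ := by
      rintro d ⟨⟨_, ⟨u, hu, rfl⟩, _, ⟨v, hv, rfl⟩, rfl⟩ | ⟨_, ⟨u, hu, rfl⟩, _, ⟨v, hv, rfl⟩, rfl⟩, -⟩
      · exact sub_mem (hperp u hu) (hperp v hv)
      · exact add_mem (hperp u hu) (hperp v hv)
    have : Finite D := hD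
    obtain ⟨η, hηH, hηD⟩ := Module.Dual.exists_forall_mem_ne_zero_of_forall_exists (ℝ ∙ H)ᗮ
      (fun d : D => (innerₗ E (d : E) : Module.Dual ℝ E)) fun d =>
        ⟨d, hDperp d d.2, by simpa using d.2.2⟩
    have hηH' : ⟪H, η⟫_ℝ = 0 := Submodule.mem_orthogonal_singleton_iff_inner_right.1 hηH
    have hinj : ∀ α ∈ P, ∀ β ∈ P, ⟪w β, η⟫_ℝ = ⟪w α, η⟫_ℝ ↔ w β = w α := fun α hα β hβ => by
      refine ⟨fun e => ?_, fun e => by rw [e]⟩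
      by_contra hne
      refine hηD ⟨w β - w α, Or.inl ⟨w β, ⟨β, hβ, rfl⟩, w α, ⟨α, hα, rfl⟩, rfl⟩,
        sub_ne_zero.2 hne⟩ ?_
      change ⟪w β - w α, η⟫_ℝ = 0
      rw [inner_sub_left, e, sub_self]
    have hinj' : ∀ α ∈ P, ∀ β ∈ P, ⟪w β, η⟫_ℝ = -⟪w α, η⟫_ℝ ↔ w β = -w α := fun α hα β hβ => by
      refine ⟨fun e => ?_, fun e => by rw [e, inner_neg_left]⟩
      by_contra hne
      refine hηD ⟨w β + w α, Or.inr ⟨w β, ⟨β, hβ, rfl⟩, w α, ⟨α, hα, rfl⟩, rfl⟩,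
        fun h0 => hne (eq_neg_of_add_eq_zero_left h0)⟩ ?_
      change ⟪w β + w α, η⟫_ℝ = 0
      rw [inner_add_left, e, neg_add_cancel]
    have hNN : ∀ α ∈ P, N (w α) = N (-w α) := fun α hα => by
      have := h η hηH' ⟪w α, η⟫_ℝ
      rw [hη η hηH', hη η hηH'] at this
      rw [Finset.filter_congr fun β hβ => hinj α hα β hβ,
        Finset.filter_congr fun β hβ => hinj' α hα β hβ] at this
      exact this
    have hex : ∀ α : (P : Set E), ∃ β : (P : Set E), w β = -w α := fun α => by
      have h1 : 0 < N (-w α) := by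
        rw [← hNN α α.2]
        exact Finset.sum_pos (fun μ hμ => hm μ (Finset.mem_filter.1 hμ).1)
          ⟨α, Finset.mem_filter.2 ⟨α.2, rfl⟩⟩
      obtain ⟨β, hβ⟩ := Finset.nonempty_of_sum_ne_zero h1.ne'
      exact ⟨⟨β, (Finset.mem_filter.1 hβ).1⟩, (Finset.mem_filter.1 hβ).2⟩
    choose f hf using hex
    refine ⟨f, (isPairing_iff hP hH f).2 hf, fun α => ?_⟩
    rw [hpar, hpar, hf]
    exact hNN α α.2
  · rintro ⟨f, hf, hfN⟩ η hηH c
    have hf' := (isPairing_iff hP hH f).1 hf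
    rw [hη η hηH, hη η hηH]
    -- Grouping by direction: the map v ↦ -v preserves the set of directions and their weights and
    -- exchanges the levels c and -c.
    have hsum : ∀ c : ℝ, ∑ α ∈ P with ⟪w α, η⟫_ℝ = c, m α =
        ∑ v ∈ (P.image w) with ⟪v, η⟫_ℝ = c, N v := fun c => by
      rw [← Finset.sum_fiberwise_of_maps_to (g := w)
        (t := (P.image w).filter fun v => ⟪v, η⟫_ℝ = c) fun α hα => by
          obtain ⟨h1, h2⟩ := Finset.mem_filter.1 hα
          exact Finset.mem_filter.2 ⟨Finset.mem_image_of_mem w h1, h2⟩]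
      refine Finset.sum_congr rfl fun v hv => ?_
      rw [hN, Finset.filter_filter]
      refine Finset.sum_congr (Finset.filter_congr fun α _ => ?_) fun _ _ => rfl
      refine ⟨fun h => h.2, fun h => ⟨?_, h⟩⟩
      rw [h]
      exact (Finset.mem_filter.1 hv).2
    rw [hsum, hsum]
    have hNv : ∀ v ∈ P.image w, N v = N (-v) ∧ -v ∈ P.image w := fun v hv => by
      obtain ⟨α, hα, rfl⟩ := Finset.mem_image.1 hv
      have h1 := hf' ⟨α, hα⟩
      have h2 := hfN ⟨α, hα⟩
      rw [hpar, hpar, hw, h1] at h2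
      refine ⟨h2, ?_⟩
      rw [hw, ← h1]
      exact Finset.mem_image_of_mem w (f ⟨α, hα⟩).2
    refine Finset.sum_bij' (fun v _ => -v) (fun v _ => -v) ?_ ?_ (fun _ _ => neg_neg _)
      (fun _ _ => neg_neg _) fun v hv => (hNv v (Finset.mem_filter.1 hv).1).1
    · intro v hv
      obtain ⟨h1, h2⟩ := Finset.mem_filter.1 hv
      exact Finset.mem_filter.2 ⟨(hNv v h1).2, by rw [inner_neg_left, h2]⟩
    · intro v hv
      obtain ⟨h1, h2⟩ := Finset.mem_filter.1 hv
      exact Finset.mem_filter.2 ⟨(hNv v h1).2, by rw [inner_neg_left, h2, neg_neg]⟩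

omit [NormedAddCommGroup E] [InnerProductSpace ℝ E] in
theorem even_ncard_of_involutive {f : P → P} (hfin : P.Finite) (hf : ∀ α, f (f α) = α)
    (hne : ∀ α, f α ≠ α) : Even P.ncard := by
  have : Fintype P := hfin.fintype
  rw [← Nat.card_coe_set_eq, Nat.card_eq_fintype_card, ← ZMod.natCast_eq_zero_iff_even,
    ← Finset.card_univ, ← nsmul_one, ← Finset.sum_const]
  exact Finset.sum_involution (fun α _ => f α) (fun _ _ => by decide) (fun α _ _ => hne α)
    (fun _ _ => Finset.mem_univ _) fun α _ => hf α

/-- If distinct elements of `P` are not parallel, then a pairing is an involution. -/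
theorem IsPairing.of_reduced {m : E → ℕ} (hfin : P.Finite)
    (hP : ∀ α ∈ P, ⟪α, H⟫_ℝ ≠ 0) (hH : ∀ α ∈ P, ¬ ∃ x : ℝ, H = x • α)
    (hred : ∀ α ∈ P, ∀ β ∈ P, (∃ c : ℝ, β = c • α) → β = α) {f : P → P} (hf : IsPairing H f) :
    (∀ α : P, parallelSum m P α = parallelSum m P (f α) ↔ m α = m (f α)) ∧
      (∀ α : P, f (f α) = α) ∧ Even P.ncard := by
  have h1 : ∀ α ∈ P, parallelSum m P α = m α := fun α hα => by
    rw [parallelSum, show {μ | μ ∈ P ∧ ∃ c : ℝ, μ = c • α} = {α} from ?_, finsum_mem_singleton]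
    ext μ
    exact ⟨fun h => hred α hα μ h.1 h.2, fun h => by rw [h]; exact ⟨hα, 1, (one_smul _ _).symm⟩⟩
  have h2 : ∀ α : P, f (f α) = α := fun α => by
    have hf' := (isPairing_iff hP hH f).1 hf
    refine Subtype.ext (hred α α.2 _ (f (f α)).2 ?_)
    rw [← principalDir_eq_iff (hP α α.2) (hP _ (f (f α)).2), hf', hf', neg_neg]
  exact ⟨fun α => by rw [h1 α α.2, h1 _ (f α).2], h2, even_ncard_of_involutive hfin h2 hf.1⟩

end Pairing

/-! ### Lexicographic positivity and faces of the chamber. -/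

section Lex

variable {E : Type*} [NormedAddCommGroup E] [InnerProductSpace ℝ E] {r : ℕ}

/-- The first nonzero coordinate of `x` is positive. -/
def LexPos (b : Module.Basis (Fin r) ℝ E) (x : E) : Prop :=
  ∃ i, (∀ j < i, b.repr x j = 0) ∧ 0 < b.repr x i

variable {b : Module.Basis (Fin r) ℝ E}

theorem LexPos.add {x y : E} (hx : LexPos b x) (hy : LexPos b y) : LexPos b (x + y) := by
  obtain ⟨i, hi, hi'⟩ := hx
  obtain ⟨j, hj, hj'⟩ := hy
  rcases lt_trichotomy i j with h | rfl | h
  · exact ⟨i, fun l hl => by simp [hi l hl, hj l (hl.trans h)], by simpa [hj i h] using hi'⟩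
  · exact ⟨i, fun l hl => by simp [hi l hl, hj l hl], by simpa using add_pos hi' hj'⟩
  · exact ⟨j, fun l hl => by simp [hj l hl, hi l (hl.trans h)], by simpa [hi j h] using hj'⟩

theorem not_lexPos_zero : ¬ LexPos b (0 : E) := by
  rintro ⟨i, -, h⟩
  simp at h

theorem LexPos.not_neg {x : E} (hx : LexPos b x) : ¬ LexPos b (-x) := fun h =>
  not_lexPos_zero (b := b) (by simpa using hx.add h)

theorem lexPos_or_neg {x : E} (hx : x ≠ 0) : LexPos b x ∨ LexPos b (-x) := by
  classical
  have hne : (Finset.univ.filter fun i => b.repr x i ≠ 0).Nonempty := by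
    by_contra h
    rw [Finset.not_nonempty_iff_eq_empty] at h
    apply hx
    apply b.repr.map_eq_zero_iff.1
    ext i
    by_contra hi
    exact Finset.notMem_empty i (h ▸ Finset.mem_filter.2 ⟨Finset.mem_univ i, hi⟩)
  set i := (Finset.univ.filter fun i => b.repr x i ≠ 0).min' hne with hi
  have h1 : b.repr x i ≠ 0 := (Finset.mem_filter.1 (Finset.min'_mem _ hne)).2
  have h2 : ∀ j < i, b.repr x j = 0 := fun j hj => by
    by_contra h
    exact absurd (Finset.min'_le _ j (Finset.mem_filter.2 ⟨Finset.mem_univ j, h⟩)) (not_le.2 hj)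
  rcases lt_or_gt_of_ne h1 with h | h
  · exact Or.inr ⟨i, fun j hj => by simp [h2 j hj], by simpa using h⟩
  · exact Or.inl ⟨i, h2, h⟩

/-- The roots in a finite set of positive vectors which are orthogonal to an element of a face of
the closed chamber are integral combinations of the simple ones which are orthogonal to it. -/
theorem inner_nonneg_and_mem_span {P : Set E} (hfin : P.Finite) (hpos : ∀ α ∈ P, LexPos b α)
    {F Δ : Set E} (hF : F = {α | α ∈ P ∧ ¬ ∃ β ∈ P, ∃ γ ∈ P, α = β + γ}) {H : E}
    (h0 : ∀ α ∈ F, 0 ≤ ⟪α, H⟫_ℝ) (hΔ : ∀ α ∈ Δ, 0 < ⟪α, H⟫_ℝ) :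
    ∀ α ∈ P, 0 ≤ ⟪α, H⟫_ℝ ∧ (⟪α, H⟫_ℝ = 0 → α ∈ Submodule.span ℤ (F \ Δ)) := by
  -- A finite set is well-founded for this strict order, and a non-simple positive root is a sum of
  -- two smaller positive ones. Both have nonnegative product with H, so a zero sum forces both to
  -- be zero.
  let lt : E → E → Prop := fun x y => LexPos b (y - x)
  have : IsStrictOrder E lt :=
    { irrefl := fun x h => by
        change LexPos b (x - x) at h
        rw [sub_self] at h
        exact not_lexPos_zero h
      trans := fun x y z h1 h2 => by
        have := LexPos.add h2 h1
        rwa [sub_add_sub_cancel] at this }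
  have hwf : P.WellFoundedOn lt := hfin.wellFoundedOn
  intro α hα
  refine hwf.induction (P := fun α => 0 ≤ ⟪α, H⟫_ℝ ∧
    (⟪α, H⟫_ℝ = 0 → α ∈ Submodule.span ℤ (F \ Δ))) hα fun α hα ih => ?_
  by_cases hs : ∃ β ∈ P, ∃ γ ∈ P, α = β + γ
  · obtain ⟨β, hβ, γ, hγ, rfl⟩ := hs
    obtain ⟨p1, q1⟩ := ih β hβ (by
      change LexPos b (β + γ - β)
      rw [add_sub_cancel_left]; exact hpos γ hγ)
    obtain ⟨p2, q2⟩ := ih γ hγ (by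
      change LexPos b (β + γ - γ)
      rw [add_sub_cancel_right]; exact hpos β hβ)
    rw [inner_add_left]
    exact ⟨add_nonneg p1 p2, fun h => add_mem (q1 (by linarith)) (q2 (by linarith))⟩
  · have hαF : α ∈ F := by rw [hF]; exact ⟨hα, hs⟩
    exact ⟨h0 α hαF, fun h => Submodule.subset_span ⟨hαF, fun h' => (hΔ α h').ne' h⟩⟩

end Lex

/-! ### sl₂-triples: integrality and reflections of restricted roots. -/

namespace SymmetricLie

variable {L : Type*} [NormedAddCommGroup L] [InnerProductSpace ℝ L] {D : SymmetricLie L}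
  {𝔞 : Submodule ℝ L} [FiniteDimensional ℝ L]

theorem mult_pos (h𝔞 : D.IsMaxAbelian 𝔞) {α : 𝔞} (hα : α ∈ D.roots 𝔞) : 0 < D.mult α := by
  have h1 := finrank_rootSpace h𝔞 hα.1
  have h2 : 0 < Module.finrank ℝ (D.rootSpace α) := by
    have : Nontrivial (D.rootSpace α) := Submodule.nontrivial_iff_ne_bot.2 hα.2
    exact Module.finrank_pos
  omega

theorem exists_mem_rootSpace_inf_m (h𝔞 : D.IsMaxAbelian 𝔞) {α : 𝔞} (hα : α ∈ D.roots 𝔞) :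
    ∃ X ∈ D.rootSpace α ⊓ D.m, X ≠ 0 := by
  by_contra! h
  have h1 := mult_pos h𝔞 hα
  rw [mult, (Submodule.eq_bot_iff _).2 h, finrank_bot] at h1
  exact lt_irrefl _ h1

theorem ad_rot (α : 𝔞) {X : L} (hα : α ≠ 0) (hX : X ∈ D.rootSpace α) (A : 𝔞) :
    D.ad A (D.rot α X) = -(⟪α, A⟫_ℝ • X) := by
  have := (cplx_mem_complexRootSpace.1
    ((cplx_mem_complexRootSpace_iff hα).2 ⟨hX, rfl⟩) A).2
  rw [map_neg] at this
  rw [← this, neg_neg]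

/-- The bracket of a root vector in `𝔪` and its rotation is a multiple of the root. -/
theorem ad_rot_self (h𝔞 : D.IsMaxAbelian 𝔞) {α : 𝔞} (hα : α ≠ 0) {X : L}
    (hX : X ∈ D.rootSpace α) (hXm : X ∈ D.m) : D.ad X (D.rot α X) = ‖X‖ ^ 2 • (α : L) := by
  -- Bracketing with A ∈ 𝔞 only produces multiples of [rot X, rot X] and [X, X], so this element of
  -- 𝔪 commutes with 𝔞.
  have h1 : D.ad X (D.rot α X) ∈ 𝔞 := by
    refine h𝔞.mem_of_commute _ (ad_m_k hXm (rot_mem_k h𝔞.le_m α hXm)) fun A hA => ?_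
    have hj := D.jacobi A X (D.rot α X)
    rw [ad_rot α hα hX ⟨A, hA⟩, ad_eq_smul_rot hX ⟨A, hA⟩, map_smul, LinearMap.smul_apply, ad_self,
      smul_zero, map_neg, map_smul, ad_self, smul_zero, neg_zero, sub_zero] at hj
    exact hj.symm
  have h2 : (⟨_, h1⟩ : 𝔞) = ‖X‖ ^ 2 • α := by
    refine ext_inner_right ℝ fun A => ?_
    change ⟪D.ad X (D.rot α X), (A : L)⟫_ℝ = _
    rw [inner_ad_cyclic, D.ad_swap, ad_rot α hα hX A, neg_neg, inner_smul_right, inner_smul_left,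
      real_inner_self_eq_norm_sq, mul_comm]
    rfl
  exact congrArg Subtype.val h2

section Sl2

attribute [local instance] LieRing.ofAssociativeRing

/-- The complexification of `ad X`. -/
noncomputable def adC (D : SymmetricLie L) (X : L) : Module.End ℂ (ℂ ⊗[ℝ] L) :=
  (D.ad X).baseChange ℂ

theorem lie_adC (X Y : L) : ⁅adC D X, adC D Y⁆ = adC D (D.ad X Y) := by
  rw [Ring.lie_def, adC, adC, adC, ← LinearMap.baseChange_mul, ← LinearMap.baseChange_mul,
    ← LinearMap.baseChange_sub]
  congr 1
  ext Z
  exact (D.jacobi X Y Z).symm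

theorem adC_neg (X : L) : adC D (-X) = -adC D X := by
  rw [adC, adC, map_neg, LinearMap.baseChange_neg]

theorem adC_smul (c : ℝ) (X : L) : adC D (c • X) = (c : ℂ) • adC D X := by
  rw [adC, adC, map_smul, LinearMap.baseChange_smul]
  rfl

theorem mem_complexRootSpace {β : 𝔞} {v : ℂ ⊗[ℝ] L} :
    v ∈ D.complexRootSpace β ↔
      ∀ A : 𝔞, adC D A v = (Complex.I * (⟪β, A⟫_ℝ : ℂ)) • v := by
  rw [complexRootSpace, Submodule.mem_iInf]
  exact forall_congr' fun A => Module.End.mem_eigenspace_iff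

/-- An operator of weight `γ` shifts the root spaces by `γ`. -/
theorem apply_mem_complexRootSpace {β γ : 𝔞} {e : Module.End ℂ (ℂ ⊗[ℝ] L)}
    (he : ∀ A : 𝔞, ⁅adC D A, e⁆ = (Complex.I * (⟪γ, A⟫_ℝ : ℂ)) • e) {v : ℂ ⊗[ℝ] L}
    (hv : v ∈ D.complexRootSpace β) : e v ∈ D.complexRootSpace (β + γ) := by
  refine mem_complexRootSpace.2 fun A => ?_
  have h1 := congrArg (fun T : Module.End ℂ (ℂ ⊗[ℝ] L) => T v) (he A)
  simp only [Ring.lie_def, LinearMap.sub_apply, Module.End.mul_apply, LinearMap.smul_apply] at h1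
  rw [mem_complexRootSpace.1 hv A, map_smul, sub_eq_iff_eq_add] at h1
  rw [h1, ← add_smul, inner_add_left]
  congr 1
  push_cast
  ring

theorem pow_apply_mem_complexRootSpace {β γ : 𝔞} {e : Module.End ℂ (ℂ ⊗[ℝ] L)}
    (he : ∀ A : 𝔞, ⁅adC D A, e⁆ = (Complex.I * (⟪γ, A⟫_ℝ : ℂ)) • e) {v : ℂ ⊗[ℝ] L}
    (hv : v ∈ D.complexRootSpace β) (n : ℕ) : (e ^ n) v ∈ D.complexRootSpace (β + (n : ℝ) • γ) := by
  induction n with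
  | zero => simpa using hv
  | succ n ih =>
    rw [pow_succ', Module.End.mul_apply]
    have := apply_mem_complexRootSpace he ih
    rwa [add_assoc, ← one_smul ℝ γ, smul_smul, mul_one, ← add_smul, ← Nat.cast_succ] at this

theorem end_lie_smul {M : Type*} [AddCommGroup M] [Module ℂ M] (c : ℂ) (f g : Module.End ℂ M) :
    ⁅f, c • g⁆ = c • ⁅f, g⁆ := by
  rw [Ring.lie_def, Ring.lie_def, mul_smul_comm, smul_mul_assoc, smul_sub]

theorem end_smul_lie {M : Type*} [AddCommGroup M] [Module ℂ M] (c : ℂ) (f g : Module.End ℂ M) :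
    ⁅c • f, g⁆ = c • ⁅f, g⁆ := by
  rw [Ring.lie_def, Ring.lie_def, mul_smul_comm, smul_mul_assoc, smul_sub]

/-- The `sl₂`-triple of a root. -/
theorem exists_isSl2Triple (h𝔞 : D.IsMaxAbelian 𝔞) {α : 𝔞} (hα : α ∈ D.roots 𝔞) :
    ∃ h e f : Module.End ℂ (ℂ ⊗[ℝ] L), IsSl2Triple h e f ∧
      (∀ A : 𝔞, ⁅adC D A, e⁆ = (Complex.I * (⟪α, A⟫_ℝ : ℂ)) • e) ∧
      (∀ A : 𝔞, ⁅adC D A, f⁆ = (Complex.I * (⟪-α, A⟫_ℝ : ℂ)) • f) ∧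
      ∀ β, ∀ v ∈ D.complexRootSpace β, h v = ((2 * ⟪β, α⟫_ℝ / ‖α‖ ^ 2 : ℝ) : ℂ) • v := by
  obtain ⟨X, hX, hX0⟩ := exists_mem_rootSpace_inf_m h𝔞 hα
  have hα2 : ((‖α‖ ^ 2 : ℝ) : ℂ) ≠ 0 :=
    Complex.ofReal_ne_zero.2 (pow_ne_zero _ (norm_ne_zero_iff.2 hα.1))
  have hX2 : ((‖X‖ ^ 2 : ℝ) : ℂ) ≠ 0 :=
    Complex.ofReal_ne_zero.2 (pow_ne_zero _ (norm_ne_zero_iff.2 hX0))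
  set x := adC D X with hx
  set y := adC D (D.rot α X) with hy
  set a := adC D (α : L) with ha
  set p : ℂ := ((‖α‖ ^ 2 : ℝ) : ℂ) with hp
  set q : ℂ := ((‖X‖ ^ 2 : ℝ) : ℂ) with hq
  have hxy : ⁅x, y⁆ = q • a := by
    rw [hx, hy, lie_adC, ad_rot_self h𝔞 hα.1 hX.1 hX.2, adC_smul]
  have hyx : ⁅y, x⁆ = -(q • a) := by rw [← lie_skew, hxy]
  have hAx : ∀ A : 𝔞, ⁅adC D A, x⁆ = (⟪α, A⟫_ℝ : ℂ) • y := fun A => by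
    rw [hx, hy, lie_adC, ad_eq_smul_rot hX.1, adC_smul]
  have hAy : ∀ A : 𝔞, ⁅adC D A, y⁆ = -((⟪α, A⟫_ℝ : ℂ) • x) := fun A => by
    rw [hx, hy, lie_adC, ad_rot α hα.1 hX.1, adC_neg, adC_smul]
  have he : ∀ A : 𝔞, ⁅adC D A, x - Complex.I • y⁆ =
      (Complex.I * (⟪α, A⟫_ℝ : ℂ)) • (x - Complex.I • y) := fun A => by
    rw [lie_sub, end_lie_smul, hAx, hAy]
    simp only [smul_sub, smul_neg, smul_smul]
    rw [show Complex.I * (⟪α, A⟫_ℝ : ℂ) * Complex.I = -(⟪α, A⟫_ℝ : ℂ) by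
      rw [mul_right_comm, Complex.I_mul_I, neg_one_mul], neg_smul]
    abel
  have hf : ∀ A : 𝔞, ⁅adC D A, x + Complex.I • y⁆ =
      (Complex.I * (⟪-α, A⟫_ℝ : ℂ)) • (x + Complex.I • y) := fun A => by
    rw [lie_add, end_lie_smul, hAx, hAy, inner_neg_left]
    simp only [smul_add, smul_neg, smul_smul, Complex.ofReal_neg]
    rw [show Complex.I * -(⟪α, A⟫_ℝ : ℂ) * Complex.I = (⟪α, A⟫_ℝ : ℂ) by
      rw [mul_right_comm, Complex.I_mul_I, neg_one_mul, neg_neg], mul_neg, neg_smul]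
    abel
  have hααC : (⟪α, α⟫_ℝ : ℂ) = p := by rw [real_inner_self_eq_norm_sq]
  -- On weight β the operator a is i⟨β,α⟩, so this multiple of it acts by 2⟨β,α⟩/‖α‖². Since [x -
  -- iy, x + iy] = 2iq a, the factor of f is what makes [e, f] = h.
  refine ⟨(-(2 * Complex.I) * p⁻¹) • a, x - Complex.I • y,
    (-(q⁻¹ * p⁻¹)) • (x + Complex.I • y), ⟨?_, ?_, ?_, ?_⟩, he, fun A => ?_, fun β v hv => ?_⟩
  · refine smul_ne_zero (mul_ne_zero (neg_ne_zero.2 (mul_ne_zero two_ne_zero Complex.I_ne_zero))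
      (inv_ne_zero hα2)) fun h0 => ?_
    have h1 := hAx α
    rw [← ha, h0, zero_lie, hααC] at h1
    have h2 := (smul_eq_zero.1 h1.symm).resolve_left hα2
    rw [h2, lie_zero] at hxy
    have h3 : adC D α (cplx X (-D.rot α X)) = 0 := by rw [← ha, h0, LinearMap.zero_apply]
    rw [mem_complexRootSpace.1 ((cplx_mem_complexRootSpace_iff hα.1).2 ⟨hX.1, rfl⟩) α, hααC] at h3
    have h4 := (smul_eq_zero.1 h3).resolve_left (mul_ne_zero Complex.I_ne_zero hα2)
    exact hX0 (cplx_inj (h4.trans (by simp [cplx] : (0 : ℂ ⊗[ℝ] L) = cplx 0 0))).1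
  · have hef : ⁅x - Complex.I • y, x + Complex.I • y⁆ = (2 * Complex.I * q) • a := by
      rw [lie_add, sub_lie, sub_lie, end_lie_smul, end_smul_lie, end_smul_lie, end_lie_smul,
        lie_self, lie_self, hxy, hyx]
      module
    rw [end_lie_smul, hef, smul_smul]
    congr 1
    field_simp
  · rw [end_smul_lie, he α, hααC, smul_smul, two_nsmul, ← two_smul ℂ]
    congr 1
    field_simp
    rw [Complex.I_sq]
    ring
  · rw [end_smul_lie, end_lie_smul, hf α, inner_neg_left, Complex.ofReal_neg, hααC, two_nsmul,
      ← two_smul ℂ, smul_smul, smul_smul, smul_smul, ← neg_smul]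
    congr 1
    field_simp
    rw [Complex.I_sq]
    ring
  · rw [end_lie_smul, hf A, smul_comm]
  · rw [LinearMap.smul_apply, ha, mem_complexRootSpace.1 hv α, smul_smul]
    congr 1
    push_cast [hp]
    field_simp
    rw [Complex.I_sq]
    ring

/-- The action of the `sl₂`-triple of `α` on the root space of `β`. -/
theorem exists_int_and_reflect (h𝔞 : D.IsMaxAbelian 𝔞) {α β : 𝔞} (hα : α ∈ D.roots 𝔞)
    (hβ : β ∈ D.roots 𝔞) : ∃ n : ℤ, 2 * ⟪β, α⟫_ℝ / ‖α‖ ^ 2 = n ∧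
      (0 ≤ n → D.complexRootSpace (β - (n : ℝ) • α) ≠ ⊥) := by
  obtain ⟨h, e, f, t, he, hf, hh⟩ := exists_isSl2Triple h𝔞 hα
  have hβ' : D.complexRootSpace β ≠ ⊥ := fun h0 => hβ.2 ((complexRootSpace_eq_bot_iff hβ.1).1 h0)
  obtain ⟨v, hv, hv0⟩ := (Submodule.ne_bot_iff _).1 hβ'
  -- Otherwise all the distinct vectors β + pα would be roots or zero, against finiteness.
  have hex : ∃ p : ℕ, (e ^ p) v = 0 := by
    by_contra! hne
    have hmem : ∀ p : ℕ, β + (p : ℝ) • α ∈ insert 0 (D.roots 𝔞) := fun p => by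
      by_cases h0 : β + (p : ℝ) • α = 0
      · exact Or.inl h0
      · refine Or.inr ⟨h0, fun hbot => hne p ?_⟩
        have h1 := pow_apply_mem_complexRootSpace he hv p
        rwa [(complexRootSpace_eq_bot_iff h0).2 hbot, Submodule.mem_bot] at h1
    have hinj : Function.Injective fun p : ℕ => β + (p : ℝ) • α := fun p q hpq => by
      have := smul_left_injective ℝ hα.1 (add_left_cancel hpq)
      exact_mod_cast this
    exact Set.infinite_of_injective_forall_mem hinj hmem
      ((roots_finite (D := D) (𝔞 := 𝔞)).insert 0)
  -- The last nonzero e^p v is a primitive vector, so its weight 2⟨β,α⟩/‖α‖² + 2p is a natural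
  -- number N.
  obtain ⟨p, hp, hp'⟩ := Nat.exists_not_and_succ_of_not_zero_of_exists
    (p := fun p => (e ^ p) v = 0) (by simpa using hv0) hex
  have hm := pow_apply_mem_complexRootSpace he hv p
  set m := (e ^ p) v with hmdef
  have P : t.HasPrimitiveVectorWith m ((2 * ⟪β + (p : ℝ) • α, α⟫_ℝ / ‖α‖ ^ 2 : ℝ) : ℂ) :=
    { ne_zero := hp
      lie_h := hh _ m hm
      lie_e := by
        change e ((e ^ p) v) = 0
        rw [← Module.End.mul_apply, ← pow_succ']
        exact hp' }
  obtain ⟨N, hN⟩ := P.exists_nat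
  have hα2 : ‖α‖ ^ 2 ≠ 0 := pow_ne_zero _ (norm_ne_zero_iff.2 hα.1)
  have hα1 : ‖α‖ ≠ 0 := norm_ne_zero_iff.2 hα.1
  have hN' : 2 * ⟪β, α⟫_ℝ / ‖α‖ ^ 2 + 2 * p = N := by
    have : 2 * ⟪β + (p : ℝ) • α, α⟫_ℝ / ‖α‖ ^ 2 = (N : ℝ) := by exact_mod_cast hN
    rw [← this, inner_add_left, inner_smul_left, real_inner_self_eq_norm_sq, RCLike.conj_to_real]
    field_simp
  refine ⟨N - 2 * p, by push_cast; linarith, fun hn h0 => ?_⟩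
  -- f^(N-p) does not kill the primitive vector and moves it to weight β + pα - (N-p)α = β - nα with
  -- n = N - 2p. The assumption n ≥ 0 ensures p ≤ N, so the subtraction is a true one.
  have hi : N - p ≤ N := Nat.sub_le _ _
  have h1 := P.pow_toEnd_f_ne_zero_of_eq_nat hN hi
  have h2 := pow_apply_mem_complexRootSpace hf hm (N - p)
  rw [show β + (p : ℝ) • α + ((N - p : ℕ) : ℝ) • -α = β - (((N : ℤ) - 2 * p : ℤ) : ℝ) • α by
    rw [Nat.cast_sub (by omega)]
    push_cast
    rw [smul_neg, sub_smul, sub_smul, mul_smul, two_smul]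
    abel, h0, Submodule.mem_bot] at h2
  exact h1 h2

end Sl2

theorem exists_int_eq (h𝔞 : D.IsMaxAbelian 𝔞) {α β : 𝔞} (hα : α ∈ D.roots 𝔞)
    (hβ : β ∈ D.roots 𝔞) : ∃ n : ℤ, 2 * ⟪β, α⟫_ℝ / ‖α‖ ^ 2 = n :=
  let ⟨n, hn, _⟩ := exists_int_and_reflect h𝔞 hα hβ
  ⟨n, hn⟩

/-- The string argument covers a nonnegative Cartan integer; for a negative one α is replaced by -α,
which defines the same reflection. -/
theorem reflect_mem_roots (h𝔞 : D.IsMaxAbelian 𝔞) {α β : 𝔞} (hα : α ∈ D.roots 𝔞)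
    (hβ : β ∈ D.roots 𝔞) : β - (2 * ⟪β, α⟫_ℝ / ‖α‖ ^ 2) • α ∈ D.roots 𝔞 := by
  have hne : β - (2 * ⟪β, α⟫_ℝ / ‖α‖ ^ 2) • α ≠ 0 := fun h0 => by
    have hα2 : ‖α‖ ^ 2 ≠ 0 := pow_ne_zero _ (norm_ne_zero_iff.2 hα.1)
    have h1 := congrArg (fun x => ⟪x, α⟫_ℝ) h0
    simp only [inner_sub_left, inner_smul_left, real_inner_self_eq_norm_sq, RCLike.conj_to_real,
      inner_zero_left] at h1
    rw [div_mul_cancel₀ _ hα2] at h1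
    have h2 : ⟪β, α⟫_ℝ = 0 := by linarith
    rw [h2, mul_zero, zero_div, zero_smul, sub_zero] at h0
    exact hβ.1 h0
  refine ⟨hne, fun hbot => ?_⟩
  rw [← complexRootSpace_eq_bot_iff hne] at hbot
  obtain ⟨n, hn, h⟩ := exists_int_and_reflect h𝔞 hα hβ
  rcases le_total 0 n with h0 | h0
  · exact h h0 (by rw [← hn]; exact hbot)
  · obtain ⟨n', hn', h'⟩ := exists_int_and_reflect h𝔞 (neg_mem_roots hα) hβ
    have e : (n' : ℝ) = -n := by
      rw [← hn, ← hn', inner_neg_right, norm_neg]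
      ring
    refine h' (by have : n' = -n := by exact_mod_cast e
                  omega) ?_
    rw [e, neg_smul_neg, ← hn]
    exact hbot

end SymmetricLie

/-! ### From infinitesimal invariance to invariance under a connected group. -/

namespace IsotropyRep

open SymmetricLie

variable {L K : Type*} [NormedAddCommGroup L] [InnerProductSpace ℝ L] [FiniteDimensional ℝ L]
  [Group K] [TopologicalSpace K] {D : SymmetricLie L} (R : IsotropyRep D K)

/-- A subspace which is invariant under the fixed algebra is invariant under the group elements in
the image of the parametrization. -/
theorem chart_mem_of_forall_ad_mem {𝔫 : Submodule ℝ L}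
    (h : ∀ z, D.θ z = z → ∀ X ∈ 𝔫, D.ad z X ∈ 𝔫) {v : L} (hv : ‖v‖ < R.radius)
    (hvθ : D.θ v = v) {X : L} (hX : X ∈ 𝔫) : R.chart v X ∈ 𝔫 := by
  set P : L →L[ℝ] L := 𝔫.starProjection with hP
  set Q : L →L[ℝ] L := 𝔫ᗮ.starProjection with hQ
  have hball : ∀ t ∈ Icc (0 : ℝ) 1, t • v ∈ Metric.ball (0 : L) R.radius := fun t ht => by
    rw [mem_ball_zero_iff, norm_smul, Real.norm_of_nonneg ht.1]
    exact (mul_le_of_le_one_left (norm_nonneg _) ht.2).trans_lt hv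
  have hfix : ∀ t : ℝ, D.θ (t • v) = t • v := fun t => by rw [map_smul, hvθ]
  -- The block Q ∘ chart(tv) ∘ P measures how far the chart leaves 𝔫. Its derivative is the same
  -- block applied after ad(z), which preserves 𝔫; so the derivative is bounded by a multiple of the
  -- block, which vanishes at t = 0 and hence throughout.
  have hder : ∀ t ∈ Icc (0 : ℝ) 1, HasDerivAt (fun t : ℝ => Q.comp ((R.chart (t • v)).comp P))
      (Q.comp ((fderiv ℝ R.chart (t • v) v).comp P)) t := fun t ht => by
    have h1 : HasFDerivAt R.chart (fderiv ℝ R.chart (t • v)) (t • v) :=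
      ((R.contDiffOn_chart.contDiffAt (Metric.isOpen_ball.mem_nhds (hball t ht))).differentiableAt
        (by simp)).hasFDerivAt
    have h2 : HasDerivAt (fun t : ℝ => t • v) v t := by
      simpa using (hasDerivAt_id t).smul_const v
    have h3 : HasDerivAt (fun t : ℝ => R.chart (t • v)) (fderiv ℝ R.chart (t • v) v) t :=
      HasFDerivAt.comp_hasDerivAt (f := fun t : ℝ => t • v) t h1 h2
    have h4 := h3.clm_comp (hasDerivAt_const t P)
    have h5 := (hasDerivAt_const t Q).clm_comp h4
    simpa using h5
  have hcont : ContinuousOn (fun t : ℝ => fderiv ℝ R.chart (t • v) v) (Icc 0 1) := by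
    have h1 : ContinuousOn (fderiv ℝ R.chart) (Metric.ball 0 R.radius) :=
      R.contDiffOn_chart.continuousOn_fderiv_of_isOpen Metric.isOpen_ball (by simp)
    exact (h1.comp (continuous_id.smul continuous_const).continuousOn hball).clm_apply
      continuousOn_const
  obtain ⟨C, hC⟩ := isCompact_Icc.exists_bound_of_continuousOn hcont
  have hbound : ∀ t ∈ Ico (0 : ℝ) 1, ‖Q.comp ((fderiv ℝ R.chart (t • v) v).comp P)‖ ≤
      C * ‖Q.comp ((R.chart (t • v)).comp P)‖ := fun t ht => by
    have ht' : t ∈ Icc (0 : ℝ) 1 := ⟨ht.1, ht.2.le⟩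
    have hC0 : 0 ≤ C := (norm_nonneg _).trans (hC t ht')
    refine ContinuousLinearMap.opNorm_le_bound _ (mul_nonneg hC0 (norm_nonneg _)) fun Y => ?_
    obtain ⟨z, hz, hz'⟩ := R.fderiv_chart _ (hball t ht') v (hfix t) hvθ
    obtain ⟨k, hk⟩ := R.chart_mem _ (hball t ht') (hfix t)
    have h1 : D.ad z (P Y) ∈ 𝔫 := h z hz _ (𝔫.starProjection_apply_mem Y)
    have h2 : P (D.ad z (P Y)) = D.ad z (P Y) := Submodule.starProjection_eq_self_iff.2 h1
    have h3 : Q.comp ((fderiv ℝ R.chart (t • v) v).comp P) Y =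
        Q.comp ((R.chart (t • v)).comp P) (D.ad z (P Y)) := by
      simp only [ContinuousLinearMap.comp_apply]
      rw [hz', h2]
    -- There is no direct control of z; but chart(tv) is an isometry, so [z, PY] has the norm of the
    -- derivative of the chart applied to PY.
    have h4 : ‖D.ad z (P Y)‖ ≤ C * ‖Y‖ := by
      rw [← R.norm_ρ k, hk, ← hz']
      refine (ContinuousLinearMap.le_opNorm _ _).trans ?_
      exact mul_le_mul (hC t ht') (𝔫.norm_starProjection_apply_le Y) (norm_nonneg _) hC0
    rw [h3]
    refine (ContinuousLinearMap.le_opNorm _ _).trans ?_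
    calc _ ≤ ‖Q.comp ((R.chart (t • v)).comp P)‖ * (C * ‖Y‖) :=
          mul_le_mul_of_nonneg_left h4 (norm_nonneg _)
      _ = _ := by ring
  have hzero : ∀ Y, Q (P Y) = 0 := fun Y => by
    have h1 : P Y ∈ 𝔫ᗮᗮ := Submodule.le_orthogonal_orthogonal 𝔫 (𝔫.starProjection_apply_mem Y)
    exact (Submodule.starProjection_apply_eq_zero_iff _).2 h1
  have key := eq_zero_of_abs_deriv_le_mul_abs_self_of_eq_zero_right
    (f := fun t : ℝ => Q.comp ((R.chart (t • v)).comp P)) (fun t ht => (hder t ht).continuousAt.continuousWithinAt)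
    (fun t ht => (hder t ⟨ht.1, ht.2.le⟩).hasDerivWithinAt) (by
      ext1 Y
      simp only [zero_smul, R.chart_zero]
      exact hzero Y) hbound 1 ⟨zero_le_one, le_rfl⟩
  have h1 := congrArg (fun T : L →L[ℝ] L => T X) key
  simp only [one_smul, ContinuousLinearMap.comp_apply] at h1
  rw [Submodule.starProjection_eq_self_iff.2 hX] at h1
  have h2 := (Submodule.starProjection_apply_eq_zero_iff _).1 h1
  rwa [Submodule.orthogonal_orthogonal] at h2

/-- For a connected group, a subspace which is invariant under the fixed algebra is invariant. -/
theorem ρ_mem_of_forall_ad_mem [IsTopologicalGroup K] [ConnectedSpace K] {𝔫 : Submodule ℝ L}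
    (h : ∀ z, D.θ z = z → ∀ X ∈ 𝔫, D.ad z X ∈ 𝔫) (k : K) {X : L} (hX : X ∈ 𝔫) :
    R.ρ k X ∈ 𝔫 := by
  -- The stabilizer of 𝔫 contains a neighbourhood of 1, so it is open, hence closed, hence
  -- everything. The equivalence in its definition provides closure under inverses.
  let S : Subgroup K :=
    { carrier := {k | ∀ X, R.ρ k X ∈ 𝔫 ↔ X ∈ 𝔫}
      one_mem' := fun X => by rw [map_one]; rfl
      mul_mem' := fun {k l} hk hl X => by
        rw [map_mul]
        exact (hk _).trans (hl X)
      inv_mem' := fun {k} hk X => by rw [← hk, R.ρ_apply_inv] }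
  have hev : ∀ᶠ k in nhds (1 : K), ∀ X ∈ 𝔫, R.ρ k X ∈ 𝔫 := by
    filter_upwards [R.chart_cover R.radius R.radius_pos] with k hk X hX
    obtain ⟨v, hv, hvθ, hvk⟩ := hk
    rw [hvk]
    exact R.chart_mem_of_forall_ad_mem h hv hvθ hX
  have hinv : ∀ᶠ k in nhds (1 : K), ∀ X ∈ 𝔫, R.ρ k⁻¹ X ∈ 𝔫 := by
    have := (continuous_inv (G := K)).tendsto 1
    rw [inv_one] at this
    exact this.eventually hev
  have hS : (S : Set K) ∈ nhds (1 : K) := by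
    filter_upwards [hev, hinv] with k h1 h2 X
    refine ⟨fun h3 => ?_, h1 X⟩
    rw [← R.ρ_inv_apply k X]
    exact h2 _ h3
  have hopen : IsOpen (S : Set K) := S.isOpen_of_mem_nhds hS
  have huniv := IsClopen.eq_univ ⟨S.isClosed_of_isOpen hopen, hopen⟩ ⟨1, S.one_mem⟩
  have hk : k ∈ (S : Set K) := huniv ▸ mem_univ k
  exact (hk X).2 hX

end IsotropyRep

/-! ### Irreducibility of the restricted root system. -/

namespace SymmetricLie

variable {L : Type*} [NormedAddCommGroup L] [InnerProductSpace ℝ L] {D : SymmetricLie L}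
  {𝔞 : Submodule ℝ L} [FiniteDimensional ℝ L]

/-- Every ideal contains `𝔪` or has trivial intersection with it. -/
def IsIrreducible (D : SymmetricLie L) : Prop :=
  ∀ 𝔫 : Submodule ℝ L, (∀ X, ∀ Y ∈ 𝔫, D.ad X Y ∈ 𝔫) → 𝔫 ⊓ D.m = ⊥ ∨ D.m ≤ 𝔫

/-- The centralizer of a set. -/
def centralizer (D : SymmetricLie L) (s : Set L) : Submodule ℝ L where
  carrier := {X | ∀ Y ∈ s, D.ad X Y = 0}
  add_mem' {X X'} hX hX' Y hY := by rw [map_add, LinearMap.add_apply, hX Y hY, hX' Y hY, add_zero]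
  zero_mem' Y _ := by simp
  smul_mem' c X hX Y hY := by rw [map_smul, LinearMap.smul_apply, hX Y hY, smul_zero]

/-- A root does not centralize its root space. -/
theorem exists_ad_ne_zero {α : 𝔞} (hα : α ∈ D.roots 𝔞) : ∃ X ∈ D.rootSpace α, D.ad α X ≠ 0 := by
  obtain ⟨X, hX, hX0⟩ := (Submodule.ne_bot_iff _).1 hα.2
  refine ⟨X, hX, fun h => hX0 ?_⟩
  have := norm_rot hα.1 hX
  rw [rot_apply, h, smul_zero, norm_zero] at this
  exact norm_eq_zero.1 this.symm

/-- The roots span `𝔞`. -/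
theorem IsIrreducible.eq_zero_of_forall_inner (hD : D.IsIrreducible) (h𝔞 : D.IsMaxAbelian 𝔞)
    (hne : (D.roots 𝔞).Nonempty) {A : 𝔞} (hA : ∀ α ∈ D.roots 𝔞, ⟪α, A⟫_ℝ = 0) : A = 0 := by
  -- A vector orthogonal to all roots is central. The centre is an ideal and does not contain 𝔪, so
  -- it meets 𝔪 trivially.
  have h1 : (A : L) ∈ D.centralizer univ := fun X _ =>
    h𝔞.ad_eq_zero_of_ad_eq_zero (A := 0) (fun β hβ _ => hA β hβ) (by simp)
  have hideal : ∀ X, ∀ Y ∈ D.centralizer univ, D.ad X Y ∈ D.centralizer univ := fun X Y hY => by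
    rw [D.ad_swap, hY X (mem_univ X), neg_zero]
    exact zero_mem _
  rcases hD _ hideal with h | h
  · have h2 : (A : L) ∈ D.centralizer univ ⊓ D.m := ⟨h1, h𝔞.le_m A.2⟩
    rw [h] at h2
    exact Subtype.ext h2
  · obtain ⟨α, hα⟩ := hne
    obtain ⟨X, -, hX⟩ := exists_ad_ne_zero hα
    exact (hX (h (h𝔞.le_m α.2) X (mem_univ X))).elim

theorem ad_mem_rootSpace_of_mem_zero {α : 𝔞} {Z Y : L}
    (hZ : Z ∈ D.rootSpace (0 : 𝔞)) (hY : Y ∈ D.rootSpace α) : D.ad Z Y ∈ D.rootSpace α := by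
  have hc : ∀ (A : 𝔞) (W : L), D.ad A (D.ad Z W) = D.ad Z (D.ad A W) := fun A W => by
    have := D.jacobi A Z W
    rw [mem_rootSpace_zero.1 hZ A A.2, map_zero, LinearMap.zero_apply] at this
    exact sub_eq_zero.1 this.symm
  intro A B
  rw [hc, hc, hY A B, map_smul]

/-- Root vectors of `α` and `β` commute if `α + β` and `α - β` are neither roots nor zero. -/
theorem ad_eq_zero_of_rootSpace_eq_bot {α β : 𝔞} (hα : α ≠ 0) (hβ : β ≠ 0)
    (h1 : D.rootSpace (β + α) = ⊥) (h2 : D.rootSpace (β - α) = ⊥) {Z Y : L}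
    (hZ : Z ∈ D.rootSpace β) (hY : Y ∈ D.rootSpace α) : D.ad Z Y = 0 := by
  set Z' := D.rot β Z with hZ'
  set Y' := D.rot α Y with hY'
  have hleib : ∀ (A : 𝔞) (U V : L), D.ad A (D.ad U V) = D.ad (D.ad A U) V + D.ad U (D.ad A V) :=
    fun A U V => by rw [D.jacobi]; abel
  have aZ : ∀ A : 𝔞, D.ad A Z = ⟪β, A⟫_ℝ • Z' := fun A => ad_eq_smul_rot hZ A
  have aY : ∀ A : 𝔞, D.ad A Y = ⟪α, A⟫_ℝ • Y' := fun A => ad_eq_smul_rot hY A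
  have aZ' : ∀ A : 𝔞, D.ad A Z' = -(⟪β, A⟫_ℝ • Z) := fun A => ad_rot β hβ hZ A
  have aY' : ∀ A : 𝔞, D.ad A Y' = -(⟪α, A⟫_ℝ • Y) := fun A => ad_rot α hα hY A
  have e1 : D.ad Z Y - D.ad Z' Y' ∈ D.rootSpace (β + α) := fun A B => by
    simp only [map_sub, hleib, aZ, aY, aZ', aY', map_add, map_smul, map_neg, LinearMap.smul_apply,
      LinearMap.neg_apply, inner_add_left]
    module
  have e2 : D.ad Z Y + D.ad Z' Y' ∈ D.rootSpace (β - α) := fun A B => by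
    simp only [map_add, hleib, aZ, aY, aZ', aY', map_smul, map_neg, LinearMap.smul_apply,
      LinearMap.neg_apply, inner_sub_left]
    module
  rw [h1, Submodule.mem_bot] at e1
  rw [h2, Submodule.mem_bot] at e2
  have e3 : (2 : ℝ) • D.ad Z Y = (D.ad Z Y - D.ad Z' Y') + (D.ad Z Y + D.ad Z' Y') := by module
  rw [e1, e2, add_zero] at e3
  exact (smul_eq_zero.1 e3).resolve_left two_ne_zero

/-- The root system is irreducible. -/
theorem IsIrreducible.roots_irreducible (hD : D.IsIrreducible) (h𝔞 : D.IsMaxAbelian 𝔞)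
    {S : Set 𝔞} (hS : S ⊆ D.roots 𝔞) (hne : S.Nonempty)
    (horth : ∀ α ∈ S, ∀ β ∈ D.roots 𝔞, β ∉ S → ⟪α, β⟫_ℝ = 0) : S = D.roots 𝔞 := by
  refine hS.antisymm fun β hβ => ?_
  by_contra hβS
  set T : Set L := {Y | ∃ α ∈ S, Y ∈ D.rootSpace α} with hT
  -- A root γ + α would be non-orthogonal to α, hence in S, hence orthogonal to γ; but ⟨γ + α, γ⟩ =
  -- ‖γ‖².
  have hbot : ∀ α ∈ S, ∀ γ ∈ D.roots 𝔞, γ ∉ S → D.rootSpace (γ + α) = ⊥ := fun α hα γ hγ hγS => by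
    have hαγ := horth α hα γ hγ hγS
    have hα0 := (hS hα).1
    have hγ0 := hγ.1
    by_contra hne
    have hαα : ⟪α, γ + α⟫_ℝ ≠ 0 := by
      rw [inner_add_right, hαγ, zero_add]
      exact inner_self_ne_zero.2 hα0
    have hr : γ + α ∈ D.roots 𝔞 := ⟨fun h0 => hαα (by rw [h0, inner_zero_right]), hne⟩
    by_cases hmem : γ + α ∈ S
    · have := horth _ hmem γ hγ hγS
      rw [inner_add_left, hαγ, add_zero] at this
      exact hγ0 (inner_self_eq_zero.1 this)
    · exact hαα (horth α hα _ hr hmem)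
  have hneg : ∀ α ∈ S, -α ∈ S := fun α hα => by
    by_contra h
    have := horth α hα (-α) (neg_mem_roots (hS hα)) h
    rw [inner_neg_right, neg_eq_zero, inner_self_eq_zero] at this
    exact (hS hα).1 this
  -- By Jacobi it remains to see [X, [Z, Y]] = 0, which may be checked for Z in a root space: weight
  -- 0 preserves the root spaces, weights in S follow from Jacobi, and weights outside S commute
  -- with Y.
  have hideal : ∀ Z, ∀ X ∈ D.centralizer T, D.ad Z X ∈ D.centralizer T := by
    intro Z X hX
    rintro Y ⟨α, hα, hY⟩
    have hXY := hX Y ⟨α, hα, hY⟩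
    rw [D.jacobi, hXY, map_zero, zero_sub, neg_eq_zero]
    have : (⊤ : Submodule ℝ L) ≤ LinearMap.ker (D.ad X ∘ₗ D.ad.flip Y) := by
      rw [← h𝔞.iSup_rootSpace]
      refine iSup_le fun γ Z hZ => ?_
      change D.ad X (D.ad Z Y) = 0
      by_cases hγ0 : γ = 0
      · rw [hγ0] at hZ
        exact hX _ ⟨α, hα, ad_mem_rootSpace_of_mem_zero hZ hY⟩
      by_cases hγ : γ ∈ D.roots 𝔞
      · by_cases hγS : γ ∈ S
        · have h1 := D.jacobi X Z Y
          rw [hX Z ⟨γ, hγS, hZ⟩, hXY, map_zero, map_zero, LinearMap.zero_apply, sub_zero] at h1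
          exact h1.symm
        · rw [ad_eq_zero_of_rootSpace_eq_bot (hS hα).1 hγ0 (hbot α hα γ hγ hγS) (by
            rw [sub_eq_add_neg]
            exact hbot _ (hneg α hα) γ hγ hγS) hZ hY, map_zero]
      · have hb : D.rootSpace γ = ⊥ := by
          by_contra h
          exact hγ ⟨hγ0, h⟩
        rw [hb, Submodule.mem_bot] at hZ
        rw [hZ, map_zero, LinearMap.zero_apply, map_zero]
    exact this (Submodule.mem_top (x := Z))
  -- The ideal contains β ∈ 𝔪, so it does not meet 𝔪 trivially; and it does not contain 𝔪, as α ∈ S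
  -- does not centralize its own root space.
  rcases hD _ hideal with h | h
  · have h1 : (β : L) ∈ D.centralizer T ⊓ D.m := by
      refine ⟨?_, h𝔞.le_m β.2⟩
      rintro Y ⟨α, hα, hY⟩
      rw [ad_eq_smul_rot hY, horth α hα β hβ hβS, zero_smul]
    rw [h] at h1
    exact hβ.1 (Subtype.ext h1)
  · obtain ⟨α, hα⟩ := hne
    obtain ⟨X, hX, hX'⟩ := exists_ad_ne_zero (hS hα)
    exact hX' (h (h𝔞.le_m α.2) X ⟨α, hα, hX⟩)

end SymmetricLie

/-! ### Non-reduced irreducible root systems are of type BC. -/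

/-- An irreducible (crystallographic, not necessarily reduced) root system in a Euclidean space. -/
structure IsIrreducibleRootSet {E : Type*} [NormedAddCommGroup E] [InnerProductSpace ℝ E]
    (R : Set E) : Prop where
  finite : R.Finite
  ne_zero : ∀ α ∈ R, α ≠ 0
  integral : ∀ α ∈ R, ∀ β ∈ R, ∃ n : ℤ, 2 * ⟪β, α⟫_ℝ / ‖α‖ ^ 2 = n
  reflect : ∀ α ∈ R, ∀ β ∈ R, β - (2 * ⟪β, α⟫_ℝ / ‖α‖ ^ 2) • α ∈ R
  span : ∀ A : E, (∀ α ∈ R, ⟪α, A⟫_ℝ = 0) → A = 0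
  irreducible : ∀ S ⊆ R, S.Nonempty → (∀ α ∈ S, ∀ β ∈ R, β ∉ S → ⟪α, β⟫_ℝ = 0) → S = R

namespace IsIrreducibleRootSet

variable {E : Type*} [NormedAddCommGroup E] [InnerProductSpace ℝ E] {R : Set E}
  (hR : IsIrreducibleRootSet R)

include hR

theorem norm_sq_ne_zero {α : E} (hα : α ∈ R) : ‖α‖ ^ 2 ≠ 0 :=
  pow_ne_zero _ (norm_ne_zero_iff.2 (hR.ne_zero α hα))

theorem reflect_mem {α β : E} (hα : α ∈ R) (hβ : β ∈ R) {n : ℝ}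
    (h : 2 * ⟪β, α⟫_ℝ = n * ‖α‖ ^ 2) : β - n • α ∈ R := by
  have := hR.reflect α hα β hβ
  rwa [h, mul_div_cancel_right₀ _ (hR.norm_sq_ne_zero hα)] at this

theorem exists_int {α β : E} (hα : α ∈ R) (hβ : β ∈ R) :
    ∃ n : ℤ, 2 * ⟪β, α⟫_ℝ = n * ‖α‖ ^ 2 := by
  obtain ⟨n, hn⟩ := hR.integral α hα β hβ
  exact ⟨n, (div_eq_iff (hR.norm_sq_ne_zero hα)).1 hn⟩

theorem neg_mem {α : E} (hα : α ∈ R) : -α ∈ R := by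
  have := hR.reflect_mem hα hα (n := 2) (by rw [real_inner_self_eq_norm_sq])
  rwa [two_smul, sub_add_cancel_left] at this

theorem sign_smul_mem {α : E} (hα : α ∈ R) {s : ℝ} (hs : s = 1 ∨ s = -1) : s • α ∈ R := by
  rcases hs with rfl | rfl
  · rwa [one_smul]
  · rw [neg_one_smul]; exact hR.neg_mem hα

theorem exists_int_of_two_smul {α β : E} (h2α : (2 : ℝ) • α ∈ R) (hβ : β ∈ R) :
    ∃ k : ℤ, ⟪β, α⟫_ℝ = k * ‖α‖ ^ 2 := by
  obtain ⟨k, hk⟩ := hR.exists_int h2α hβ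
  refine ⟨k, ?_⟩
  rw [inner_smul_right, norm_smul, mul_pow, Real.norm_of_nonneg zero_le_two] at hk
  linarith

/-- Parallel roots of a reduced root system are equal or opposite. -/
theorem eq_or_eq_neg_of_parallel (hred : ¬ ∃ α ∈ R, (2 : ℝ) • α ∈ R) {α β : E} (hα : α ∈ R)
    (hβ : β ∈ R) (h : ∃ c : ℝ, β = c • α) : β = α ∨ β = -α := by
  obtain ⟨c, rfl⟩ := h
  obtain ⟨n, hn⟩ := hR.exists_int hα hβ
  obtain ⟨m, hm⟩ := hR.exists_int hβ hα
  have hα2 := hR.norm_sq_ne_zero hα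
  have hc : c ≠ 0 := fun h0 => hR.ne_zero _ hβ (by rw [h0, zero_smul])
  rw [inner_smul_left, RCLike.conj_to_real, real_inner_self_eq_norm_sq] at hn
  rw [inner_smul_right, real_inner_self_eq_norm_sq, norm_smul, mul_pow, Real.norm_eq_abs,
    sq_abs] at hm
  have e1 : (n : ℝ) = 2 * c := mul_right_cancel₀ hα2 (by linarith)
  have e2 : (m : ℝ) * c = 2 := mul_right_cancel₀ (mul_ne_zero hc hα2) (by linarith)
  -- The Cartan integers of α and cα are 2c and 2/c. As 2c divides 4, c is one of ±1/2, ±1, ±2, and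
  -- all but ±1 exhibit a root whose double is a root.
  have e3 : n * m = 4 := by
    have : (n : ℝ) * m = 4 := by rw [e1]; linear_combination 2 * e2
    exact_mod_cast this
  have hn4 : n ∣ 4 := ⟨m, e3.symm⟩
  have hle : n ≤ 4 := Int.le_of_dvd (by norm_num) hn4
  have hge : -4 ≤ n := by
    have := Int.le_of_dvd (by norm_num) ((neg_dvd).2 hn4)
    omega
  have hcn : c = n / 2 := by rw [e1]; ring
  have hhalf : ∀ {s : ℝ}, (s = 1 ∨ s = -1) → c = s * 2 → False := fun {s} hs h => by
    refine hred ⟨α, hα, ?_⟩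
    rcases hs with rfl | rfl
    · rwa [h, one_mul] at hβ
    · rw [h, neg_one_mul, neg_smul] at hβ
      simpa using hR.neg_mem hβ
  have hhalf' : ∀ {s : ℝ}, (s = 1 ∨ s = -1) → c = s * 2⁻¹ → False := fun {s} hs h => by
    refine hred ⟨_, hβ, ?_⟩
    rw [smul_smul, h, mul_left_comm, mul_inv_cancel₀ two_ne_zero, mul_one]
    exact hR.sign_smul_mem hα hs
  interval_cases n
  · exact (hhalf (Or.inr rfl) (by rw [hcn]; norm_num)).elim
  · omega
  · right; rw [hcn]; norm_num
  · exact (hhalf' (Or.inr rfl) (by rw [hcn]; norm_num)).elim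
  · omega
  · exact (hhalf' (Or.inl rfl) (by rw [hcn]; norm_num)).elim
  · left; rw [hcn]; norm_num
  · omega
  · exact (hhalf (Or.inl rfl) (by rw [hcn]; norm_num)).elim

/-- Roots whose doubles are roots are equal, opposite or orthogonal. -/
theorem double_trichotomy {α γ : E} (hα : α ∈ R) (h2α : (2 : ℝ) • α ∈ R) (hγ : γ ∈ R)
    (h2γ : (2 : ℝ) • γ ∈ R) : ⟪γ, α⟫_ℝ = 0 ∨ γ = α ∨ γ = -α := by
  obtain ⟨k, hk⟩ := hR.exists_int_of_two_smul h2α hγ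
  obtain ⟨k', hk'⟩ := hR.exists_int_of_two_smul h2γ hα
  by_cases h0 : ⟪γ, α⟫_ℝ = 0
  · exact Or.inl h0
  right
  have hα2 : 0 < ‖α‖ ^ 2 := lt_of_le_of_ne (sq_nonneg _) (hR.norm_sq_ne_zero hα).symm
  have hγ2 : 0 < ‖γ‖ ^ 2 := lt_of_le_of_ne (sq_nonneg _) (hR.norm_sq_ne_zero hγ).symm
  rw [real_inner_comm] at hk'
  have hcs : ⟪γ, α⟫_ℝ * ⟪γ, α⟫_ℝ ≤ ‖γ‖ ^ 2 * ‖α‖ ^ 2 := by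
    have := real_inner_mul_inner_self_le γ α
    rwa [real_inner_self_eq_norm_sq, real_inner_self_eq_norm_sq] at this
  -- As 2α and 2γ are roots, ⟨γ,α⟩ is an integral multiple of both ‖α‖² and ‖γ‖²; Cauchy–Schwarz
  -- then leaves k k' = 1, the case of equality.
  have hprod : ⟪γ, α⟫_ℝ * ⟪γ, α⟫_ℝ = (k * k' : ℝ) * (‖γ‖ ^ 2 * ‖α‖ ^ 2) := by
    nth_rewrite 1 [hk]
    rw [hk']
    ring
  have hpos : 0 < ⟪γ, α⟫_ℝ * ⟪γ, α⟫_ℝ := mul_self_pos.2 h0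
  have h1 : (0 : ℝ) < k * k' := by
    by_contra hneg
    have := mul_nonpos_of_nonpos_of_nonneg (not_lt.1 hneg) (mul_pos hγ2 hα2).le
    linarith
  have h2 : (k * k' : ℝ) ≤ 1 := by
    by_contra hgt
    have := mul_lt_mul_of_pos_right (not_le.1 hgt) (mul_pos hγ2 hα2)
    linarith
  have h3 : k * k' = 1 := by
    have a : 0 < k * k' := by exact_mod_cast h1
    have b : k * k' ≤ 1 := by exact_mod_cast h2
    omega
  rcases Int.mul_eq_one_iff_eq_one_or_neg_one.1 h3 with ⟨rfl, rfl⟩ | ⟨rfl, rfl⟩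
  · left
    rw [← sub_eq_zero, ← norm_eq_zero, ← sq_eq_zero_iff, norm_sub_sq_real]
    push_cast at hk hk'
    linarith
  · right
    rw [← sub_eq_zero, sub_neg_eq_add, ← norm_eq_zero, ← sq_eq_zero_iff, norm_add_sq_real]
    push_cast at hk hk'
    linarith

/-- The roots which are not orthogonal to a root `α` whose double is a root. -/
theorem eq_of_inner_double_ne_zero {α β : E} (hα : α ∈ R) (h2α : (2 : ℝ) • α ∈ R) (hβ : β ∈ R)
    (h0 : ⟪β, α⟫_ℝ ≠ 0) :
    (∃ s : ℝ, (s = 1 ∨ s = -1 ∨ s = 2 ∨ s = -2) ∧ β = s • α) ∨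
      ∃ γ ∈ R, (2 : ℝ) • γ ∈ R ∧ ⟪γ, α⟫_ℝ = 0 ∧ ‖γ‖ ^ 2 = ‖α‖ ^ 2 ∧
        ∃ j : ℝ, (j = 1 ∨ j = -1) ∧ β = j • (α - γ) := by
  obtain ⟨k, hk⟩ := hR.exists_int_of_two_smul h2α hβ
  obtain ⟨j, hj⟩ := hR.exists_int hβ hα
  rw [real_inner_comm] at hj
  have hα2 : 0 < ‖α‖ ^ 2 := lt_of_le_of_ne (sq_nonneg _) (hR.norm_sq_ne_zero hα).symm
  have hβ2 : 0 < ‖β‖ ^ 2 := lt_of_le_of_ne (sq_nonneg _) (hR.norm_sq_ne_zero hβ).symm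
  have hcs : ⟪β, α⟫_ℝ * ⟪β, α⟫_ℝ ≤ ‖β‖ ^ 2 * ‖α‖ ^ 2 := by
    have := real_inner_mul_inner_self_le β α
    rwa [real_inner_self_eq_norm_sq, real_inner_self_eq_norm_sq] at this
  have hprod : 2 * (⟪β, α⟫_ℝ * ⟪β, α⟫_ℝ) = (j * k : ℝ) * (‖β‖ ^ 2 * ‖α‖ ^ 2) := by
    nth_rewrite 2 [hk]
    rw [← mul_assoc, hj]
    ring
  have hpos : 0 < ⟪β, α⟫_ℝ * ⟪β, α⟫_ℝ := mul_self_pos.2 h0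
  have h1 : (0 : ℝ) < j * k := by
    by_contra hneg
    have := mul_nonpos_of_nonpos_of_nonneg (not_lt.1 hneg) (mul_pos hβ2 hα2).le
    linarith
  have h2 : (j * k : ℝ) ≤ 2 := by
    by_contra hgt
    have := mul_lt_mul_of_pos_right (not_le.1 hgt) (mul_pos hβ2 hα2)
    linarith
  have h3 : j * k = 1 ∨ j * k = 2 := by
    have a : 0 < j * k := by exact_mod_cast h1
    have b : j * k ≤ 2 := by exact_mod_cast h2
    omega
  -- For jk = 1 one has ‖β‖² = 2‖α‖², and γ is the reflection of α in β, whose double is the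
  -- reflection of 2α. For jk = 2 equality holds in Cauchy–Schwarz and β = kα.
  rcases h3 with h3 | h3
  · right
    have hjk : (j : ℝ) * k = 1 := by exact_mod_cast h3
    have hj1 : (j : ℝ) = 1 ∨ (j : ℝ) = -1 := by
      rcases Int.mul_eq_one_iff_eq_one_or_neg_one.1 h3 with ⟨rfl, -⟩ | ⟨rfl, -⟩
      · left; norm_num
      · right; norm_num
    have hjj : (j : ℝ) * j = 1 := by rcases hj1 with h | h <;> rw [h] <;> norm_num
    have hββ : ‖β‖ ^ 2 = 2 * ‖α‖ ^ 2 := by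
      rw [hk] at hj
      linear_combination (-(j : ℝ)) * hj + 2 * ‖α‖ ^ 2 * hjk - ‖β‖ ^ 2 * hjj
    have hγα : ⟪α - (j : ℝ) • β, α⟫_ℝ = 0 := by
      rw [inner_sub_left, inner_smul_left, RCLike.conj_to_real, real_inner_self_eq_norm_sq, hk]
      linear_combination (-‖α‖ ^ 2) * hjk
    refine ⟨α - (j : ℝ) • β, ?_, ?_, hγα, ?_, j, hj1, ?_⟩
    · exact hR.reflect_mem hβ hα (by rw [real_inner_comm]; exact hj)
    · rw [smul_sub, smul_smul]
      refine hR.reflect_mem hβ h2α ?_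
      rw [inner_smul_left, RCLike.conj_to_real, real_inner_comm, hj]
      ring
    · rw [norm_sub_sq_real, norm_smul, mul_pow, Real.norm_eq_abs, sq_abs, inner_smul_right,
        real_inner_comm, hββ, hk]
      linear_combination (2 * ‖α‖ ^ 2) * hjj - 2 * ‖α‖ ^ 2 * hjk
    · rw [sub_sub_cancel, smul_smul, hjj, one_smul]
  · left
    have hjk : (j : ℝ) * k = 2 := by exact_mod_cast h3
    refine ⟨k, ?_, ?_⟩
    · have hk2 : k ∣ 2 := ⟨j, by rw [mul_comm]; exact h3.symm⟩
      have hle : k ≤ 2 := Int.le_of_dvd (by norm_num) hk2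
      have hge : -2 ≤ k := by
        have := Int.le_of_dvd (by norm_num) ((neg_dvd).2 hk2)
        omega
      interval_cases k
      · norm_num
      · norm_num
      · omega
      · norm_num
      · norm_num
    · rw [← sub_eq_zero, ← norm_eq_zero, ← sq_eq_zero_iff, norm_sub_sq_real, norm_smul, mul_pow,
        Real.norm_eq_abs, sq_abs, inner_smul_right, hk]
      rw [hk] at hj
      have hk0 : (k : ℝ) ≠ 0 := fun h => by rw [h, mul_zero] at hjk; norm_num at hjk
      linear_combination (-(k : ℝ) / 2) * hj - ‖β‖ ^ 2 / 2 * hjk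

/-- If `α - γ` is a root for orthogonal `α`, `γ` whose doubles are roots, then `α` and `γ` have
equal norms. -/
theorem norm_sq_eq {α γ : E} (hα : α ∈ R) (h2α : (2 : ℝ) • α ∈ R) (hγ : γ ∈ R)
    (h : ⟪γ, α⟫_ℝ = 0) (hd : α - γ ∈ R) : ‖γ‖ ^ 2 = ‖α‖ ^ 2 := by
  have hα2 := hR.norm_sq_ne_zero hα
  have h1 : ⟪α - γ, α⟫_ℝ = ‖α‖ ^ 2 := by
    rw [inner_sub_left, h, real_inner_self_eq_norm_sq, sub_zero]
  rcases hR.eq_of_inner_double_ne_zero hα h2α hd (by rw [h1]; exact hα2) with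
    ⟨s, -, hs⟩ | ⟨γ', -, -, hγ', hn, j, -, hj⟩
  · have := congrArg (fun x => ⟪x, γ⟫_ℝ) hs
    have hαγ : ⟪α, γ⟫_ℝ = 0 := by rw [real_inner_comm]; exact h
    rw [inner_sub_left, inner_smul_left, hαγ, real_inner_self_eq_norm_sq, mul_zero, zero_sub,
      neg_eq_zero] at this
    exact (hR.norm_sq_ne_zero hγ this).elim
  · have h2 := congrArg (fun x => ⟪x, α⟫_ℝ) hj
    simp only [inner_smul_left, inner_sub_left, h, hγ', real_inner_self_eq_norm_sq, sub_zero,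
      RCLike.conj_to_real] at h2
    have hj1 : j = 1 := (mul_eq_right₀ hα2).1 h2.symm
    rw [hj1, one_smul, sub_right_inj] at hj
    rw [hj, hn]

/-- Reflecting α - γ in γ gives α + γ; negation gives the other two sign patterns. -/
theorem sign_add_sign_mem {α γ : E} (hγ : γ ∈ R) (h : ⟪γ, α⟫_ℝ = 0) (hd : α - γ ∈ R) {s t : ℝ}
    (hs : s = 1 ∨ s = -1) (ht : t = 1 ∨ t = -1) : s • α + t • γ ∈ R := by
  have hadd : α + γ ∈ R := by
    have := hR.reflect_mem hγ hd (n := -2) (by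
      rw [inner_sub_left, real_inner_comm, h, real_inner_self_eq_norm_sq]; ring)
    rw [neg_smul, sub_neg_eq_add, two_smul] at this
    convert this using 1
    abel
  rcases hs with rfl | rfl <;> rcases ht with rfl | rfl
  · rwa [one_smul, one_smul]
  · rwa [one_smul, neg_one_smul, ← sub_eq_add_neg]
  · have := hR.neg_mem hd
    rwa [neg_sub, sub_eq_neg_add, ← neg_one_smul ℝ, ← one_smul ℝ γ] at this
  · have := hR.neg_mem hadd
    rwa [neg_add, ← neg_one_smul ℝ, ← neg_one_smul ℝ γ] at this

end IsIrreducibleRootSet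

/-- The roots `γ` such that `2 γ` is a root and `γ` is equal to `± α₀` or is joined to `α₀` by the
root `α₀ - γ`. -/
def doubleComponent {E : Type*} [NormedAddCommGroup E] [InnerProductSpace ℝ E] (R : Set E)
    (α₀ : E) : Set E :=
  {γ | γ ∈ R ∧ (2 : ℝ) • γ ∈ R ∧ (γ = α₀ ∨ γ = -α₀ ∨ (⟪γ, α₀⟫_ℝ = 0 ∧ α₀ - γ ∈ R))}

namespace IsIrreducibleRootSet

variable {E : Type*} [NormedAddCommGroup E] [InnerProductSpace ℝ E] {R : Set E}
  (hR : IsIrreducibleRootSet R) {α₀ : E} (hα₀ : α₀ ∈ R) (h2α₀ : (2 : ℝ) • α₀ ∈ R)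

include hR hα₀ h2α₀

theorem norm_sq_doubleComponent {γ : E} (hγ : γ ∈ doubleComponent R α₀) :
    ‖γ‖ ^ 2 = ‖α₀‖ ^ 2 := by
  obtain ⟨h1, -, rfl | rfl | ⟨h, hd⟩⟩ := hγ
  · rfl
  · rw [norm_neg]
  · exact hR.norm_sq_eq hα₀ h2α₀ h1 h hd

theorem neg_mem_doubleComponent {γ : E} (hγ : γ ∈ doubleComponent R α₀) :
    -γ ∈ doubleComponent R α₀ := by
  obtain ⟨h1, h2, h⟩ := hγ
  refine ⟨hR.neg_mem h1, by rw [smul_neg]; exact hR.neg_mem h2, ?_⟩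
  rcases h with rfl | rfl | ⟨h, hd⟩
  · exact Or.inr (Or.inl rfl)
  · exact Or.inl (neg_neg _)
  · refine Or.inr (Or.inr ⟨by rw [inner_neg_left, h, neg_zero], ?_⟩)
    simpa using hR.sign_add_sign_mem h1 h hd (Or.inl rfl) (Or.inl rfl)

/-- When γ and δ are both orthogonal to α₀, reflecting α₀ - δ in α₀ - γ yields γ - δ. The other
cases involve ±α₀ itself. -/
theorem sub_mem_of_mem_doubleComponent {γ δ : E} (hγ : γ ∈ doubleComponent R α₀)
    (hδ : δ ∈ doubleComponent R α₀) (hγδ : ⟪γ, δ⟫_ℝ = 0) : γ - δ ∈ R := by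
  have h0 : ∀ {a d : E}, (a = α₀ ∨ a = -α₀) → (d = α₀ ∨ d = -α₀) → ⟪a, d⟫_ℝ = 0 → False := by
    intro a d ha hd had
    refine hR.norm_sq_ne_zero hα₀ ?_
    rcases ha with rfl | rfl <;> rcases hd with rfl | rfl <;>
      simpa [inner_neg_left, inner_neg_right, real_inner_self_eq_norm_sq] using had
  have h1 : ∀ {a d : E}, (a = α₀ ∨ a = -α₀) → d ∈ doubleComponent R α₀ → ⟪a, d⟫_ℝ = 0 →
      a - d ∈ R := by
    rintro a d ha ⟨hd1, -, hd⟩ had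
    rcases or_assoc.2 hd with hd | ⟨hd, hd'⟩
    · exact (h0 ha hd had).elim
    · rcases ha with rfl | rfl
      · exact hd'
      · have := hR.sign_add_sign_mem hd1 hd hd' (Or.inr rfl) (Or.inr rfl)
        rwa [neg_one_smul, neg_one_smul, ← sub_eq_add_neg] at this
  rcases or_assoc.2 hγ.2.2 with hγ' | ⟨hγ', hγd⟩
  · exact h1 hγ' hδ hγδ
  rcases or_assoc.2 hδ.2.2 with hδ' | ⟨hδ', hδd⟩
  · rw [← neg_sub]
    exact hR.neg_mem (h1 hδ' hγ (by rw [real_inner_comm]; exact hγδ))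
  · have := hR.reflect_mem hγd hδd (n := 1) (by
      have hγ'' : ⟪α₀, γ⟫_ℝ = 0 := by rw [real_inner_comm]; exact hγ'
      have hδγ : ⟪δ, γ⟫_ℝ = 0 := by rw [real_inner_comm]; exact hγδ
      rw [norm_sub_sq_real, hR.norm_sq_doubleComponent hα₀ h2α₀ hγ, inner_sub_left,
        inner_sub_right, inner_sub_right, hγ'', hδ', hδγ, real_inner_self_eq_norm_sq]
      ring)
    rwa [one_smul, sub_sub_sub_cancel_left] at this

/-- A chain of two joins from α₀ through α to γ can be shortened: a reflection combines α - γ and α₀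
- α into α₀ - γ. -/
theorem mem_doubleComponent_of_sub_mem {α γ : E} (hα : α ∈ doubleComponent R α₀) (hγ : γ ∈ R)
    (h2γ : (2 : ℝ) • γ ∈ R) (h : ⟪γ, α⟫_ℝ = 0) (hd : α - γ ∈ R) : γ ∈ doubleComponent R α₀ := by
  refine ⟨hγ, h2γ, ?_⟩
  obtain ⟨hα1, hα2, rfl | rfl | ⟨hα3, hα4⟩⟩ := hα
  · exact Or.inr (Or.inr ⟨h, hd⟩)
  · refine Or.inr (Or.inr ⟨by rwa [inner_neg_right, neg_eq_zero] at h, ?_⟩)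
    have := hR.sign_add_sign_mem hγ h hd (Or.inr rfl) (Or.inr rfl)
    rwa [neg_one_smul, neg_one_smul, neg_neg, ← sub_eq_add_neg] at this
  · rcases hR.double_trichotomy hα₀ h2α₀ hγ h2γ with h0 | h0 | h0
    · refine Or.inr (Or.inr ⟨h0, ?_⟩)
      have := hR.reflect_mem hd hα4 (n := -1) (by
        have hα3' : ⟪α₀, α⟫_ℝ = 0 := by rw [real_inner_comm]; exact hα3
        have h0' : ⟪α₀, γ⟫_ℝ = 0 := by rw [real_inner_comm]; exact h0
        have h' : ⟪α, γ⟫_ℝ = 0 := by rw [real_inner_comm]; exact h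
        rw [norm_sub_sq_real, hR.norm_sq_eq hα1 hα2 hγ h hd, inner_sub_left, inner_sub_right,
          inner_sub_right, hα3', h0', h', real_inner_self_eq_norm_sq]
        ring)
      rwa [neg_one_smul, sub_neg_eq_add, sub_add_sub_cancel] at this
    · exact Or.inl h0
    · exact Or.inr (Or.inl h0)

/-- The roots not orthogonal to the component are combinations of its elements, hence orthogonal to
all remaining roots; irreducibility leaves no remaining ones. -/
theorem exists_inner_ne_zero {β : E} (hβ : β ∈ R) :
    ∃ α ∈ doubleComponent R α₀, ⟪β, α⟫_ℝ ≠ 0 := by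
  have key : {β | β ∈ R ∧ ∃ α ∈ doubleComponent R α₀, ⟪β, α⟫_ℝ ≠ 0} = R := by
    refine hR.irreducible _ (fun β hβ => hβ.1) ⟨α₀, hα₀, α₀, ⟨hα₀, h2α₀, Or.inl rfl⟩, ?_⟩ ?_
    · rw [real_inner_self_eq_norm_sq]; exact hR.norm_sq_ne_zero hα₀
    · rintro β ⟨hβ, α, hα, hne⟩ β' hβ' hn
      have horth : ∀ γ ∈ doubleComponent R α₀, ⟪γ, β'⟫_ℝ = 0 := fun γ hγ => by
        by_contra h
        exact hn ⟨hβ', γ, hγ, by rwa [real_inner_comm]⟩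
      rcases hR.eq_of_inner_double_ne_zero hα.1 hα.2.1 hβ hne with
        ⟨s, -, rfl⟩ | ⟨γ, hγ, h2γ, h, -, j, hj, rfl⟩
      · rw [inner_smul_left, horth α hα, mul_zero]
      · have hd : α - γ ∈ R := by
          have := hR.sign_smul_mem hβ hj
          rwa [smul_smul, show j * j = 1 by rcases hj with rfl | rfl <;> norm_num,
            one_smul] at this
        rw [inner_smul_left, inner_sub_left, horth α hα,
          horth γ (hR.mem_doubleComponent_of_sub_mem hα₀ h2α₀ hα hγ h2γ h hd), sub_zero, mul_zero]
  exact (key.symm ▸ hβ : β ∈ {β | β ∈ R ∧ ∃ α ∈ doubleComponent R α₀, ⟪β, α⟫_ℝ ≠ 0}).2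

theorem eq_smul_or_eq_smul_sub {β : E} (hβ : β ∈ R) :
    (∃ α ∈ doubleComponent R α₀, ∃ s : ℝ, (s = 1 ∨ s = -1 ∨ s = 2 ∨ s = -2) ∧ β = s • α) ∨
      ∃ α ∈ doubleComponent R α₀, ∃ γ ∈ doubleComponent R α₀, ⟪α, γ⟫_ℝ = 0 ∧ β = α - γ := by
  obtain ⟨α, hα, hne⟩ := hR.exists_inner_ne_zero hα₀ h2α₀ hβ
  rcases hR.eq_of_inner_double_ne_zero hα.1 hα.2.1 hβ hne with
    ⟨s, hs, h⟩ | ⟨γ, hγ, h2γ, h, -, j, hj, rfl⟩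
  · exact Or.inl ⟨α, hα, s, hs, h⟩
  · have hd : α - γ ∈ R := by
      have := hR.sign_smul_mem hβ hj
      rwa [smul_smul, show j * j = 1 by rcases hj with rfl | rfl <;> norm_num, one_smul] at this
    have hγ' := hR.mem_doubleComponent_of_sub_mem hα₀ h2α₀ hα hγ h2γ h hd
    right
    rcases hj with rfl | rfl
    · exact ⟨α, hα, γ, hγ', by rwa [real_inner_comm], by rw [one_smul]⟩
    · exact ⟨γ, hγ', α, hα, h, by rw [neg_one_smul, neg_sub]⟩

/-- An irreducible root system which contains a root and its double is of type `BC`. -/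
theorem exists_orthonormalBasis [FiniteDimensional ℝ E] :
    ∃ (l : ℕ) (e : OrthonormalBasis (Fin l) ℝ E) (c : ℝ), 1 ≤ l ∧ 0 < c ∧
      R = {α | ∃ i, ∃ s ∈ ({1, -1, 2, -2} : Set ℝ), α = (s * c) • e i} ∪
        {α | ∃ i j, i < j ∧ ∃ s ∈ ({1, -1} : Set ℝ), ∃ t ∈ ({1, -1} : Set ℝ),
          α = c • (s • e i + t • e j)} := by
  classical
  set b := Module.finBasis ℝ E
  -- One representative of each pair ±γ in the component. These have equal norms and are pairwise
  -- orthogonal, so normalized they give the basis e.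
  set P : Set E := {γ | γ ∈ doubleComponent R α₀ ∧ LexPos b γ} with hPdef
  have : Finite P := (hR.finite.subset fun γ hγ => hγ.1.1).to_subtype
  have : Fintype P := Fintype.ofFinite P
  have hc : 0 < ‖α₀‖ := norm_pos_iff.2 (hR.ne_zero _ hα₀)
  have hnorm : ∀ γ ∈ doubleComponent R α₀, ‖γ‖ = ‖α₀‖ := fun γ hγ =>
    (sq_eq_sq₀ (norm_nonneg _) (norm_nonneg _)).1 (hR.norm_sq_doubleComponent hα₀ h2α₀ hγ)
  have hon : Orthonormal ℝ (fun γ : P => ‖α₀‖⁻¹ • (γ : E)) := by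
    refine ⟨fun γ => ?_, fun γ δ hγδ => ?_⟩
    · rw [norm_smul, hnorm γ γ.2.1, norm_inv, norm_norm, inv_mul_cancel₀ hc.ne']
    · dsimp only
      rw [inner_smul_left, inner_smul_right]
      rcases hR.double_trichotomy δ.2.1.1 δ.2.1.2.1 γ.2.1.1 γ.2.1.2.1 with h | h | h
      · rw [h, mul_zero, mul_zero]
      · exact (hγδ (Subtype.ext h)).elim
      · exact (δ.2.2.not_neg (h ▸ γ.2.2)).elim
  have hP : ∀ γ ∈ doubleComponent R α₀, ∃ δ : P, ∃ s ∈ ({1, -1} : Set ℝ), γ = s • (δ : E) := by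
    intro γ hγ
    rcases lexPos_or_neg (b := b) (hR.ne_zero _ hγ.1) with h | h
    · exact ⟨⟨γ, hγ, h⟩, 1, by simp, by simp⟩
    · exact ⟨⟨-γ, hR.neg_mem_doubleComponent hα₀ h2α₀ hγ, h⟩, -1, by simp, by simp⟩
  -- A vector orthogonal to the component is orthogonal to every root by `eq_smul_or_eq_smul_sub`,
  -- and the roots span.
  have hbot : (Submodule.span ℝ (Set.range fun γ : P => ‖α₀‖⁻¹ • (γ : E)))ᗮ = ⊥ := by
    rw [Submodule.eq_bot_iff]
    intro A hA
    have hA' : ∀ γ ∈ doubleComponent R α₀, ⟪γ, A⟫_ℝ = 0 := by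
      intro γ hγ
      obtain ⟨δ, s, -, rfl⟩ := hP γ hγ
      have := (Submodule.mem_orthogonal _ _).1 hA _ (Submodule.subset_span (mem_range_self δ))
      rw [inner_smul_left] at this
      rw [inner_smul_left, (mul_eq_zero.1 this).resolve_left (by simpa using hc.ne'), mul_zero]
    refine hR.span A fun β hβ => ?_
    rcases hR.eq_smul_or_eq_smul_sub hα₀ h2α₀ hβ with
      ⟨α, hα, s, -, rfl⟩ | ⟨α, hα, γ, hγ, -, rfl⟩
    · rw [inner_smul_left, hA' α hα, mul_zero]
    · rw [inner_sub_left, hA' α hα, hA' γ hγ, sub_zero]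
  set e := (OrthonormalBasis.mkOfOrthogonalEqBot hon hbot).reindex (Fintype.equivFin P) with he
  have heP : ∀ δ : P, ‖α₀‖ • e (Fintype.equivFin P δ) = δ := fun δ => by
    rw [he, OrthonormalBasis.reindex_apply, Equiv.symm_apply_apply,
      OrthonormalBasis.coe_of_orthogonal_eq_bot_mk, smul_smul, mul_inv_cancel₀ hc.ne', one_smul]
  have hmem : ∀ i, ‖α₀‖ • e i ∈ doubleComponent R α₀ := fun i => by
    have := heP ((Fintype.equivFin P).symm i)
    rw [Equiv.apply_symm_apply] at this
    rw [this]
    exact ((Fintype.equivFin P).symm i).2.1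
  have hex : ∀ γ ∈ doubleComponent R α₀, ∃ i, ∃ s ∈ ({1, -1} : Set ℝ), γ = (s * ‖α₀‖) • e i := by
    intro γ hγ
    obtain ⟨δ, s, hs, rfl⟩ := hP γ hγ
    exact ⟨Fintype.equivFin P δ, s, hs, by rw [mul_smul, heP]⟩
  refine ⟨Fintype.card P, e, ‖α₀‖, ?_, hc, Set.Subset.antisymm (fun β hβ => ?_) ?_⟩
  · obtain ⟨δ, -⟩ := hP α₀ ⟨hα₀, h2α₀, Or.inl rfl⟩
    exact Fintype.card_pos_iff.2 ⟨δ⟩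
  · rcases hR.eq_smul_or_eq_smul_sub hα₀ h2α₀ hβ with
      ⟨α, hα, s, hs, rfl⟩ | ⟨α, hα, γ, hγ, h, rfl⟩
    · obtain ⟨i, t, ht, rfl⟩ := hex α hα
      refine Or.inl ⟨i, s * t, ?_, by rw [smul_smul, mul_assoc]⟩
      rcases hs with rfl | rfl | rfl | rfl <;> rcases ht with rfl | rfl <;> norm_num
    · obtain ⟨i, s, hs, rfl⟩ := hex α hα
      obtain ⟨j, t, ht, rfl⟩ := hex γ hγ
      have hs0 : s ≠ 0 := by rcases hs with rfl | rfl <;> norm_num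
      have ht0 : t ≠ 0 := by rcases ht with rfl | rfl <;> norm_num
      have ht' : -t ∈ ({1, -1} : Set ℝ) := by rcases ht with rfl | rfl <;> norm_num
      right
      rcases lt_trichotomy i j with hij | rfl | hij
      · exact ⟨i, j, hij, s, hs, -t, ht', by module⟩
      · rw [inner_smul_left, inner_smul_right, real_inner_self_eq_norm_sq,
          e.orthonormal.norm_eq_one] at h
        simp [hs0, ht0, hR.ne_zero _ hα₀] at h
      · exact ⟨j, i, hij, -t, ht', s, hs, by module⟩
  · rintro β (⟨i, s, hs, rfl⟩ | ⟨i, j, hij, s, hs, t, ht, rfl⟩)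
    · obtain ⟨h1, h2, -⟩ := hmem i
      rw [mul_smul]
      rcases hs with rfl | rfl | rfl | rfl
      · exact hR.sign_smul_mem h1 (Or.inl rfl)
      · exact hR.sign_smul_mem h1 (Or.inr rfl)
      · exact h2
      · rw [neg_smul]; exact hR.neg_mem h2
    · have h0 : ∀ {i j}, i ≠ j → ⟪‖α₀‖ • e i, ‖α₀‖ • e j⟫_ℝ = 0 := fun h => by
        rw [inner_smul_left, inner_smul_right, e.orthonormal.inner_eq_zero h, mul_zero, mul_zero]
      have := hR.sign_add_sign_mem (hmem j).1 (h0 hij.ne')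
        (hR.sub_mem_of_mem_doubleComponent hα₀ h2α₀ (hmem i) (hmem j) (h0 hij.ne)) hs ht
      convert this using 1
      module

end IsIrreducibleRootSet

/-! ### Translation to the symmetric pair and conclusion. -/

section SymmetricPair

variable {d : ℕ} {G : Type*} [TopologicalSpace G] [ChartedSpace (EuclideanSpace ℝ (Fin d)) G]
  [Group G] [LieGroup (𝓡 d) ∞ G] [RiemannianBundle (fun x : G => TangentSpace (𝓡 d) x)]
  {θ : G →* G} (hθ : ContMDiff (𝓡 d) (𝓡 d) ∞ (fun x : G => θ x)) (hinv : ∀ x, θ (θ x) = x)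
  (hinner : IsInvariantInner d θ) {𝔞 : Submodule ℝ (GroupLieAlgebra (𝓡 d) G)}

theorem restrictedRootSpace_eq (α : 𝔞) :
    restrictedRootSpace 𝔞 α = (groupSymmetricLie hθ hinv hinner).complexRootSpace α := rfl

theorem restrictedRoots_eq : restrictedRoots 𝔞 = (groupSymmetricLie hθ hinv hinner).roots 𝔞 := by
  ext α
  refine and_congr_right fun hα => not_congr ?_
  rw [restrictedRootSpace_eq hθ hinv hinner]
  exact SymmetricLie.complexRootSpace_eq_bot_iff hα

theorem isMaxAbelian (h : IsMaximalAbelianIn θ 𝔞) :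
    (groupSymmetricLie hθ hinv hinner).IsMaxAbelian 𝔞 :=
  SymmetricLie.IsMaxAbelian.of_maximal h

theorem rootMult_eq (h : IsMaximalAbelianIn θ 𝔞) {α : 𝔞} (hα : α ≠ 0) :
    rootMult 𝔞 α = (groupSymmetricLie hθ hinv hinner).mult α :=
  SymmetricLie.finrank_complexRootSpace (isMaxAbelian hθ hinv hinner h) hα

theorem parallelMult_eq (h : IsMaximalAbelianIn θ 𝔞) {P : Set 𝔞} (hP : ∀ μ ∈ P, μ ≠ 0) (α : 𝔞) :
    parallelMult P α = parallelSum (groupSymmetricLie hθ hinv hinner).mult P α :=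
  finsum_mem_congr rfl fun μ hμ => rootMult_eq hθ hinv hinner h (hP μ hμ.1)

theorem isHalf_rootsNotOrthogonal {r : ℕ} (b : Module.Basis (Fin r) ℝ 𝔞) (H : 𝔞) :
    (groupSymmetricLie hθ hinv hinner).IsHalf H (rootsNotOrthogonal b H) where
  mem_roots α hα := restrictedRoots_eq hθ hinv hinner ▸ hα.1.1
  inner_ne_zero α hα := hα.2
  mem_or_neg_mem α hα hαH := by
    have hα' := SymmetricLie.neg_mem_roots hα
    rw [← restrictedRoots_eq] at hα hα'
    rcases lexPos_or_neg (b := b) hα.1 with h | h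
    · exact Or.inl ⟨⟨hα, h⟩, hαH⟩
    · exact Or.inr ⟨⟨hα', h⟩, by rwa [inner_neg_left, neg_ne_zero]⟩
  neg_notMem α hα h := LexPos.not_neg hα.1.2 h.1.2

/-- For an irreducible pair, the `θ`-symmetric Lie algebra is irreducible. -/
theorem isIrreducible_groupSymmetricLie [T2Space G] [CompactSpace G] [ConnectedSpace G]
    {K : Subgroup G} (hpair : IsSymmetricPair d θ K) (hirr : IsIrreduciblePair d θ K) :
    (groupSymmetricLie hpair.smooth hpair.involutive hinner).IsIrreducible := by
  intro 𝔫 h𝔫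
  -- R, for the trivial involution, integrates the ideal 𝔫 to an Ad(G)-invariant subspace; R', for
  -- θ, shows that Ad(K) preserves 𝔪. Then 𝔫 ∩ 𝔪 is an invariant subspace of an irreducible
  -- representation.
  obtain ⟨R, hR⟩ := exists_isotropyRep (isSymmetricPair_id (d := d) (G := G)) hinner.id
  obtain ⟨R', hR'⟩ := exists_isotropyRep hpair hinner
  have : IsTopologicalGroup G := topologicalGroup_of_lieGroup (𝓡 d) ∞
  have : ConnectedSpace (⊤ : Subgroup G) :=
    isConnected_iff_connectedSpace.1 (by simpa using isConnected_univ (α := G))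
  have hAd : ∀ (g : G), ∀ X ∈ 𝔫, lieAd g X ∈ 𝔫 := fun g X hX => by
    rw [← hR ⟨g, Subgroup.mem_top g⟩ X]
    exact R.ρ_mem_of_forall_ad_mem (fun z _ Y hY => h𝔫 z Y hY) _ hX
  have hinvt : ∀ k ∈ K, ∀ X ∈ 𝔫 ⊓ mSpace d θ, lieAd k X ∈ 𝔫 ⊓ mSpace d θ := by
    intro k hk X hX
    refine ⟨hAd k X hX.1, ?_⟩
    rw [← hR' ⟨k, hk⟩ X]
    have h1 := R'.ρ_θ ⟨k, hk⟩ X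
    have h2 : (groupSymmetricLie hpair.smooth hpair.involutive hinner).θ X = -X := hX.2
    rw [h2, map_neg] at h1
    exact h1.symm
  rcases hirr.2 (𝔫 ⊓ mSpace d θ) inf_le_right hinvt with h | h
  · exact Or.inl h
  · exact Or.inr (inf_eq_right.1 h)

theorem isIrreducibleRootSet [T2Space G] [CompactSpace G] [ConnectedSpace G]
    {K : Subgroup G} (hpair : IsSymmetricPair d θ K) (hinner : IsInvariantInner d θ)
    (hirr : IsIrreduciblePair d θ K) (h𝔞 : IsMaximalAbelianIn θ 𝔞) (hne : (restrictedRoots 𝔞).Nonempty) :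
    IsIrreducibleRootSet (restrictedRoots 𝔞) := by
  have hD := isIrreducible_groupSymmetricLie hinner hpair hirr
  have h𝔞' := isMaxAbelian hpair.smooth hpair.involutive hinner h𝔞
  rw [restrictedRoots_eq hpair.smooth hpair.involutive hinner] at hne ⊢
  exact
    { finite := SymmetricLie.roots_finite
      ne_zero := fun α hα => hα.1
      integral := fun α hα β hβ => SymmetricLie.exists_int_eq h𝔞' hα hβ
      reflect := fun α hα β hβ => SymmetricLie.reflect_mem_roots h𝔞' hα hβ
      span := fun A hA => hD.eq_zero_of_forall_inner h𝔞' hne hA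
      irreducible := fun S hS hne' h => hD.roots_irreducible h𝔞' hS hne' h }

theorem isotropyOrbit_eq {K : Subgroup G} (hpair : IsSymmetricPair d θ K)
    (R : IsotropyRep (groupSymmetricLie hpair.smooth hpair.involutive hinner) K)
    (hR : ∀ (k : K) (X : GroupLieAlgebra (𝓡 d) G), R.ρ k X = lieAd (k : G) X)
    {H : GroupLieAlgebra (𝓡 d) G} (hH : H ∈ mSpace d θ) :
    isotropyOrbit θ K H = R.toSmoothAction.orbit ⟨H, hH⟩ := by
  ext X
  constructor
  · rintro ⟨k, hk, h⟩
    exact ⟨⟨k, hk⟩, Subtype.ext (by rw [R.coe_act, hR]; exact h)⟩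
  · rintro ⟨k, rfl⟩
    exact ⟨k, k.2, by rw [R.coe_act, hR]⟩

end SymmetricPair

theorem mainTheorem3 {d : ℕ} {G : Type*} [TopologicalSpace G]
    [ChartedSpace (EuclideanSpace ℝ (Fin d)) G] [Group G] [LieGroup (𝓡 d) ∞ G]
    [T2Space G] [CompactSpace G] [ConnectedSpace G]
    [RiemannianBundle (fun x : G => TangentSpace (𝓡 d) x)]
    (θ : G →* G) (K : Subgroup G) (hpair : IsSymmetricPair d θ K)
    (hinner : IsInvariantInner d θ) (hirr : IsIrreduciblePair d θ K)
    (𝔞 : Submodule ℝ (GroupLieAlgebra (𝓡 d) G)) (h𝔞 : IsMaximalAbelianIn θ 𝔞)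
    {r : ℕ} (b : Module.Basis (Fin r) ℝ 𝔞)
    (H : 𝔞) (hH : ¬ ∃ α ∈ restrictedRoots 𝔞, ∃ x : ℝ, H = x • α) :
    (restrictedRoots 𝔞).Finite ∧
    (∀ Δ ⊆ simpleRoots b, H ∈ chamberFace b Δ →
      positiveRoots b \ positiveRootsOfFace b Δ = rootsNotOrthogonal b H) ∧
    (IsAustereInSphere ‖H‖ (isotropyOrbit θ K (H : GroupLieAlgebra (𝓡 d) G)) ↔
      ∃ f : rootsNotOrthogonal b H → rootsNotOrthogonal b H, IsAusterePairing H f ∧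
        ∀ α : rootsNotOrthogonal b H, parallelMult (rootsNotOrthogonal b H) (α : 𝔞) =
          parallelMult (rootsNotOrthogonal b H) (f α : 𝔞)) ∧
    (¬ IsTypeBC (restrictedRoots 𝔞) →
      ∀ f : rootsNotOrthogonal b H → rootsNotOrthogonal b H, IsAusterePairing H f →
        (∀ α : rootsNotOrthogonal b H, parallelMult (rootsNotOrthogonal b H) (α : 𝔞) =
            parallelMult (rootsNotOrthogonal b H) (f α : 𝔞) ↔
          rootMult 𝔞 (α : 𝔞) = rootMult 𝔞 (f α : 𝔞)) ∧
        (∀ α : rootsNotOrthogonal b H, f (f α) = α) ∧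
        Even (rootsNotOrthogonal b H).ncard) := by
  have h𝔞' := isMaxAbelian hpair.smooth hpair.involutive hinner h𝔞
  have hroots := restrictedRoots_eq (𝔞 := 𝔞) hpair.smooth hpair.involutive hinner
  have hfin : (restrictedRoots 𝔞).Finite := by
    rw [hroots]
    exact SymmetricLie.roots_finite
  have hhalf := isHalf_rootsNotOrthogonal hpair.smooth hpair.involutive hinner b H
  have hPfin : (rootsNotOrthogonal b H).Finite := hfin.subset fun α hα => hα.1.1
  have hPH : ∀ α ∈ rootsNotOrthogonal b H, ¬ ∃ x : ℝ, H = x • α := fun α hα ⟨x, hx⟩ =>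
    hH ⟨α, hα.1.1, x, hx⟩
  refine ⟨hfin, fun Δ _ hHΔ => ?_, ?_, fun hBC f hf => ?_⟩
  · obtain ⟨h0, hΔ, hF⟩ := hHΔ
    have key := inner_nonneg_and_mem_span (b := b) (hfin.subset fun α (hα : α ∈ positiveRoots b) =>
      hα.1) (fun α hα => hα.2) (F := simpleRoots b) rfl h0 hΔ
    have hspan : ∀ α ∈ Submodule.span ℤ (simpleRoots b \ Δ), ⟪α, H⟫_ℝ = 0 := fun α hα => by
      induction hα using Submodule.span_induction with
      | mem x hx => exact hF x hx
      | zero => exact inner_zero_left H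
      | add x y _ _ hx hy => rw [inner_add_left, hx, hy, add_zero]
      | smul n x _ hx => rw [← Int.cast_smul_eq_zsmul ℝ, inner_smul_left, hx, mul_zero]
    ext α
    refine ⟨fun hα => ⟨hα.1, fun h => hα.2 ⟨hα.1, (key α hα.1).2 h⟩⟩, fun hα => ⟨hα.1, fun h =>
      hα.2 (hspan α h.2)⟩⟩
  · obtain ⟨R, hR⟩ := exists_isotropyRep hpair hinner
    have : IsTopologicalGroup G := topologicalGroup_of_lieGroup (𝓡 d) ∞
    have : CompactSpace K := isCompact_iff_compactSpace.1 hpair.isClosed.isCompact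
    have hP0 : ∀ μ ∈ rootsNotOrthogonal b H, μ ≠ 0 := fun μ hμ => hμ.1.1.1
    simp only [parallelMult_eq hpair.smooth hpair.involutive hinner h𝔞 hP0]
    have hPne : ∀ α ∈ rootsNotOrthogonal b H, ⟪α, H⟫_ℝ ≠ 0 := fun α hα => hα.2
    -- Only the recorded properties of P_H matter from here on, so it may be replaced by an
    -- arbitrary finite half-system.
    generalize rootsNotOrthogonal b H = S at hhalf hPfin hPH hPne
    lift S to Finset 𝔞 using hPfin
    rw [isotropyOrbit_eq hinner hpair R hR (h𝔞'.le_m H.2)]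
    refine (R.isAustereInSphere_orbit_iff h𝔞' hhalf).trans ?_
    exact forall_sum_eq_iff_exists_pairing
      (fun α hα => SymmetricLie.mult_pos h𝔞' (hhalf.mem_roots α hα)) hPne hPH
  · refine IsPairing.of_reduced hPfin (fun α hα => hα.2) hPH (fun α hα β hβ hαβ => ?_) hf
    -- Excluding type BC makes R reduced. Parallel roots are then equal or opposite, and opposite
    -- roots are not both positive.
    have hR := isIrreducibleRootSet hpair hinner hirr h𝔞 ⟨α, hα.1.1⟩
    have hred : ¬ ∃ α ∈ restrictedRoots 𝔞, (2 : ℝ) • α ∈ restrictedRoots 𝔞 := by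
      rintro ⟨α₀, h1, h2⟩
      exact hBC (hR.exists_orthonormalBasis h1 h2)
    rcases hR.eq_or_eq_neg_of_parallel hred hα.1.1 hβ.1.1 hαβ with h | h
    · exact h
    · exact (hhalf.neg_notMem α hα (h ▸ hβ)).elim
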